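/- **Definitions.** Words are binary words of length $12$; their coordinates are numbered $0,1,\dots,9,a,b$ from left to right ($a=10$, $b=11$). The halved $12$-cube is the graph of the even-weight words, two words being adjacent iff they differ in exactly two positions; $J(12,6)$ is its subgraph induced by the words of weight $6$. An $S(5,6,12)$ is a set of vertices of $J(12,6)$ that meets every maximum clique of $J(12,6)$ in exactly one word. A *constant-weight trade* (of length $12$) is an ordered pair $(T_0,T_1)$ of disjoint nonempty sets of words of weight $6$ such that $|T_0\cap B|=|T_1\cap B|\in\{0,1\}$ for every maximum clique $B$ of the halved $12$-cube; its *volume* is $|T_0|$. It is *primary* if there are no two trades $(T_0',T_1')$, $(T_0'',T_1'')$ in the halved $12$-cube such that $T_i$ is the disjoint union of $T_i'$ and $T_i''$ for $i=0,1$. Two pairs $(S_0,S_1)$, $(C_0,C_1)$ of sets of vertices of the halved $12$-cube are *equivalent* if some automorphism $\pi$ of the halved $12$-cube satisfies $\pi(S_0)=C_0,\ \pi(S_1)=C_1$ or $\pi(S_0)=C_1,\ \pi(S_1)=C_0$. A *Witt difference pair* is a pair $(W_0\setminus W_1,\,W_1\setminus W_0)$, where $W_0\neq W_1$ are two $S(5,6,12)$.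 **The 25 trades.** For each name below, $G$ is the group of coordinate permutations generated by the listed permutations, $T_0$ is the union of the $G$-orbits of the words listed for $T_0$, and $T_1$ is either the union of the $G$-orbits of the words listed for $T_1$, or the image $\sigma(T_0)$ under the listed coordinate permutation $\sigma$. - **32**: $G=\langle (89)(ab),\ (8a)(9b),\ (02468)(13579)\rangle$; $T_0$: $010101010101$; $T_1=\sigma(T_0)$, $\sigma=(ab)$. - **48**: $G=\langle (012)(465),\ (01)(23),\ (45)(67),\ (02)(46)(89),\ (89)(ab),\ (8a)(9b),\ (04)(15)(26)(37)\rangle$; $T_0$: $010100110101$; $T_1=\sigma(T_0)$, $\sigma=(ab)$. - **56a**: $G=\langle (0123456),\ (13)(24)(67)(89),\ (89)(ab),\ (8a)(9b)\rangle$; $T_0$: $010001110101$; $T_1=\sigma(T_0)$, $\sigma=(ab)$. - **56b**: $G=\langle (01)(23),\ (02)(13),\ (048)(159)(26a)(37b),\ (04)(15)(26)(37)\rangle$; $T_0$: $011001100110$, $001101010101$, $001100110110$; $T_1=\sigma(T_0)$, $\sigma=(01)(45)(89)$. - **68**: $G=\langle (123)(567),\ (05)(14)(26)(37),\ (89)(ab),\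 (8a)(9b)\rangle$; $T_0$: $000011110110$, $001100110101$, $001111000101$, $000111100011$, $001101100110$; $T_1$: $000011110011$, $001100110110$, $001111000011$, $000111100110$, $001101100101$. - **72a**: $G=\langle (01)(23),\ (012)(465),\ (048)(159)(26a)(37b),\ (04)(15)(26)(37)\rangle$; $T_0$: $001100110011$; $T_1=\sigma(T_0)$, $\sigma=(01)(45)(8a)$. - **72b**: $G=\langle (0187)(2365),\ (09)(48)(57)(ab)\rangle$; $T_0$: $000011110101$; $T_1=\sigma(T_0)$, $\sigma=(ab)$. - **72c**: $G=\langle (01)(23)(45)(67),\ (89)(ab),\ (123)(567)(9ab),\ (04)(15)(26)(37)\rangle$; $T_0$: $011010010011$, $010101010011$, $000110110011$; $T_1=\sigma(T_0)$, $\sigma=(01)(45)(89)$. - **72d**: $G=\langle (012)(678),\ (12)(45)(78)(ab),\ (03)(14)(25)(69)(7a)(8b),\ (06)(17)(28)(39)(4a)(5b)\rangle$; $T_0$: $001101010011$, $001101011100$; $T_1=\sigma(T_0)$, $\sigma=(12)(78)$. - **80a**: $G=\langle (01234)(6789a),\ (1342)(79a8),\ (05)(23)(6b)(89),\ (06)(17)(28)(39)(4a)(5b)\rangle$;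 $T_0$: $000111111000$, $000111010110$; $T_1$: $000111000111$, $000111101001$. - **80b**: $G=\langle (01)(23)(45)(67),\ (123)(567),\ (04)(15)(27)(36),\ (89)(ab),\ (8a)(9b)\rangle$; $T_0$: $000011110110$, $001100110011$, $000111100011$, $001101100101$, $001101010110$; $T_1=\sigma(T_0)$, $\sigma=(23)(67)(9b)$. - **86**: $G=\langle (012)(345),\ (05)(14)(23)(6b)(7a)(89),\ (06)(17)(28)(39)(4a)(5b)\rangle$; $T_0$: $000111111000$, $000111001110$, $001100011101$, $001001011011$, $001011011100$; $T_1$: $000111000111$, $000111011100$, $001011011010$, $001110001110$, $001001011101$, $110110100010$. - **92a**: $G=\langle (01234)(6789a),\ (1342)(79a8),\ (05)(23)(6b)(89),\ (06)(17)(28)(39)(4a)(5b)\rangle$; $T_0$: $000000111111$, $001111110000$, $000111100011$; $T_1$: $011111100000$, $000111000111$, $000111101001$. - **92b**: $G=\langle (0213)(6879),\ (2435)(8a9b),\ (06)(17)(28)(39)(4a)(5b)\rangle$; $T_0$: $000000111111$, $000011111100$, $000111000111$, $000101110101$, $000111101001$; $T_1$: $010101101010$, $000111111000$, $000111001011$,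 $000001111101$, $000111100101$. - **96a**: $G=\langle (0527)(1634),\ (048)(159)(26a)(37b),\ (01)(23)(45)(67)(89)(ab)\rangle$; $T_0$: $000100110111$; $T_1=\sigma(T_0)$, $\sigma=(02)(13)$. - **96b**: $G=\langle (0213)(6879),\ (2435)(8a9b),\ (06)(17)(28)(39)(4a)(5b)\rangle$; $T_0$: $000111001011$, $000001111101$, $000101111010$, $000111010110$; $T_1$: $000111000111$, $000001111110$, $000101110101$, $000111011010$. - **98**: $G=\langle (012345)(6789ab),\ (0b)(1a)(29)(38)(47)(56)\rangle$; $T_0$: $111111000000$, $001110100011$, $011011001001$, $010110001101$, $101001110010$, $011010010110$, $100101101001$, $001100111001$, $010100110101$, $001010110101$, $000101100111$, $111010011000$; $T_1$: $010101101010$, $011100110001$, $011100001110$, $001011001011$, $010110001011$, $001011010110$, $000001101111$, $000101010111$, $000101111001$, $111010000110$. - **102**: $G=\langle (02468)(13579),\ (01)(23)(48)(59)(6a)(7b)\rangle$; $T_0$: $100101011001$, $100111000110$, $111100100010$, $000011011101$; $T_1$: $100101100110$, $000101011101$, $010000111011$. - **108a**: $G=\langle (012)(345)(678),\ (012)(876)(9ab),\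 (630)(258)(9ab)\rangle$; $T_0$: $000011011110$, $111100100001$; $T_1=\sigma(T_0)$, $\sigma=(06)(17)(28)(9b)$. - **108b**: $G=\langle (01)(23)(45)(67)(89)(ab),\ (123)(567)(9ab),\ (04)(15)(26)(37),\ (08)(19)(2a)(3b)\rangle$; $T_0$: $000101101101$, $001100110110$; $T_1=\sigma(T_0)$, $\sigma=(01)(45)(89)$. - **110a**: $G=\langle (0123456789a),\ (13954)(267a8),\ (0b)(1a)(25)(37)(48)(69)\rangle$; $T_0$: $000010011111$; $T_1=\sigma(T_0)$, $\sigma=(0a)(19)(28)(37)(46)$. - **110b**: $G=\langle (0123456789a),\ (13954)(267a8),\ (0b)(1a)(25)(37)(48)(69)\rangle$; $T_0$: $000010111011$; $T_1$: $000010011111$. - **120a**: $G=\langle (0527)(1634),\ (048)(159)(26a)(37b)\rangle$; $T_0$: $001101010101$, $000100111011$; $T_1=\sigma(T_0)$, $\sigma=(02)(46)(9b)$. - **120b**: $G=\langle (02468)(13579),\ (01)(23)(48)(59)(6a)(7b)\rangle$; $T_0$: $011110101000$, $000010011111$; $T_1=\sigma(T_0)$, $\sigma=(01)(23)(45)(67)(89)(ab)$.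 - **132**: $G=\langle (0123456789a),\ (13954)(267a8),\ (0b)(1a)(25)(37)(48)(69)\rangle$; $T_0$: $000001011111$; $T_1=\sigma(T_0)$, $\sigma=(0a)(19)(28)(37)(46)$. **Theorem.** 1. Each of these 25 pairs is a primary constant-weight trade, whose volume is the number in its name, and the 25 trades are pairwise nonequivalent. 2. Among these 25 trades, exactly the seven trades 72b, 96a, 108a, 108b, 120a, 120b, 132 are equivalent to a Witt difference pair; moreover, each of these seven is itself a Witt difference pair, and every Witt difference pair is equivalent to one of the seven. 3. The smallest volume of a constant-weight trade $(T_0,T_1)$ whose component $T_0$ is contained in an $S(5,6,12)$ is $72$. -/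

import Mathlib

/-! Binary words, halved cubes and Johnson graphs. -/

namespace WittTrades

/-- Binary words of length `n`. The weight of `w` is `hammingNorm w`. -/
abbrev Word (n : ℕ) : Type := Fin n → ZMod 2

/-- The halved `n`-cube: the even-weight words of length `n`, two words being adjacent when they
differ in exactly two positions. -/
def halvedCube (n : ℕ) : SimpleGraph {w : Word n // Even (hammingNorm w)} where
  Adj x y := hammingDist x.1 y.1 = 2
  symm := ⟨fun x y h => by rw [hammingDist_comm]; exact h⟩
  loopless := ⟨fun x h => by simp at h⟩

/-- The Johnson graph `J(n,k)`: the weight-`k` words of length `n`, two words being adjacent when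
they differ in exactly two positions. -/
def johnson (n k : ℕ) : SimpleGraph {w : Word n // hammingNorm w = k} where
  Adj x y := hammingDist x.1 y.1 = 2
  symm := ⟨fun x y h => by rw [hammingDist_comm]; exact h⟩
  loopless := ⟨fun x h => by simp at h⟩

/-! Trades, primary trades and equivalence in an arbitrary finite graph. -/

/-- `(T₀, T₁)` is a pair of disjoint nonempty vertex sets such that every maximum clique `B`
satisfies `|T₀ ∩ B| = |T₁ ∩ B| ∈ {0, 1}`. -/
structure IsCliqueTrade {V : Type*} [Finite V] (G : SimpleGraph V) (T₀ T₁ : Set V) : Prop where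
  disjoint : Disjoint T₀ T₁
  nonempty₀ : T₀.Nonempty
  nonempty₁ : T₁.Nonempty
  balanced : ∀ B : Finset V, G.IsMaximumClique B →
    (T₀ ∩ ↑B).ncard = (T₁ ∩ ↑B).ncard ∧ ((T₀ ∩ ↑B).ncard = 0 ∨ (T₀ ∩ ↑B).ncard = 1)

/-- A trade that cannot be partitioned into two trades. -/
def IsPrimaryCliqueTrade {V : Type*} [Finite V] (G : SimpleGraph V) (T₀ T₁ : Set V) : Prop :=
  IsCliqueTrade G T₀ T₁ ∧
    ¬ ∃ A₀ A₁ B₀ B₁ : Set V, IsCliqueTrade G A₀ A₁ ∧ IsCliqueTrade G B₀ B₁ ∧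
      Disjoint A₀ B₀ ∧ Disjoint A₁ B₁ ∧ T₀ = A₀ ∪ B₀ ∧ T₁ = A₁ ∪ B₁

/-- Equivalence of pairs of vertex sets: some automorphism of the graph maps one pair to the other
one, possibly interchanging the two components. -/
def PairEquivalent {V : Type*} (G : SimpleGraph V) (S C : Set V × Set V) : Prop :=
  ∃ π : G ≃g G, (π '' S.1 = C.1 ∧ π '' S.2 = C.2) ∨ (π '' S.1 = C.2 ∧ π '' S.2 = C.1)

/-! Steiner systems and constant-weight extended 1-perfect trades of length 12. -/

/-- A Steiner system `S(k-1,k,n)`, `n ≥ 2k`, as a set of weight-`k` words of length `n` that meets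
every maximum clique of `J(n,k)` in exactly one word. -/
def IsSteinerSystem (k n : ℕ) (W : Set (Word n)) : Prop :=
  (∀ w ∈ W, hammingNorm w = k) ∧
    ∀ B : Finset {w : Word n // hammingNorm w = k}, (johnson n k).IsMaximumClique B →
      (Subtype.val ⁻¹' W ∩ (↑B : Set {w : Word n // hammingNorm w = k})).ncard = 1

/-- A set of words of length 12, as a set of vertices of the halved 12-cube. -/
def evenPart (T : Set (Word 12)) : Set {w : Word 12 // Even (hammingNorm w)} := Subtype.val ⁻¹' T

/-- A constant-weight extended 1-perfect trade of length 12: an extended 1-perfect trade (a trade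
in the halved 12-cube) all of whose words have weight 6. -/
def IsConstantWeightTrade (T : Set (Word 12) × Set (Word 12)) : Prop :=
  (∀ w ∈ T.1 ∪ T.2, hammingNorm w = 6) ∧ IsCliqueTrade (halvedCube 12) (evenPart T.1) (evenPart T.2)

/-- A primary constant-weight extended 1-perfect trade of length 12. -/
def IsPrimaryConstantWeightTrade (T : Set (Word 12) × Set (Word 12)) : Prop :=
  (∀ w ∈ T.1 ∪ T.2, hammingNorm w = 6) ∧
    IsPrimaryCliqueTrade (halvedCube 12) (evenPart T.1) (evenPart T.2)

/-- Equivalence of pairs of sets of even-weight words of length 12. -/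
def Equivalent (S T : Set (Word 12) × Set (Word 12)) : Prop :=
  PairEquivalent (halvedCube 12) (evenPart S.1, evenPart S.2) (evenPart T.1, evenPart T.2)

/-- The volume of a trade. -/
noncomputable def volume (T : Set (Word 12) × Set (Word 12)) : ℕ := T.1.ncard

/-- `T` is the difference pair `(W₀ \ W₁, W₁ \ W₀)` of two different `S(5,6,12)`. -/
def IsWittDifference (T : Set (Word 12) × Set (Word 12)) : Prop :=
  ∃ W₀ W₁ : Set (Word 12), IsSteinerSystem 6 12 W₀ ∧ IsSteinerSystem 6 12 W₁ ∧ W₀ ≠ W₁ ∧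
    T = (W₀ \ W₁, W₁ \ W₀)

/-! The table of the 25 trades. Coordinates are numbered 0, …, 11. -/

/-- The coordinate permutation `g` moves the symbol in position `i` to position `g i`. -/
def permute (g : Equiv.Perm (Fin 12)) (w : Word 12) : Word 12 := fun i => w (g.symm i)

/-- The permutation of the coordinates with the given disjoint cycles. -/
def cycles (cs : List (List (Fin 12))) : Equiv.Perm (Fin 12) := (cs.map List.formPerm).prod

/-- The union of the orbits of the words `reps` under the group of coordinate permutations that is
generated by `gens`. -/
def orbits (gens : List (Equiv.Perm (Fin 12))) (reps : List (Word 12)) : Set (Word 12) :=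
  {w | ∃ g ∈ Subgroup.closure {h | h ∈ gens}, ∃ r ∈ reps, w = permute g r}

/-- The pair whose components are both unions of orbits. -/
def pairOfOrbits (gens : List (Equiv.Perm (Fin 12))) (reps₀ reps₁ : List (Word 12)) :
    Set (Word 12) × Set (Word 12) :=
  (orbits gens reps₀, orbits gens reps₁)

/-- The pair whose first component is a union of orbits, and whose second component is obtained
from the first one by the coordinate permutation `s`. -/
def pairOfSwap (gens : List (Equiv.Perm (Fin 12))) (reps₀ : List (Word 12))
    (s : Equiv.Perm (Fin 12)) : Set (Word 12) × Set (Word 12) :=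
  (orbits gens reps₀, permute s '' orbits gens reps₀)

/-- The names of the 25 trades: the volume, followed by a letter where needed. -/
inductive TradeName : Type
  | t32
  | t48
  | t56a
  | t56b
  | t68
  | t72a
  | t72b
  | t72c
  | t72d
  | t80a
  | t80b
  | t86
  | t92a
  | t92b
  | t96a
  | t96b
  | t98
  | t102
  | t108a
  | t108b
  | t110a
  | t110b
  | t120a
  | t120b
  | t132

/-- The volume that is part of the name of a trade. -/
def TradeName.nominalVolume : TradeName → ℕ
  | .t32 => 32
  | .t48 => 48
  | .t56a => 56
  | .t56b => 56
  | .t68 => 68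
  | .t72a => 72
  | .t72b => 72
  | .t72c => 72
  | .t72d => 72
  | .t80a => 80
  | .t80b => 80
  | .t86 => 86
  | .t92a => 92
  | .t92b => 92
  | .t96a => 96
  | .t96b => 96
  | .t98 => 98
  | .t102 => 102
  | .t108a => 108
  | .t108b => 108
  | .t110a => 110
  | .t110b => 110
  | .t120a => 120
  | .t120b => 120
  | .t132 => 132

/-- The 25 trades. -/
def trade : TradeName → Set (Word 12) × Set (Word 12)
  | .t32 => pairOfSwap
      [cycles [[8, 9], [10, 11]],
        cycles [[8, 10], [9, 11]],
        cycles [[0, 2, 4, 6, 8], [1, 3, 5, 7, 9]]]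
      [![0,1,0,1,0,1,0,1,0,1,0,1]]
      (cycles [[10, 11]])
  | .t48 => pairOfSwap
      [cycles [[0, 1, 2], [4, 6, 5]],
        cycles [[0, 1], [2, 3]],
        cycles [[4, 5], [6, 7]],
        cycles [[0, 2], [4, 6], [8, 9]],
        cycles [[8, 9], [10, 11]],
        cycles [[8, 10], [9, 11]],
        cycles [[0, 4], [1, 5], [2, 6], [3, 7]]]
      [![0,1,0,1,0,0,1,1,0,1,0,1]]
      (cycles [[10, 11]])
  | .t56a => pairOfSwap
      [cycles [[0, 1, 2, 3, 4, 5, 6]],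
        cycles [[1, 3], [2, 4], [6, 7], [8, 9]],
        cycles [[8, 9], [10, 11]],
        cycles [[8, 10], [9, 11]]]
      [![0,1,0,0,0,1,1,1,0,1,0,1]]
      (cycles [[10, 11]])
  | .t56b => pairOfSwap
      [cycles [[0, 1], [2, 3]],
        cycles [[0, 2], [1, 3]],
        cycles [[0, 4, 8], [1, 5, 9], [2, 6, 10], [3, 7, 11]],
        cycles [[0, 4], [1, 5], [2, 6], [3, 7]]]
      [![0,1,1,0,0,1,1,0,0,1,1,0],
        ![0,0,1,1,0,1,0,1,0,1,0,1],
        ![0,0,1,1,0,0,1,1,0,1,1,0]]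
      (cycles [[0, 1], [4, 5], [8, 9]])
  | .t68 => pairOfOrbits
      [cycles [[1, 2, 3], [5, 6, 7]],
        cycles [[0, 5], [1, 4], [2, 6], [3, 7]],
        cycles [[8, 9], [10, 11]],
        cycles [[8, 10], [9, 11]]]
      [![0,0,0,0,1,1,1,1,0,1,1,0],
        ![0,0,1,1,0,0,1,1,0,1,0,1],
        ![0,0,1,1,1,1,0,0,0,1,0,1],
        ![0,0,0,1,1,1,1,0,0,0,1,1],
        ![0,0,1,1,0,1,1,0,0,1,1,0]]
      [![0,0,0,0,1,1,1,1,0,0,1,1],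
        ![0,0,1,1,0,0,1,1,0,1,1,0],
        ![0,0,1,1,1,1,0,0,0,0,1,1],
        ![0,0,0,1,1,1,1,0,0,1,1,0],
        ![0,0,1,1,0,1,1,0,0,1,0,1]]
  | .t72a => pairOfSwap
      [cycles [[0, 1], [2, 3]],
        cycles [[0, 1, 2], [4, 6, 5]],
        cycles [[0, 4, 8], [1, 5, 9], [2, 6, 10], [3, 7, 11]],
        cycles [[0, 4], [1, 5], [2, 6], [3, 7]]]
      [![0,0,1,1,0,0,1,1,0,0,1,1]]
      (cycles [[0, 1], [4, 5], [8, 10]])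
  | .t72b => pairOfSwap
      [cycles [[0, 1, 8, 7], [2, 3, 6, 5]],
        cycles [[0, 9], [4, 8], [5, 7], [10, 11]]]
      [![0,0,0,0,1,1,1,1,0,1,0,1]]
      (cycles [[10, 11]])
  | .t72c => pairOfSwap
      [cycles [[0, 1], [2, 3], [4, 5], [6, 7]],
        cycles [[8, 9], [10, 11]],
        cycles [[1, 2, 3], [5, 6, 7], [9, 10, 11]],
        cycles [[0, 4], [1, 5], [2, 6], [3, 7]]]
      [![0,1,1,0,1,0,0,1,0,0,1,1],
        ![0,1,0,1,0,1,0,1,0,0,1,1],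
        ![0,0,0,1,1,0,1,1,0,0,1,1]]
      (cycles [[0, 1], [4, 5], [8, 9]])
  | .t72d => pairOfSwap
      [cycles [[0, 1, 2], [6, 7, 8]],
        cycles [[1, 2], [4, 5], [7, 8], [10, 11]],
        cycles [[0, 3], [1, 4], [2, 5], [6, 9], [7, 10], [8, 11]],
        cycles [[0, 6], [1, 7], [2, 8], [3, 9], [4, 10], [5, 11]]]
      [![0,0,1,1,0,1,0,1,0,0,1,1],
        ![0,0,1,1,0,1,0,1,1,1,0,0]]
      (cycles [[1, 2], [7, 8]])
  | .t80a => pairOfOrbits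
      [cycles [[0, 1, 2, 3, 4], [6, 7, 8, 9, 10]],
        cycles [[1, 3, 4, 2], [7, 9, 10, 8]],
        cycles [[0, 5], [2, 3], [6, 11], [8, 9]],
        cycles [[0, 6], [1, 7], [2, 8], [3, 9], [4, 10], [5, 11]]]
      [![0,0,0,1,1,1,1,1,1,0,0,0],
        ![0,0,0,1,1,1,0,1,0,1,1,0]]
      [![0,0,0,1,1,1,0,0,0,1,1,1],
        ![0,0,0,1,1,1,1,0,1,0,0,1]]
  | .t80b => pairOfSwap
      [cycles [[0, 1], [2, 3], [4, 5], [6, 7]],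
        cycles [[1, 2, 3], [5, 6, 7]],
        cycles [[0, 4], [1, 5], [2, 7], [3, 6]],
        cycles [[8, 9], [10, 11]],
        cycles [[8, 10], [9, 11]]]
      [![0,0,0,0,1,1,1,1,0,1,1,0],
        ![0,0,1,1,0,0,1,1,0,0,1,1],
        ![0,0,0,1,1,1,1,0,0,0,1,1],
        ![0,0,1,1,0,1,1,0,0,1,0,1],
        ![0,0,1,1,0,1,0,1,0,1,1,0]]
      (cycles [[2, 3], [6, 7], [9, 11]])
  | .t86 => pairOfOrbits
      [cycles [[0, 1, 2], [3, 4, 5]],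
        cycles [[0, 5], [1, 4], [2, 3], [6, 11], [7, 10], [8, 9]],
        cycles [[0, 6], [1, 7], [2, 8], [3, 9], [4, 10], [5, 11]]]
      [![0,0,0,1,1,1,1,1,1,0,0,0],
        ![0,0,0,1,1,1,0,0,1,1,1,0],
        ![0,0,1,1,0,0,0,1,1,1,0,1],
        ![0,0,1,0,0,1,0,1,1,0,1,1],
        ![0,0,1,0,1,1,0,1,1,1,0,0]]
      [![0,0,0,1,1,1,0,0,0,1,1,1],
        ![0,0,0,1,1,1,0,1,1,1,0,0],
        ![0,0,1,0,1,1,0,1,1,0,1,0],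
        ![0,0,1,1,1,0,0,0,1,1,1,0],
        ![0,0,1,0,0,1,0,1,1,1,0,1],
        ![1,1,0,1,1,0,1,0,0,0,1,0]]
  | .t92a => pairOfOrbits
      [cycles [[0, 1, 2, 3, 4], [6, 7, 8, 9, 10]],
        cycles [[1, 3, 4, 2], [7, 9, 10, 8]],
        cycles [[0, 5], [2, 3], [6, 11], [8, 9]],
        cycles [[0, 6], [1, 7], [2, 8], [3, 9], [4, 10], [5, 11]]]
      [![0,0,0,0,0,0,1,1,1,1,1,1],
        ![0,0,1,1,1,1,1,1,0,0,0,0],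
        ![0,0,0,1,1,1,1,0,0,0,1,1]]
      [![0,1,1,1,1,1,1,0,0,0,0,0],
        ![0,0,0,1,1,1,0,0,0,1,1,1],
        ![0,0,0,1,1,1,1,0,1,0,0,1]]
  | .t92b => pairOfOrbits
      [cycles [[0, 2, 1, 3], [6, 8, 7, 9]],
        cycles [[2, 4, 3, 5], [8, 10, 9, 11]],
        cycles [[0, 6], [1, 7], [2, 8], [3, 9], [4, 10], [5, 11]]]
      [![0,0,0,0,0,0,1,1,1,1,1,1],
        ![0,0,0,0,1,1,1,1,1,1,0,0],
        ![0,0,0,1,1,1,0,0,0,1,1,1],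
        ![0,0,0,1,0,1,1,1,0,1,0,1],
        ![0,0,0,1,1,1,1,0,1,0,0,1]]
      [![0,1,0,1,0,1,1,0,1,0,1,0],
        ![0,0,0,1,1,1,1,1,1,0,0,0],
        ![0,0,0,1,1,1,0,0,1,0,1,1],
        ![0,0,0,0,0,1,1,1,1,1,0,1],
        ![0,0,0,1,1,1,1,0,0,1,0,1]]
  | .t96a => pairOfSwap
      [cycles [[0, 5, 2, 7], [1, 6, 3, 4]],
        cycles [[0, 4, 8], [1, 5, 9], [2, 6, 10], [3, 7, 11]],
        cycles [[0, 1], [2, 3], [4, 5], [6, 7], [8, 9], [10, 11]]]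
      [![0,0,0,1,0,0,1,1,0,1,1,1]]
      (cycles [[0, 2], [1, 3]])
  | .t96b => pairOfOrbits
      [cycles [[0, 2, 1, 3], [6, 8, 7, 9]],
        cycles [[2, 4, 3, 5], [8, 10, 9, 11]],
        cycles [[0, 6], [1, 7], [2, 8], [3, 9], [4, 10], [5, 11]]]
      [![0,0,0,1,1,1,0,0,1,0,1,1],
        ![0,0,0,0,0,1,1,1,1,1,0,1],
        ![0,0,0,1,0,1,1,1,1,0,1,0],
        ![0,0,0,1,1,1,0,1,0,1,1,0]]
      [![0,0,0,1,1,1,0,0,0,1,1,1],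
        ![0,0,0,0,0,1,1,1,1,1,1,0],
        ![0,0,0,1,0,1,1,1,0,1,0,1],
        ![0,0,0,1,1,1,0,1,1,0,1,0]]
  | .t98 => pairOfOrbits
      [cycles [[0, 1, 2, 3, 4, 5], [6, 7, 8, 9, 10, 11]],
        cycles [[0, 11], [1, 10], [2, 9], [3, 8], [4, 7], [5, 6]]]
      [![1,1,1,1,1,1,0,0,0,0,0,0],
        ![0,0,1,1,1,0,1,0,0,0,1,1],
        ![0,1,1,0,1,1,0,0,1,0,0,1],
        ![0,1,0,1,1,0,0,0,1,1,0,1],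
        ![1,0,1,0,0,1,1,1,0,0,1,0],
        ![0,1,1,0,1,0,0,1,0,1,1,0],
        ![1,0,0,1,0,1,1,0,1,0,0,1],
        ![0,0,1,1,0,0,1,1,1,0,0,1],
        ![0,1,0,1,0,0,1,1,0,1,0,1],
        ![0,0,1,0,1,0,1,1,0,1,0,1],
        ![0,0,0,1,0,1,1,0,0,1,1,1],
        ![1,1,1,0,1,0,0,1,1,0,0,0]]
      [![0,1,0,1,0,1,1,0,1,0,1,0],
        ![0,1,1,1,0,0,1,1,0,0,0,1],
        ![0,1,1,1,0,0,0,0,1,1,1,0],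
        ![0,0,1,0,1,1,0,0,1,0,1,1],
        ![0,1,0,1,1,0,0,0,1,0,1,1],
        ![0,0,1,0,1,1,0,1,0,1,1,0],
        ![0,0,0,0,0,1,1,0,1,1,1,1],
        ![0,0,0,1,0,1,0,1,0,1,1,1],
        ![0,0,0,1,0,1,1,1,1,0,0,1],
        ![1,1,1,0,1,0,0,0,0,1,1,0]]
  | .t102 => pairOfOrbits
      [cycles [[0, 2, 4, 6, 8], [1, 3, 5, 7, 9]],
        cycles [[0, 1], [2, 3], [4, 8], [5, 9], [6, 10], [7, 11]]]
      [![1,0,0,1,0,1,0,1,1,0,0,1],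
        ![1,0,0,1,1,1,0,0,0,1,1,0],
        ![1,1,1,1,0,0,1,0,0,0,1,0],
        ![0,0,0,0,1,1,0,1,1,1,0,1]]
      [![1,0,0,1,0,1,1,0,0,1,1,0],
        ![0,0,0,1,0,1,0,1,1,1,0,1],
        ![0,1,0,0,0,0,1,1,1,0,1,1]]
  | .t108a => pairOfSwap
      [cycles [[0, 1, 2], [3, 4, 5], [6, 7, 8]],
        cycles [[0, 1, 2], [8, 7, 6], [9, 10, 11]],
        cycles [[6, 3, 0], [2, 5, 8], [9, 10, 11]]]
      [![0,0,0,0,1,1,0,1,1,1,1,0],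
        ![1,1,1,1,0,0,1,0,0,0,0,1]]
      (cycles [[0, 6], [1, 7], [2, 8], [9, 11]])
  | .t108b => pairOfSwap
      [cycles [[0, 1], [2, 3], [4, 5], [6, 7], [8, 9], [10, 11]],
        cycles [[1, 2, 3], [5, 6, 7], [9, 10, 11]],
        cycles [[0, 4], [1, 5], [2, 6], [3, 7]],
        cycles [[0, 8], [1, 9], [2, 10], [3, 11]]]
      [![0,0,0,1,0,1,1,0,1,1,0,1],
        ![0,0,1,1,0,0,1,1,0,1,1,0]]
      (cycles [[0, 1], [4, 5], [8, 9]])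
  | .t110a => pairOfSwap
      [cycles [[0, 1, 2, 3, 4, 5, 6, 7, 8, 9, 10]],
        cycles [[1, 3, 9, 5, 4], [2, 6, 7, 10, 8]],
        cycles [[0, 11], [1, 10], [2, 5], [3, 7], [4, 8], [6, 9]]]
      [![0,0,0,0,1,0,0,1,1,1,1,1]]
      (cycles [[0, 10], [1, 9], [2, 8], [3, 7], [4, 6]])
  | .t110b => pairOfOrbits
      [cycles [[0, 1, 2, 3, 4, 5, 6, 7, 8, 9, 10]],
        cycles [[1, 3, 9, 5, 4], [2, 6, 7, 10, 8]],
        cycles [[0, 11], [1, 10], [2, 5], [3, 7], [4, 8], [6, 9]]]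
      [![0,0,0,0,1,0,1,1,1,0,1,1]]
      [![0,0,0,0,1,0,0,1,1,1,1,1]]
  | .t120a => pairOfSwap
      [cycles [[0, 5, 2, 7], [1, 6, 3, 4]],
        cycles [[0, 4, 8], [1, 5, 9], [2, 6, 10], [3, 7, 11]]]
      [![0,0,1,1,0,1,0,1,0,1,0,1],
        ![0,0,0,1,0,0,1,1,1,0,1,1]]
      (cycles [[0, 2], [4, 6], [9, 11]])
  | .t120b => pairOfSwap
      [cycles [[0, 2, 4, 6, 8], [1, 3, 5, 7, 9]],
        cycles [[0, 1], [2, 3], [4, 8], [5, 9], [6, 10], [7, 11]]]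
      [![0,1,1,1,1,0,1,0,1,0,0,0],
        ![0,0,0,0,1,0,0,1,1,1,1,1]]
      (cycles [[0, 1], [2, 3], [4, 5], [6, 7], [8, 9], [10, 11]])
  | .t132 => pairOfSwap
      [cycles [[0, 1, 2, 3, 4, 5, 6, 7, 8, 9, 10]],
        cycles [[1, 3, 9, 5, 4], [2, 6, 7, 10, 8]],
        cycles [[0, 11], [1, 10], [2, 5], [3, 7], [4, 8], [6, 9]]]
      [![0,0,0,0,0,1,0,1,1,1,1,1]]
      (cycles [[0, 10], [1, 9], [2, 8], [3, 7], [4, 6]])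

/-- The seven trades that are differences of two small Witt designs. -/
def wittNames : Set TradeName := {.t72b, .t96a, .t108a, .t108b, .t120a, .t120b, .t132}

end WittTrades

/-! A word is encoded as a number below `4096` and a set of words as a bit mask of `4096` digits.
Set operations, the change of one symbol and coordinate permutations then become a few operations on
large numbers, and finite statements are evaluated by the kernel.

The link with the graphs is `exists_center`: five words at mutual distance two have a common
neighbour. Hence the maximum cliques of the halved cube are the sets of the 12 neighbours of a word
of odd weight, and those of `J(12,6)` are the sets of the 7 weight-6 neighbours of a word of weight
5 or 7. Let `degree T c` count the words of `T` at distance one from `c`. Two disjoint nonempty sets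
of weight-6 words form a trade iff their degrees agree everywhere and are at most 1. A set of
weight-6 words is an `S(5,6,12)` iff its degree is 1 at all words of weight 5 and 7.

Item 1. That the pairs are trades is read off from their masks. Inside a trade, every subtrade is
closed under adjacency (`mem_of_adjacent_aux`), so a trade with connected support is primary. For
nonequivalence, any graph automorphism preserves the size of the support and of its closed
neighbourhood; the automorphism group itself need not be known. Three pairs of trades are not
separated by these two numbers. They are separated by the numbers of support vertices reachable from
a support vertex in two steps (`localSize`).

Item 2. Two exhaustive searches with isomorph rejection are given as explicit trees and verified by
`SearchTree.check`. The first shows that every `S(5,6,12)` is a coordinate permutation of one system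
`W`, with mask `wittMask`. The second runs through the systems `W'` up to automorphisms of `W`. It
finds that `W' = W` or that the pair `(W, W')` is a permuted copy of one of seven explicit pairs,
whose differences are the seven trades.

Item 3. Let `T₀ ⊆ W` contain a block `x`; by item 2 and transitivity on blocks, `W` and `x` may be
fixed. Double counting shows that every set `U` receives equal degree sums from `T₀` and `T₁`.
Taking for `U` the weight-5 words at a given distance from `x` forces the complement of `x` into
`T₀`. The words of `T₁` adjacent to `x` define a bijection from the ones of `x` to its zeros, and
all blocks adjacent to words of `T₁` are in `T₀`. For each of the 720 bijections this gives at least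
25 blocks of `T₀` at distance 4 from `x`, and the same holds for the complement. A weighted count
over the nonblocks expresses the number of blocks of `T₀` at distance 6 by `|T₀|`, and adding up
yields `|T₀| ≥ 72`. -/

set_option maxRecDepth 100000

namespace WittTrades

/-! ### Words as numbers, sets of words as bit masks -/

/-- Applies `f` to `n`; the case distinction makes the kernel evaluate `n` first. Since the kernel
hashes numbers by their lowest 64 digits, these are made to depend on all digits of `n`. -/
def force {α : Type*} (n : ℕ) (f : ℕ → α) : α :=
  match Nat.add (Nat.shiftLeft n 64) (Nat.mod n 2305843009213693951) with
  | 0 => f 0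
  | Nat.succ m => f (Nat.shiftRight (Nat.succ m) 64)

@[simp] theorem force_eq {α : Type*} (n : ℕ) (f : ℕ → α) : force n f = f n := by
  have h : Nat.shiftRight (Nat.add (Nat.shiftLeft n 64) (Nat.mod n 2305843009213693951)) 64 =
      n := by
    change (n <<< 64 + n % 2305843009213693951) >>> 64 = n
    -- The modulus is `2 ^ 61 - 1`, so the added remainder is below `2 ^ 64` and disappears under
    -- the shift.
    have := Nat.mod_lt n (show 2305843009213693951 > 0 by norm_num)
    rw [Nat.shiftLeft_eq, Nat.shiftRight_eq_div_pow]
    omega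
  rw [force]
  split
  next h' => rw [h'] at h; exact congrArg f h
  next m h' => rw [h'] at h; exact congrArg f h

/-- The binary digit `n` of `M`. -/
def digit (M n : ℕ) : Bool := Nat.beq (Nat.land 1 (Nat.shiftRight M n)) 1

theorem digit_eq (M n : ℕ) : digit M n = M.testBit n := by
  have h : digit M n = Nat.beq (1 &&& M >>> n) 1 := rfl
  rw [h, Nat.testBit, Nat.one_and_eq_mod_two]
  rcases Nat.mod_two_eq_zero_or_one (M >>> n) with h | h <;> rw [h] <;> rfl

/-- `p` holds for all numbers `2 ^ k * b, …, 2 ^ k * (b + 1) - 1`. -/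
def allBits : ℕ → ℕ → (ℕ → Bool) → Bool
  | 0, b, p => p b
  | k + 1, b, p => force (Nat.mul 2 b) fun c => and (allBits k c p) (allBits k (Nat.succ c) p)

theorem allBits_iff (k : ℕ) : ∀ (b : ℕ) (p : ℕ → Bool),
    allBits k b p = true ↔ ∀ n, 2 ^ k * b ≤ n → n < 2 ^ k * (b + 1) → p n = true := by
  induction k with
  | zero =>
    intro b p
    simp only [allBits, pow_zero, one_mul]
    refine ⟨fun h n h1 h2 => ?_, fun h => h b le_rfl (Nat.lt_succ_self b)⟩
    obtain rfl : n = b := by omega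
    exact h
  | succ k ih =>
    intro b p
    simp only [allBits, force_eq, Bool.and_eq_true, ih, Nat.mul_eq, Nat.succ_eq_add_one]
    have e : 2 ^ (k + 1) * b = 2 ^ k * (2 * b) := by ring
    have e' : 2 ^ (k + 1) * (b + 1) = 2 ^ k * (2 * b + 1 + 1) := by ring
    rw [e, e']
    refine ⟨fun h n h1 h2 => ?_, fun h => ⟨fun n h1 h2 => h n h1 (h2.trans_le ?_),
      fun n h1 h2 => h n (le_trans ?_ h1) h2⟩⟩
    · rcases lt_or_ge n (2 ^ k * (2 * b + 1)) with h3 | h3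
      · exact h.1 n h1 h3
      · exact h.2 n h3 h2
    · gcongr; omega
    · gcongr; omega

/-- `p` holds for all numbers below `4096`. -/
def allCodes (p : ℕ → Bool) : Bool := allBits 12 0 p

theorem allCodes_spec {p : ℕ → Bool} (h : allCodes p = true) {n : ℕ} (hn : n < 4096) :
    p n = true := (allBits_iff 12 0 p).1 h n (by omega) (by omega)

theorem zmod_two_cases (a : ZMod 2) : a = 0 ∨ a = 1 := by
  fin_cases a
  exacts [.inl rfl, .inr rfl]

/-- Three of the digits are complemented in the codes of words. The kernel hashes numbers by
their lowest 64 digits, and this choice makes those of the masks below sufficiently varied. -/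
def offset : ℕ := 2 ^ 7 + 2 ^ 9 + 2 ^ 11

/-- The number whose binary digits are those of `w` or, for the digits of `offset`, their
complements. -/
def code (w : Word 12) : ℕ := Nat.ofBits fun i => xor (decide (w i = 1)) (digit offset i)

/-- The word with code `n`. -/
def ofCode (n : ℕ) : Word 12 := fun i => cond (xor (digit n i) (digit offset i)) 1 0

theorem code_lt (w : Word 12) : code w < 4096 := Nat.ofBits_lt_two_pow _

theorem testBit_code (w : Word 12) (i : Fin 12) :
    (code w).testBit i = xor (decide (w i = 1)) (digit offset i) := by
  rw [code, Nat.testBit_ofBits_lt _ _ i.2]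

theorem testBit_code_of_le (w : Word 12) {i : ℕ} (hi : 12 ≤ i) : (code w).testBit i = false :=
  Nat.testBit_lt_two_pow ((code_lt w).trans_le (Nat.pow_le_pow_right (n := 2) (by omega) hi))

theorem eq_of_code_testBit {n : ℕ} (hn : n < 4096) {w : Word 12}
    (h : ∀ i : Fin 12, n.testBit i = xor (decide (w i = 1)) (digit offset i)) : code w = n := by
  refine Nat.eq_of_testBit_eq fun i => ?_
  rcases lt_or_ge i 12 with hi | hi
  · rw [testBit_code w ⟨i, hi⟩, h ⟨i, hi⟩]
  · rw [testBit_code_of_le w hi, Nat.testBit_lt_two_pow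
      (hn.trans_le (Nat.pow_le_pow_right (n := 2) (by omega) hi))]

theorem code_ofCode {n : ℕ} (hn : n < 4096) : code (ofCode n) = n :=
  eq_of_code_testBit hn fun i => by
    rw [ofCode, digit_eq n]
    cases h : n.testBit i <;> cases h' : digit offset i <;> simp

theorem ofCode_code (w : Word 12) : ofCode (code w) = w := by
  funext i
  rw [ofCode, digit_eq (code w), testBit_code]
  rcases zmod_two_cases (w i) with h | h <;> simp [h]

theorem code_injective : Function.Injective code := fun v w h => by
  rw [← ofCode_code v, h, ofCode_code]

/-- The set of the words whose codes are the positions of the ones in `M`. -/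
def toSet (M : ℕ) : Set (Word 12) := {w | M.testBit (code w) = true}

theorem mem_toSet {M : ℕ} {w : Word 12} : w ∈ toSet M ↔ M.testBit (code w) = true := Iff.rfl

theorem toSet_zero : toSet 0 = ∅ := by ext w; simp [mem_toSet]

theorem toSet_or (M N : ℕ) : toSet (M ||| N) = toSet M ∪ toSet N := by
  ext w; simp [mem_toSet]

theorem toSet_and (M N : ℕ) : toSet (M &&& N) = toSet M ∩ toSet N := by
  ext w; simp [mem_toSet]

/-- The difference of two sets given by masks. -/
def sdiffMask (M N : ℕ) : ℕ := Nat.xor M (Nat.land M N)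

theorem sdiffMask_eq (M N : ℕ) : sdiffMask M N = M ^^^ (M &&& N) := rfl

theorem testBit_sdiffMask (M N n : ℕ) :
    (sdiffMask M N).testBit n = (M.testBit n && !N.testBit n) := by
  simp [sdiffMask_eq]
  cases M.testBit n <;> cases N.testBit n <;> rfl

theorem toSet_sdiff (M N : ℕ) : toSet (sdiffMask M N) = toSet M \ toSet N := by
  ext w; simp [mem_toSet, testBit_sdiffMask]

theorem toSet_subset_of_and_eq {M N : ℕ} (h : M &&& N = M) : toSet M ⊆ toSet N := by
  rw [← h, toSet_and]; exact Set.inter_subset_right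

theorem testBit_shiftLeft_one (m n : ℕ) : (1 <<< m).testBit n = decide (m = n) := by
  rw [Nat.shiftLeft_eq, one_mul, Nat.testBit_two_pow]

theorem toSet_single (v : Word 12) : toSet (1 <<< code v) = {v} := by
  ext w
  rw [mem_toSet, testBit_shiftLeft_one, decide_eq_true_iff, Set.mem_singleton_iff]
  exact ⟨fun h => (code_injective h).symm, fun h => by rw [h]⟩

/-! ### Changing one digit -/

/-- The mask of the numbers below `4096` whose digit `i` is zero. -/
def lowMask (i : ℕ) : ℕ :=
  Nat.div (Nat.sub (Nat.pow 2 4096) 1) (Nat.add (Nat.pow 2 (Nat.pow 2 i)) 1)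

/-- The mask of the numbers below `4096` whose digit `i` is one. -/
def bitMask (i : ℕ) : ℕ := Nat.shiftLeft (lowMask i) (Nat.pow 2 i)

/-- The properties of `lowMask` and `bitMask` that are needed below. -/
def lowMaskCheck (i n : ℕ) : Bool :=
  and (Nat.blt (Nat.xor n (Nat.pow 2 i)) 4096)
    (and (not (xor (digit (bitMask i) n) (digit n i)))
      (cond (digit n i)
        (and (not (digit (lowMask i) n)) (and (Nat.ble (Nat.pow 2 i) n)
          (and (Nat.beq (Nat.sub n (Nat.pow 2 i)) (Nat.xor n (Nat.pow 2 i)))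
            (digit (lowMask i) (Nat.xor n (Nat.pow 2 i))))))
        (and (digit (lowMask i) n)
          (and (Nat.beq (Nat.add n (Nat.pow 2 i)) (Nat.xor n (Nat.pow 2 i)))
          (or (Nat.blt n (Nat.pow 2 i)) (not (digit (lowMask i) (Nat.sub n (Nat.pow 2 i)))))))))

/-- `2 ^ 2 ^ (i + 1) - 1 = (2 ^ 2 ^ i - 1) * (2 ^ 2 ^ i + 1)`, so the quotient defining `lowMask i`
consists of alternating blocks of `2 ^ i` ones and `2 ^ i` zeros. The kernel confirms this for every
code, and all later facts about these masks are extracted from this check. -/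
theorem lowMaskCheck_all :
    ((List.range 12).all fun i => allCodes (lowMaskCheck i)) = true := by decide +kernel

theorem lowMaskCheck_spec {i n : ℕ} (hi : i < 12) (hn : n < 4096) : lowMaskCheck i n = true :=
  allCodes_spec (List.all_eq_true.1 lowMaskCheck_all i (List.mem_range.2 hi)) hn

theorem testBit_bitMask {i n : ℕ} (hi : i < 12) (hn : n < 4096) :
    (bitMask i).testBit n = n.testBit i := by
  have h := lowMaskCheck_spec hi hn
  simp only [lowMaskCheck, Bool.and_eq_true, digit_eq] at h
  simpa using h.2.1

theorem testBit_lowMask {i n : ℕ} (hi : i < 12) (hn : n < 4096) :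
    (lowMask i).testBit n = !n.testBit i := by
  have h := lowMaskCheck_spec hi hn
  simp only [lowMaskCheck, Bool.and_eq_true, digit_eq] at h
  replace h := h.2.2
  cases hb : n.testBit i <;>
    simp only [hb, cond_false, cond_true, Bool.and_eq_true, Bool.not_eq_true'] at h
  · exact h.1
  · exact h.1

theorem xor_two_pow_lt {i n : ℕ} (hi : i < 12) (hn : n < 4096) : n ^^^ 2 ^ i < 4096 := by
  have h := lowMaskCheck_spec hi hn
  simp only [lowMaskCheck, Bool.and_eq_true, Nat.blt_eq] at h
  exact h.1

/-- The image of a mask under the change of digit `i`. -/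
def flipMask (i M : ℕ) : ℕ :=
  Nat.lor (Nat.shiftLeft (Nat.land M (lowMask i)) (Nat.pow 2 i))
    (Nat.land (Nat.shiftRight M (Nat.pow 2 i)) (lowMask i))

theorem flipMask_eq (i M : ℕ) : flipMask i M =
    (M &&& lowMask i) <<< 2 ^ i ||| (M >>> 2 ^ i) &&& lowMask i := rfl

/-- Changing digit `i` adds `2 ^ i` to a number whose digit is zero and subtracts it from one whose
digit is one. On masks these are a left shift of one half and a right shift of the other. -/
theorem testBit_flipMask {i n : ℕ} (hi : i < 12) (hn : n < 4096) (M : ℕ) :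
    (flipMask i M).testBit n = M.testBit (n ^^^ 2 ^ i) := by
  have h := lowMaskCheck_spec hi hn
  simp only [lowMaskCheck, Bool.and_eq_true, digit_eq] at h
  replace h := h.2.2
  have e : Nat.xor n (Nat.pow 2 i) = n ^^^ 2 ^ i := rfl
  rw [e] at h
  simp only [flipMask_eq, Nat.testBit_or, Nat.testBit_shiftLeft, Nat.testBit_and,
    Nat.testBit_shiftRight]
  cases hb : n.testBit i
  · simp only [hb, cond_false, Bool.and_eq_true, Nat.beq_eq, Bool.or_eq_true, Nat.blt_eq,
      Bool.not_eq_true', Nat.add_eq, Nat.sub_eq, Nat.pow_eq] at h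
    obtain ⟨h1, h2, h3⟩ := h
    rw [h1, Nat.add_comm, h2]
    rcases h3 with h3 | h3
    · simp [show ¬ 2 ^ i ≤ n by omega]
    · simp [h3]
  · simp only [hb, cond_true, Bool.and_eq_true, Nat.beq_eq, Nat.ble_eq, Bool.not_eq_true',
      Nat.sub_eq, Nat.pow_eq] at h
    obtain ⟨h1, h2, h3, h4⟩ := h
    rw [h1, h3, h4]
    simp [h2]

/-- The word `w` with its symbol in position `i` changed. -/
def flipWord (i : Fin 12) (w : Word 12) : Word 12 := Function.update w i (w i + 1)

theorem flipWord_flipWord (i : Fin 12) (w : Word 12) : flipWord i (flipWord i w) = w := by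
  funext j
  by_cases h : j = i
  · subst h
    rcases zmod_two_cases (w j) with h | h <;> simp [flipWord, h] <;> rfl
  · simp [flipWord, h]

theorem code_flipWord (i : Fin 12) (w : Word 12) : code (flipWord i w) = code w ^^^ 2 ^ i.1 := by
  refine eq_of_code_testBit (xor_two_pow_lt i.2 (code_lt w)) fun j => ?_
  rw [Nat.testBit_xor, testBit_code, Nat.testBit_two_pow, Bool.xor_right_comm]
  congr 1
  by_cases h : j = i
  · subst h
    rcases zmod_two_cases (w j) with h | h <;> simp [flipWord, h]
  · have : i.1 ≠ j.1 := fun h' => h (Fin.ext h'.symm)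
    simp [flipWord, h, this]

theorem mem_toSet_flipMask {i : Fin 12} {M : ℕ} {w : Word 12} :
    w ∈ toSet (flipMask i M) ↔ flipWord i w ∈ toSet M := by
  rw [mem_toSet, mem_toSet, testBit_flipMask i.2 (code_lt w), code_flipWord]

theorem flipWord_left_injective (w : Word 12) : Function.Injective fun i => flipWord i w := by
  intro i j h
  by_contra hij
  have := congrFun h i
  simp [flipWord, hij] at this

/-! ### Neighbourhoods -/

/-- The mask of the words that become elements of `M` by changing one of the first `k` digits. -/
def nbrsUpTo : ℕ → ℕ → ℕ
  | 0, _ => 0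
  | k + 1, M => Nat.lor (nbrsUpTo k M) (flipMask k M)

/-- The mask of the words that become elements of `M` by changing one digit. -/
def nbrs (M : ℕ) : ℕ :=
  force M fun M =>
    (flipMask 0 M).lor (flipMask 1 M) |>.lor (flipMask 2 M) |>.lor (flipMask 3 M)
      |>.lor (flipMask 4 M) |>.lor (flipMask 5 M) |>.lor (flipMask 6 M) |>.lor (flipMask 7 M)
      |>.lor (flipMask 8 M) |>.lor (flipMask 9 M) |>.lor (flipMask 10 M) |>.lor (flipMask 11 M)

theorem nbrs_eq (M : ℕ) : nbrs M = nbrsUpTo 12 M := by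
  have h : nbrsUpTo 1 M = flipMask 0 M := Nat.zero_or _
  rw [nbrs, force_eq, ← h]; rfl

theorem testBit_nbrsUpTo {k n : ℕ} (hk : k ≤ 12) (hn : n < 4096) (M : ℕ) :
    (nbrsUpTo k M).testBit n = true ↔ ∃ i < k, M.testBit (n ^^^ 2 ^ i) = true := by
  induction k with
  | zero => simp [nbrsUpTo]
  | succ k ih =>
    rw [nbrsUpTo, Nat.lor_eq, Nat.testBit_or, Bool.or_eq_true, ih (by omega),
      testBit_flipMask (by omega) hn]
    simp only [Nat.lt_succ_iff_lt_or_eq]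
    constructor
    · rintro (⟨i, hi, h⟩ | h)
      exacts [⟨i, .inl hi, h⟩, ⟨k, .inr rfl, h⟩]
    · rintro ⟨i, hi | rfl, h⟩
      exacts [.inl ⟨i, hi, h⟩, .inr h]

theorem mem_toSet_nbrs {M : ℕ} {w : Word 12} :
    w ∈ toSet (nbrs M) ↔ ∃ i, flipWord i w ∈ toSet M := by
  rw [mem_toSet, nbrs_eq, testBit_nbrsUpTo le_rfl (code_lt w)]
  constructor
  · rintro ⟨i, hi, h⟩
    exact ⟨⟨i, hi⟩, by rwa [mem_toSet, code_flipWord]⟩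
  · rintro ⟨i, h⟩
    exact ⟨i, i.2, by rwa [mem_toSet, code_flipWord] at h⟩

/-- Adds one to the counters of the elements of `F`, where `P` consists of the masks of the words
with counters at least one and at least two. -/
def addCover (F : ℕ) (P : ℕ × ℕ) : ℕ × ℕ :=
  match P with
  | (N, D) => force F fun F => force (Nat.lor D (Nat.land N F)) fun D' =>
      force (Nat.lor N F) fun N' => (N', D')

/-- The masks of the words that become elements of `M` by changing one of the first `k` digits,
in at least one and in at least two ways. -/
def coversUpTo : ℕ → ℕ → ℕ × ℕ
  | 0, _ => (0, 0)
  | k + 1, M => addCover (flipMask k M) (coversUpTo k M)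

/-- The masks of the words that become elements of `M` by changing one digit, in at least one
and in at least two ways. -/
def covers (M : ℕ) : ℕ × ℕ :=
  force M fun M =>
    addCover (flipMask 11 M) <| addCover (flipMask 10 M) <| addCover (flipMask 9 M) <|
    addCover (flipMask 8 M) <| addCover (flipMask 7 M) <| addCover (flipMask 6 M) <|
    addCover (flipMask 5 M) <| addCover (flipMask 4 M) <| addCover (flipMask 3 M) <|
    addCover (flipMask 2 M) <| addCover (flipMask 1 M) <| addCover (flipMask 0 M) (0, 0)

theorem covers_eq (M : ℕ) : covers M = coversUpTo 12 M := by
  rw [covers, force_eq]; rfl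

theorem coversUpTo_fst (k M : ℕ) : (coversUpTo k M).1 = nbrsUpTo k M := by
  induction k with
  | zero => rfl
  | succ k ih => simp only [coversUpTo, addCover, nbrsUpTo, ih, force_eq]

theorem coversUpTo_snd (k M : ℕ) :
    (coversUpTo (k + 1) M).2 = (coversUpTo k M).2 ||| nbrsUpTo k M &&& flipMask k M := by
  simp only [coversUpTo, addCover, coversUpTo_fst, force_eq]; rfl

/-- A word enters the second mask when a digit change reaches `M` after a smaller digit has already
done so; hence the ordered pairs `i < j`. -/
theorem testBit_coversUpTo_snd {k n : ℕ} (hk : k ≤ 12) (hn : n < 4096) (M : ℕ) :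
    (coversUpTo k M).2.testBit n = true ↔
      ∃ j < k, ∃ i < j, M.testBit (n ^^^ 2 ^ i) = true ∧ M.testBit (n ^^^ 2 ^ j) = true := by
  induction k with
  | zero => simp [coversUpTo]
  | succ k ih =>
    rw [coversUpTo_snd, Nat.testBit_or, Bool.or_eq_true, ih (by omega), Nat.testBit_and,
      Bool.and_eq_true, testBit_flipMask (by omega) hn, testBit_nbrsUpTo (by omega) hn]
    simp only [Nat.lt_succ_iff_lt_or_eq]
    constructor
    · rintro (⟨j, hj, h⟩ | ⟨⟨i, hi, h⟩, h'⟩)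
      exacts [⟨j, .inl hj, h⟩, ⟨k, .inr rfl, i, hi, h, h'⟩]
    · rintro ⟨j, hj | rfl, i, hi, h, h'⟩
      exacts [.inl ⟨j, hj, i, hi, h, h'⟩, .inr ⟨⟨i, hi, h⟩, h'⟩]

theorem covers_fst (M : ℕ) : (covers M).1 = nbrs M := by
  rw [covers_eq, nbrs_eq, coversUpTo_fst]

theorem mem_toSet_covers_snd {M : ℕ} {w : Word 12} :
    w ∈ toSet (covers M).2 ↔ ∃ i j, i ≠ j ∧ flipWord i w ∈ toSet M ∧ flipWord j w ∈ toSet M := by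
  rw [mem_toSet, covers_eq, testBit_coversUpTo_snd le_rfl (code_lt w)]
  constructor
  · rintro ⟨j, hj, i, hi, h, h'⟩
    refine ⟨⟨i, by omega⟩, ⟨j, hj⟩, ?_, ?_, ?_⟩
    · simpa using hi.ne
    · rwa [mem_toSet, code_flipWord]
    · rwa [mem_toSet, code_flipWord]
  · rintro ⟨i, j, hij, h, h'⟩
    rw [mem_toSet, code_flipWord] at h h'
    rcases lt_or_gt_of_ne hij with hl | hl
    · exact ⟨j, j.2, i, hl, h, h'⟩
    · exact ⟨i, i.2, j, hl, h', h⟩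

/-! ### Coordinate permutations -/

/-- The mask of the words whose digits `i` and `j` are different. -/
def unequalMask (i j : ℕ) : ℕ :=
  Nat.xor (bitMask i) (cond (xor (digit offset i) (digit offset j)) (lowMask j) (bitMask j))

theorem unequalMask_eq (i j : ℕ) : unequalMask i j =
    bitMask i ^^^ cond (xor (digit offset i) (digit offset j)) (lowMask j) (bitMask j) := rfl

/-- The masks see digits of codes. If `offset` complements exactly one of the two positions, then
different symbols mean equal code digits, and `lowMask j` has to take the place of `bitMask j`. -/
theorem mem_toSet_unequalMask {i j : Fin 12} {w : Word 12} :
    w ∈ toSet (unequalMask i j) ↔ w i ≠ w j := by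
  rw [mem_toSet, unequalMask_eq, Nat.testBit_xor, testBit_bitMask i.2 (code_lt w), testBit_code]
  cases h1 : digit offset i <;> cases h2 : digit offset j <;>
    simp only [Bool.xor_false, Bool.xor_true, Bool.not_true, Bool.not_false, cond_true,
      cond_false, testBit_bitMask j.2 (code_lt w), testBit_lowMask j.2 (code_lt w), testBit_code,
      h2] <;>
    rcases zmod_two_cases (w i) with h3 | h3 <;> rcases zmod_two_cases (w j) with h4 | h4 <;>
      simp [h3, h4]

/-- The image of a mask under the transposition of the coordinates `i` and `j`. -/
def swapMask (i j M : ℕ) : ℕ :=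
  force M fun M => force (unequalMask i j) fun d =>
    Nat.lor (sdiffMask M d) (Nat.land (flipMask i (flipMask j M)) d)

theorem swapMask_eq (i j M : ℕ) : swapMask i j M =
    sdiffMask M (unequalMask i j) ||| flipMask i (flipMask j M) &&& unequalMask i j := by
  rw [swapMask, force_eq, force_eq]; rfl

theorem permute_mul (g h : Equiv.Perm (Fin 12)) (w : Word 12) :
    permute (g * h) w = permute g (permute h w) := rfl

theorem permute_one (w : Word 12) : permute 1 w = w := rfl

theorem permute_inv_permute (g : Equiv.Perm (Fin 12)) (w : Word 12) :
    permute g⁻¹ (permute g w) = w := by rw [← permute_mul, inv_mul_cancel, permute_one]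

theorem permute_permute_inv (g : Equiv.Perm (Fin 12)) (w : Word 12) :
    permute g (permute g⁻¹ w) = w := by rw [← permute_mul, mul_inv_cancel, permute_one]

theorem permute_injective (g : Equiv.Perm (Fin 12)) : Function.Injective (permute g) :=
  Function.LeftInverse.injective (permute_inv_permute g)

theorem mem_permute_image {g : Equiv.Perm (Fin 12)} {S : Set (Word 12)} {w : Word 12} :
    w ∈ permute g '' S ↔ permute g⁻¹ w ∈ S := by
  constructor
  · rintro ⟨v, hv, rfl⟩
    rwa [permute_inv_permute]
  · exact fun h => ⟨_, h, permute_permute_inv g w⟩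

theorem permute_swap_of_eq {i j : Fin 12} {w : Word 12} (h : w i = w j) :
    permute (Equiv.swap i j) w = w := by
  funext k
  simp only [permute, Equiv.symm_swap, Equiv.swap_apply_def]
  split_ifs with h1 h2
  · rw [h1, h]
  · rw [h2, h]
  · rfl

theorem permute_swap_of_ne {i j : Fin 12} {w : Word 12} (h : w i ≠ w j) :
    permute (Equiv.swap i j) w = flipWord j (flipWord i w) := by
  have hij : i ≠ j := fun e => h (by rw [e])
  have key : w j = w i + 1 ∧ w j + 1 = w i := by
    rcases zmod_two_cases (w i) with h1 | h1 <;> rcases zmod_two_cases (w j) with h2 | h2 <;>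
      rw [h1, h2] at h ⊢ <;> first | exact absurd rfl h | exact ⟨rfl, rfl⟩
  funext k
  simp only [permute, Equiv.symm_swap, Equiv.swap_apply_def, flipWord, Function.update_apply,
    if_neg hij.symm]
  split_ifs with h1 h2 h3
  · exact absurd (h1.symm.trans h2) hij
  · exact key.1
  · exact key.2.symm
  · rfl

/-- A transposition fixes a word whose two symbols agree and changes both symbols otherwise. -/
theorem toSet_swapMask (i j : Fin 12) (M : ℕ) :
    toSet (swapMask i j M) = permute (Equiv.swap i j) '' toSet M := by
  ext w
  rw [mem_permute_image, Equiv.swap_inv, swapMask_eq, toSet_or, toSet_sdiff,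
    toSet_and, Set.mem_union, Set.mem_sdiff, Set.mem_inter_iff, mem_toSet_flipMask,
    mem_toSet_flipMask, mem_toSet_unequalMask]
  by_cases h : w i = w j
  · simp [h, permute_swap_of_eq h]
  · simp [h, permute_swap_of_ne h]

/-- The image of a mask under a cycle of coordinates. -/
def cycleMask : List (Fin 12) → ℕ → ℕ
  | x :: y :: l, M => swapMask x y (cycleMask (y :: l) M)
  | _, M => M

/-- The image of a mask under a product of cycles of coordinates. -/
def permMask : List (List (Fin 12)) → ℕ → ℕ
  | [], M => M
  | c :: cs, M => cycleMask c (permMask cs M)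

theorem image_permute_mul (g h : Equiv.Perm (Fin 12)) (S : Set (Word 12)) :
    permute (g * h) '' S = permute g '' (permute h '' S) := by
  rw [← Set.image_comp]; rfl

theorem image_permute_one (S : Set (Word 12)) : permute 1 '' S = S := by
  have : permute 1 = id := rfl
  rw [this, Set.image_id]

theorem toSet_cycleMask (l : List (Fin 12)) (M : ℕ) :
    toSet (cycleMask l M) = permute l.formPerm '' toSet M := by
  induction l with
  | nil => simp [cycleMask, image_permute_one]
  | cons x l ih =>
    cases l with
    | nil => simp [cycleMask, image_permute_one]
    | cons y l => rw [cycleMask, toSet_swapMask, ih, List.formPerm_cons_cons, image_permute_mul]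

theorem toSet_permMask (cs : List (List (Fin 12))) (M : ℕ) :
    toSet (permMask cs M) = permute (cycles cs) '' toSet M := by
  induction cs with
  | nil => simp [permMask, cycles, image_permute_one]
  | cons c cs ih =>
    rw [permMask, toSet_cycleMask, ih, ← image_permute_mul]
    simp [cycles]

/-! ### Counting -/

/-- The number of ones among the lowest `2 ^ k` digits of `M`. -/
def popcount : ℕ → ℕ → ℕ
  | 0, M => M % 2
  | k + 1, M => match M with
    | 0 => 0
    | Nat.succ m => force (Nat.pow 2 (Nat.pow 2 k)) fun b =>
        Nat.add (force (Nat.mod (Nat.succ m) b) (popcount k))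
          (force (Nat.div (Nat.succ m) b) (popcount k))

theorem popcount_eq (k : ℕ) : ∀ M : ℕ,
    popcount k M = ((Finset.range (2 ^ k)).filter fun n => M.testBit n = true).card := by
  induction k with
  | zero =>
    intro M
    rcases Nat.mod_two_eq_zero_or_one M with h | h <;>
      simp [popcount, Finset.filter_singleton, h, Nat.testBit_zero]
  | succ k ih =>
    intro M
    have key : popcount (k + 1) M = popcount k (M % 2 ^ 2 ^ k) + popcount k (M / 2 ^ 2 ^ k) := by
      cases M with
      | zero =>
        have h0 : popcount k 0 = 0 := by rw [ih]; simp
        simp [popcount, h0]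
      | succ m => simp only [popcount, force_eq]; rfl
    rw [key, ih, ih, pow_succ, mul_two, Finset.range_eq_Ico, Finset.range_eq_Ico,
      ← Finset.Ico_union_Ico_eq_Ico (Nat.zero_le (2 ^ k)) (Nat.le_add_right _ _),
      Finset.filter_union, Finset.card_union_of_disjoint]
    · congr 1
      · congr 1
        refine Finset.filter_congr fun n hn => ?_
        rw [Finset.mem_Ico] at hn
        rw [Nat.testBit_mod_two_pow]
        simp [hn.2]
      · have himg : (Finset.Ico (2 ^ k) (2 ^ k + 2 ^ k)) =
            (Finset.range (2 ^ k)).map (addLeftEmbedding (2 ^ k)) := by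
          rw [Finset.range_eq_Ico, Finset.map_add_left_Ico, add_zero]
        rw [himg, Finset.filter_map, Finset.card_map, ← Finset.range_eq_Ico]
        congr 1
        refine Finset.filter_congr fun n hn => ?_
        simp [Nat.testBit_div_two_pow, Nat.add_comm]
    · exact Finset.disjoint_filter_filter (Finset.Ico_disjoint_Ico_consecutive _ _ _)

/-- The number of elements of the set given by a mask. -/
def maskCard (M : ℕ) : ℕ := popcount 12 M

theorem ncard_toSet (M : ℕ) : (toSet M).ncard = maskCard M := by
  rw [maskCard, popcount_eq, ← Set.ncard_coe_finset]
  refine Set.ncard_congr (fun w _ => code w) ?_ ?_ ?_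
  · intro w hw
    rw [mem_toSet] at hw
    simpa [code_lt w] using hw
  · exact fun v w _ _ h => code_injective h
  · intro n hn
    simp only [Finset.coe_filter, Finset.mem_range, Set.mem_ofPred_eq] at hn
    refine ⟨ofCode n, ?_, code_ofCode hn.1⟩
    rw [mem_toSet, code_ofCode hn.1]
    exact hn.2

/-! ### Maximum cliques -/

theorem hammingNorm_flipWord_of_zero {i : Fin 12} {w : Word 12} (h : w i = 0) :
    hammingNorm (flipWord i w) = hammingNorm w + 1 := by
  have : (Finset.univ.filter fun j => flipWord i w j ≠ 0) =
      insert i (Finset.univ.filter fun j => w j ≠ 0) := by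
    ext j
    simp only [Finset.mem_filter, Finset.mem_univ, true_and, Finset.mem_insert]
    by_cases hj : j = i
    · subst hj; simp [flipWord, h]
    · simp [flipWord, hj]
  rw [hammingNorm, this, Finset.card_insert_of_notMem (by simp [h]), hammingNorm]

theorem hammingNorm_flipWord_of_one {i : Fin 12} {w : Word 12} (h : w i = 1) :
    hammingNorm (flipWord i w) + 1 = hammingNorm w := by
  have h' : flipWord i w i = 0 := by simp [flipWord, h]; rfl
  rw [← hammingNorm_flipWord_of_zero h', flipWord_flipWord]

theorem even_hammingNorm_flipWord {i : Fin 12} {w : Word 12} :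
    Even (hammingNorm (flipWord i w)) ↔ Odd (hammingNorm w) := by
  rw [← Nat.not_even_iff_odd]
  rcases zmod_two_cases (w i) with h | h
  · rw [hammingNorm_flipWord_of_zero h, Nat.even_add_one]
  · rw [← hammingNorm_flipWord_of_one h, Nat.even_add_one, not_not]

theorem flipWord_comm (i j : Fin 12) (w : Word 12) :
    flipWord i (flipWord j w) = flipWord j (flipWord i w) := by
  by_cases h : i = j
  · rw [h]
  · funext k
    by_cases h1 : k = i <;> by_cases h2 : k = j <;>
      simp [flipWord, h1, h2, h, Ne.symm h, Function.update_apply]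

theorem flipWord_apply_ne_iff {i k : Fin 12} {v w : Word 12} :
    w k ≠ flipWord i v k ↔ (w k ≠ v k ↔ k ≠ i) := by
  by_cases h : k = i
  · subst h
    rcases zmod_two_cases (w k) with h1 | h1 <;> rcases zmod_two_cases (v k) with h2 | h2 <;>
      simp [flipWord, h1, h2]; rfl
  · simp [flipWord, h]

theorem hammingDist_eq_two_iff {v w : Word 12} :
    hammingDist v w = 2 ↔ ∃ i j, i ≠ j ∧ w = flipWord i (flipWord j v) := by
  rw [hammingDist, Finset.card_eq_two]
  refine exists_congr fun i => exists_congr fun j => and_congr_right fun hij => ?_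
  constructor
  · intro h
    funext k
    by_contra hk
    have h1 : k ∈ (Finset.univ.filter fun k => v k ≠ w k) ↔ k ∈ ({i, j} : Finset (Fin 12)) := by
      rw [h]
    have h2 := hk
    simp only [Finset.mem_filter, Finset.mem_univ, true_and, Finset.mem_insert,
      Finset.mem_singleton] at h1
    rw [← ne_eq, flipWord_apply_ne_iff, flipWord_apply_ne_iff, ne_comm] at h2
    by_cases hi : k = i <;> by_cases hj : k = j <;> simp_all
  · rintro rfl
    ext k
    simp only [Finset.mem_filter, Finset.mem_univ, true_and, Finset.mem_insert,
      Finset.mem_singleton]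
    rw [flipWord_apply_ne_iff, flipWord_apply_ne_iff]
    by_cases hi : k = i <;> by_cases hj : k = j <;> simp_all

theorem hammingDist_flipWord_flipWord {i j : Fin 12} (h : i ≠ j) (c : Word 12) :
    hammingDist (flipWord i c) (flipWord j c) = 2 :=
  hammingDist_eq_two_iff.2 ⟨i, j, h, by rw [flipWord_comm i j, flipWord_flipWord]⟩

/-- With four distinct indices the two words would differ in four positions. -/
theorem shares_of_hammingDist_eq_two {i j k l : Fin 12} {a : Word 12} (hij : i ≠ j) (hkl : k ≠ l)
    (h : hammingDist (flipWord i (flipWord j a)) (flipWord k (flipWord l a)) = 2) :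
    i = k ∨ i = l ∨ j = k ∨ j = l := by
  by_contra! hc
  obtain ⟨h1, h2, h3, h4⟩ := hc
  have hs : ({i, j, k, l} : Finset (Fin 12)) ⊆ Finset.univ.filter fun m =>
      flipWord i (flipWord j a) m ≠ flipWord k (flipWord l a) m := by
    intro m hm
    simp only [Finset.mem_insert, Finset.mem_singleton] at hm
    simp only [Finset.mem_filter, Finset.mem_univ, true_and]
    rw [flipWord_apply_ne_iff, flipWord_apply_ne_iff, ne_comm, flipWord_apply_ne_iff,
      flipWord_apply_ne_iff]
    rcases hm with rfl | rfl | rfl | rfl <;> simp_all [Ne.symm]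
  have hcard : ({i, j, k, l} : Finset (Fin 12)).card = 4 := by
    rw [Finset.card_insert_of_notMem, Finset.card_insert_of_notMem, Finset.card_insert_of_notMem,
      Finset.card_singleton] <;> simp [*]
  have := Finset.card_le_card hs
  rw [hcard] at this
  rw [hammingDist] at h
  omega

/-- The centre is `flipWord i a`. A word of `S` other than `a` differs from `a` in two positions,
and this pair must meet both `{i, j}` and `{i, k}`. So it contains `i` or equals `{j, k}`; a fifth
word excludes the latter. -/
theorem exists_center_aux {S : Finset (Word 12)}
    (hS : ∀ v ∈ S, ∀ w ∈ S, v ≠ w → hammingDist v w = 2) (h5 : 5 ≤ S.card)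
    {a : Word 12} {i j k : Fin 12} (ha : a ∈ S) (hij : i ≠ j) (hik : i ≠ k)
    (hjk : j ≠ k) (hb : flipWord i (flipWord j a) ∈ S) (hc : flipWord i (flipWord k a) ∈ S) :
    ∀ d ∈ S, ∃ r, d = flipWord r (flipWord i a) := by
  classical
  have key : ∀ d ∈ S, (∃ r, d = flipWord r (flipWord i a)) ∨ d = flipWord j (flipWord k a) := by
    intro d hd
    by_cases hda : d = a
    · exact .inl ⟨i, by rw [hda, flipWord_flipWord]⟩
    obtain ⟨p, q, hpq, rfl⟩ := hammingDist_eq_two_iff.1 (hS a ha d hd (Ne.symm hda))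
    by_cases hp : p = i
    · exact .inl ⟨q, by rw [hp, flipWord_comm]⟩
    by_cases hq : q = i
    · exact .inl ⟨p, by rw [hq]⟩
    right
    have e1 : j = p ∨ j = q := by
      by_cases h : flipWord i (flipWord j a) = flipWord p (flipWord q a)
      · have h1 := congrFun h i
        simp [flipWord, hij, Ne.symm hp, Ne.symm hq] at h1
      · have := shares_of_hammingDist_eq_two hij hpq (hS _ hb _ hd h)
        tauto
    have e2 : k = p ∨ k = q := by
      by_cases h : flipWord i (flipWord k a) = flipWord p (flipWord q a)
      · have h1 := congrFun h i
        simp [flipWord, hik, Ne.symm hp, Ne.symm hq] at h1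
      · have := shares_of_hammingDist_eq_two hik hpq (hS _ hc _ hd h)
        tauto
    rcases e1 with rfl | rfl <;> rcases e2 with rfl | rfl
    · exact absurd rfl hjk
    · rfl
    · rw [flipWord_comm]
    · exact absurd rfl hjk
  intro d hd
  refine (key d hd).elim id fun hde => ?_
  exfalso
  -- Here `d` is `a` with the positions `j` and `k` changed. These four words are mutually at
  -- distance two and have no common neighbour, which is why five words are required.
  obtain ⟨f, hf, hf'⟩ := Finset.exists_mem_notMem_of_card_lt_card
    (s := {a, flipWord i (flipWord j a), flipWord i (flipWord k a), d}) (t := S)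
    (lt_of_le_of_lt Finset.card_le_four (by omega))
  simp only [Finset.mem_insert, Finset.mem_singleton, not_or] at hf'
  obtain ⟨hfa, hfb, hfc, hfd⟩ := hf'
  rcases key f hf with ⟨r, rfl⟩ | h
  · have hri : r ≠ i := by
      rintro rfl
      exact hfa (flipWord_flipWord _ _)
    rw [hde] at hd
    have := shares_of_hammingDist_eq_two hri hjk (hS _ hf _ hd fun h => hfd (by rw [h, hde]))
    rcases this with rfl | rfl | h | h
    · exact hfb (flipWord_comm _ _ _)
    · exact hfc (flipWord_comm _ _ _)
    · exact hij h
    · exact hik h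
  · exact hfd (h.trans hde.symm)

/-- Five words at mutual distance two are at distance one from a common word. -/
theorem exists_center {S : Finset (Word 12)} (hS : ∀ v ∈ S, ∀ w ∈ S, v ≠ w → hammingDist v w = 2)
    (h5 : 5 ≤ S.card) : ∃ c, ∀ d ∈ S, ∃ r, d = flipWord r c := by
  classical
  obtain ⟨a, ha⟩ := Finset.card_pos.1 (show 0 < S.card by omega)
  obtain ⟨b, hb, hba⟩ := Finset.exists_mem_notMem_of_card_lt_card (s := {a}) (t := S)
    (by rw [Finset.card_singleton]; omega)
  obtain ⟨c, hc, hc'⟩ := Finset.exists_mem_notMem_of_card_lt_card (s := {a, b}) (t := S)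
    (lt_of_le_of_lt Finset.card_le_two (by omega))
  simp only [Finset.mem_insert, Finset.mem_singleton, not_or] at hba hc'
  obtain ⟨i, j, hij, rfl⟩ := hammingDist_eq_two_iff.1 (hS a ha b hb (Ne.symm hba))
  obtain ⟨k, l, hkl, rfl⟩ := hammingDist_eq_two_iff.1 (hS a ha c hc (Ne.symm hc'.1))
  have aux : ∀ i j k l : Fin 12, i ≠ j → k ≠ l → flipWord i (flipWord j a) ∈ S →
      flipWord k (flipWord l a) ∈ S → flipWord k (flipWord l a) ≠ flipWord i (flipWord j a) →
      i = k → ∃ c, ∀ d ∈ S, ∃ r, d = flipWord r c := by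
    rintro i j k l hij hkl hb hc hcb rfl
    exact ⟨_, exists_center_aux hS h5 ha hij hkl (fun h => hcb (by rw [h])) hb hc⟩
  rcases shares_of_hammingDist_eq_two hij hkl (hS _ hb _ hc (Ne.symm hc'.2)) with h | h | h | h
  · exact aux i j k l hij hkl hb hc hc'.2 h
  · rw [flipWord_comm k l] at hc hc'
    exact aux i j l k hij hkl.symm hb hc hc'.2 h
  · rw [flipWord_comm i j] at hb hc'
    exact aux j i k l hij.symm hkl hb hc hc'.2 h
  · rw [flipWord_comm i j] at hb hc'
    rw [flipWord_comm k l] at hc hc'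
    exact aux j i l k hij.symm hkl.symm hb hc hc'.2 h

/-- The number of words of `T` at distance one from `c`. -/
noncomputable def degree (T : Set (Word 12)) (c : Word 12) : ℕ :=
  {i : Fin 12 | flipWord i c ∈ T}.ncard

open Classical in
/-- The words with property `p` at distance one from `c`. -/
noncomputable def star (p : Word 12 → Prop) (c : Word 12) : Finset {w : Word 12 // p w} :=
  Finset.univ.filter fun w => ∃ i, w.1 = flipWord i c

theorem mem_star {p : Word 12 → Prop} {c : Word 12} {w : {w : Word 12 // p w}} :
    w ∈ star p c ↔ ∃ i, w.1 = flipWord i c := by simp [star]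

theorem ncard_inter_star {p : Word 12 → Prop} (S : Set {w : Word 12 // p w}) (c : Word 12) :
    (S ∩ ↑(star p c)).ncard = degree (Subtype.val '' S) c := by
  symm
  refine Set.ncard_congr (fun i hi => ⟨flipWord i c, ?_⟩) ?_ ?_ ?_
  · obtain ⟨v, -, h⟩ := hi
    rw [← h]; exact v.2
  · rintro i ⟨v, hv, h⟩
    refine ⟨?_, Finset.mem_coe.2 (mem_star.2 ⟨i, rfl⟩)⟩
    have : v = ⟨flipWord i c, h ▸ v.2⟩ := Subtype.ext h
    rwa [← this]
  · intro i j _ _ h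
    exact flipWord_left_injective c (Subtype.ext_iff.1 h)
  · rintro v ⟨hv, hv'⟩
    obtain ⟨i, hi⟩ := mem_star.1 (Finset.mem_coe.1 hv')
    exact ⟨i, ⟨v, hv, hi⟩, Subtype.ext hi.symm⟩

theorem card_star (p : Word 12 → Prop) (c : Word 12) : (star p c).card = degree {w | p w} c := by
  have := ncard_inter_star (p := p) Set.univ c
  rw [Set.univ_inter, Set.ncard_coe_finset] at this
  rw [this, Set.image_univ, Subtype.range_coe_subtype]

/-- Used with `m = 12` for the halved cube and `m = 7` for `J(12,6)`. Stars are cliques, and a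
clique with at least five elements lies in a star, so for `m ≥ 5` the nonempty stars are exactly the
largest cliques. -/
theorem isMaximumClique_iff_star {p : Word 12 → Prop} {G : SimpleGraph {w : Word 12 // p w}}
    (hG : ∀ x y, G.Adj x y ↔ hammingDist x.1 y.1 = 2) {m : ℕ} (hm : 5 ≤ m)
    (hstar : ∀ c, star p c = ∅ ∨ (star p c).card = m) (hex : ∃ c, star p c ≠ ∅)
    (B : Finset {w : Word 12 // p w}) :
    G.IsMaximumClique B ↔ ∃ c, B = star p c ∧ star p c ≠ ∅ := by
  classical
  have hclique : ∀ c, G.IsClique (star p c : Set {w : Word 12 // p w}) := by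
    intro c x hx y hy hxy
    obtain ⟨i, hi⟩ := mem_star.1 (Finset.mem_coe.1 hx)
    obtain ⟨j, hj⟩ := mem_star.1 (Finset.mem_coe.1 hy)
    rw [hG, hi, hj]
    exact hammingDist_flipWord_flipWord (fun h => hxy (Subtype.ext (by rw [hi, hj, h]))) c
  have hsub : ∀ B : Finset {w : Word 12 // p w}, G.IsClique (B : Set {w : Word 12 // p w}) →
      5 ≤ B.card → ∃ c, B ⊆ star p c := by
    intro B hB h5
    obtain ⟨c, hc⟩ := exists_center (S := B.map (Function.Embedding.subtype _)) (by
      intro v hv w hw hvw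
      obtain ⟨x, hx, rfl⟩ := Finset.mem_map.1 hv
      obtain ⟨y, hy, rfl⟩ := Finset.mem_map.1 hw
      exact (hG x y).1 (hB hx hy fun h => hvw (by rw [h]))) (by rwa [Finset.card_map])
    exact ⟨c, fun x hx => mem_star.2 (hc _ (Finset.mem_map_of_mem _ hx))⟩
  have hle : ∀ B : Finset {w : Word 12 // p w}, G.IsClique (B : Set {w : Word 12 // p w}) →
      B.card ≤ m := by
    intro B hB
    rcases lt_or_ge B.card 5 with h | h
    · omega
    · obtain ⟨c, hc⟩ := hsub B hB h
      have := Finset.card_le_card hc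
      rcases hstar c with h' | h'
      · rw [h', Finset.card_empty] at this; omega
      · omega
  have hcard : ∀ c, star p c ≠ ∅ → (star p c).card = m := fun c hc => (hstar c).resolve_left hc
  constructor
  · intro hB
    obtain ⟨c₀, hc₀⟩ := hex
    have h1 : m ≤ B.card := by
      rw [← hcard c₀ hc₀]
      exact hB.maximum _ (hclique c₀)
    obtain ⟨c, hc⟩ := hsub B hB.isClique (by omega)
    have hne : star p c ≠ ∅ := by
      rintro h
      rw [h, Finset.subset_empty] at hc
      rw [hc, Finset.card_empty] at h1
      omega
    exact ⟨c, Finset.eq_of_subset_of_card_le hc (by rw [hcard c hne]; exact h1), hne⟩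
  · rintro ⟨c, rfl, hc⟩
    exact ⟨hclique c, fun t ht => by rw [hcard c hc]; exact hle t ht⟩

/-! ### Cliques of the two graphs; trades and Steiner systems in terms of degrees. -/

theorem degree_even_of_odd {c : Word 12} (hc : Odd (hammingNorm c)) :
    degree {w | Even (hammingNorm w)} c = 12 := by
  have : {i : Fin 12 | flipWord i c ∈ {w | Even (hammingNorm w)}} = Set.univ := by
    ext i; simpa using even_hammingNorm_flipWord.2 hc
  rw [degree, this, Set.ncard_univ, Nat.card_eq_fintype_card, Fintype.card_fin]

theorem star_even_ne_empty_iff {c : Word 12} :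
    star (fun w => Even (hammingNorm w)) c ≠ ∅ ↔ Odd (hammingNorm c) := by
  constructor
  · intro h
    obtain ⟨w, hw⟩ := Finset.nonempty_iff_ne_empty.2 h
    obtain ⟨i, hi⟩ := mem_star.1 hw
    rw [← even_hammingNorm_flipWord (i := i), ← hi]
    exact w.2
  · intro h h'
    have := card_star (fun w => Even (hammingNorm w)) c
    rw [h', degree_even_of_odd h] at this
    simp at this

theorem exists_hammingNorm_eq_five : ∃ c : Word 12, hammingNorm c = 5 :=
  ⟨![1, 1, 1, 1, 1, 0, 0, 0, 0, 0, 0, 0], by decide⟩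

theorem halvedCube_isMaximumClique_iff (B : Finset {w : Word 12 // Even (hammingNorm w)}) :
    (halvedCube 12).IsMaximumClique B ↔
      ∃ c, B = star (fun w => Even (hammingNorm w)) c ∧ Odd (hammingNorm c) := by
  rw [isMaximumClique_iff_star (m := 12) (fun x y => Iff.rfl) (by norm_num)]
  · simp_rw [star_even_ne_empty_iff]
  · intro c
    refine or_iff_not_imp_left.2 fun h => ?_
    rw [card_star, degree_even_of_odd (star_even_ne_empty_iff.1 h)]
  · obtain ⟨c, hc⟩ := exists_hammingNorm_eq_five
    exact ⟨c, star_even_ne_empty_iff.2 (by rw [hc]; decide)⟩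

/-- A neighbour of weight 6 arises by changing one of the seven zeros of a word of weight 5, or one
of the seven ones of a word of weight 7. -/
theorem degree_six_of_mem {c : Word 12} (hc : hammingNorm c = 5 ∨ hammingNorm c = 7) :
    degree {w | hammingNorm w = 6} c = 7 := by
  rcases hc with hc | hc
  · have : {i : Fin 12 | flipWord i c ∈ {w | hammingNorm w = 6}} =
        ↑(Finset.univ.filter fun i => c i ≠ 0)ᶜ := by
      ext i
      rcases zmod_two_cases (c i) with h | h
      · simp [h, hammingNorm_flipWord_of_zero h, hc]
      · have := hammingNorm_flipWord_of_one h
        simp [h]; omega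
    rw [degree, this, Set.ncard_coe_finset, Finset.card_compl, Fintype.card_fin]
    rw [hammingNorm] at hc
    omega
  · have : {i : Fin 12 | flipWord i c ∈ {w | hammingNorm w = 6}} =
        ↑(Finset.univ.filter fun i => c i ≠ 0) := by
      ext i
      rcases zmod_two_cases (c i) with h | h
      · simp [h, hammingNorm_flipWord_of_zero h, hc]
      · have := hammingNorm_flipWord_of_one h
        simp [h]; omega
    rw [degree, this, Set.ncard_coe_finset]
    exact hc

theorem star_six_ne_empty_iff {c : Word 12} :
    star (fun w => hammingNorm w = 6) c ≠ ∅ ↔ hammingNorm c = 5 ∨ hammingNorm c = 7 := by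
  constructor
  · intro h
    obtain ⟨w, hw⟩ := Finset.nonempty_iff_ne_empty.2 h
    obtain ⟨i, hi⟩ := mem_star.1 hw
    have h6 := w.2
    rw [hi] at h6
    rcases zmod_two_cases (c i) with h | h
    · have := hammingNorm_flipWord_of_zero h
      omega
    · have := hammingNorm_flipWord_of_one h
      omega
  · intro h h'
    have := card_star (fun w => hammingNorm w = 6) c
    rw [h', degree_six_of_mem h] at this
    simp at this

theorem johnson_isMaximumClique_iff (B : Finset {w : Word 12 // hammingNorm w = 6}) :
    (johnson 12 6).IsMaximumClique B ↔
      ∃ c, B = star (fun w => hammingNorm w = 6) c ∧ (hammingNorm c = 5 ∨ hammingNorm c = 7) := by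
  rw [isMaximumClique_iff_star (m := 7) (fun x y => Iff.rfl) (by norm_num)]
  · simp_rw [star_six_ne_empty_iff]
  · intro c
    refine or_iff_not_imp_left.2 fun h => ?_
    rw [card_star, degree_six_of_mem (star_six_ne_empty_iff.1 h)]
  · obtain ⟨c, hc⟩ := exists_hammingNorm_eq_five
    exact ⟨c, star_six_ne_empty_iff.2 (.inl hc)⟩

theorem isSteinerSystem_iff {W : Set (Word 12)} : IsSteinerSystem 6 12 W ↔
    (∀ w ∈ W, hammingNorm w = 6) ∧
      ∀ c, hammingNorm c = 5 ∨ hammingNorm c = 7 → degree W c = 1 := by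
  refine and_congr_right fun h6 => ?_
  have key : Subtype.val '' (Subtype.val ⁻¹' W : Set {w : Word 12 // hammingNorm w = 6}) = W := by
    ext w
    exact ⟨fun ⟨v, hv, h⟩ => h ▸ hv, fun hw => ⟨⟨w, h6 w hw⟩, hw, rfl⟩⟩
  constructor
  · intro h c hc
    have := h _ ((johnson_isMaximumClique_iff _).2 ⟨c, rfl, hc⟩)
    rwa [ncard_inter_star, key] at this
  · intro h B hB
    obtain ⟨c, rfl, hc⟩ := (johnson_isMaximumClique_iff B).1 hB
    rw [ncard_inter_star, key]
    exact h c hc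

theorem isCliqueTrade_iff {A B : Set {w : Word 12 // Even (hammingNorm w)}} :
    IsCliqueTrade (halvedCube 12) A B ↔ Disjoint A B ∧ A.Nonempty ∧ B.Nonempty ∧
      ∀ c, Odd (hammingNorm c) → degree (Subtype.val '' A) c = degree (Subtype.val '' B) c ∧
        degree (Subtype.val '' A) c ≤ 1 := by
  constructor
  · intro h
    refine ⟨h.disjoint, h.nonempty₀, h.nonempty₁, fun c hc => ?_⟩
    have := h.balanced _ ((halvedCube_isMaximumClique_iff _).2 ⟨c, rfl, hc⟩)
    rw [ncard_inter_star, ncard_inter_star] at this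
    exact ⟨this.1, by omega⟩
  · rintro ⟨h1, h2, h3, h4⟩
    refine ⟨h1, h2, h3, fun B hB => ?_⟩
    obtain ⟨c, rfl, hc⟩ := (halvedCube_isMaximumClique_iff B).1 hB
    rw [ncard_inter_star, ncard_inter_star]
    have := h4 c hc
    exact ⟨this.1, by omega⟩

/-! ### Masks of the words of given weight -/

/-- The contribution of digit `i` of the code `n` to the weight of a word. -/
def digitWeight (n i : ℕ) : ℕ := (xor (digit n i) (digit offset i)).toNat

/-- `p n s` holds for all numbers `n` with `n / 2 ^ k = b`, where `s` exceeds the contribution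
of the lowest `k` digits of `n` to the weight by `t`. -/
def allBitsWeighted : ℕ → ℕ → ℕ → (ℕ → ℕ → Bool) → Bool
  | 0, b, t, p => p b t
  | k + 1, b, t, p => force (Nat.mul 2 b) fun c =>
      cond (digit offset k)
        (and (allBitsWeighted k c (Nat.succ t) p) (allBitsWeighted k (Nat.succ c) t p))
        (and (allBitsWeighted k c t p) (allBitsWeighted k (Nat.succ c) (Nat.succ t) p))

/-- At a digit of `offset` it is the digit zero of the code that counts for the weight, so the
counter grows in the other branch there. -/
theorem allBitsWeighted_spec (k : ℕ) : ∀ {b t : ℕ} {p : ℕ → ℕ → Bool},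
    allBitsWeighted k b t p = true → ∀ n, n / 2 ^ k = b →
      p n (t + ∑ i ∈ Finset.range k, digitWeight n i) = true := by
  induction k with
  | zero =>
    rintro b t p h n hn
    obtain rfl : n = b := by simpa using hn
    rw [Finset.sum_range_zero, Nat.add_zero]
    exact h
  | succ k ih =>
    rintro b t p h n hn
    rw [Finset.sum_range_succ, Nat.add_comm (Finset.sum _ _), ← Nat.add_assoc]
    have hb : n / 2 ^ k / 2 = b := by rw [Nat.div_div_eq_div_mul, ← pow_succ]; exact hn
    have ht : digit n k = decide (n / 2 ^ k % 2 = 1) := by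
      rw [digit_eq, Nat.testBit_eq_decide_div_mod_eq]
    have hc : ∀ c, n / 2 ^ k % 2 = c → n / 2 ^ k = Nat.mul 2 b + c := by
      intro c hc
      rw [Nat.mul_eq]; omega
    cases ho : digit offset k <;>
      simp only [allBitsWeighted, force_eq, ho, cond_true, cond_false, Bool.and_eq_true] at h <;>
      rcases Nat.mod_two_eq_zero_or_one (n / 2 ^ k) with h' | h'
    · have := ih h.1 n (hc _ h')
      rwa [digitWeight, ht, ho, h']
    · have := ih h.2 n (hc _ h')
      rwa [digitWeight, ht, ho, h']
    · have := ih h.1 n (hc _ h')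
      rwa [digitWeight, ht, ho, h']
    · have := ih h.2 n (hc _ h')
      rwa [digitWeight, ht, ho, h']

/-- `p` holds for the codes and the weights of all words. -/
def allWords (p : ℕ → ℕ → Bool) : Bool := allBitsWeighted 12 0 0 p

theorem hammingNorm_eq_sum (w : Word 12) :
    hammingNorm w = ∑ i ∈ Finset.range 12, digitWeight (code w) i := by
  rw [hammingNorm, Finset.card_filter, Finset.sum_range]
  refine Finset.sum_congr rfl fun i _ => ?_
  rw [digitWeight, digit_eq (code w), testBit_code]
  rcases zmod_two_cases (w i) with h | h <;> simp [h]

theorem allWords_spec {p : ℕ → ℕ → Bool} (h : allWords p = true) (w : Word 12) :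
    p (code w) (hammingNorm w) = true := by
  have := allBitsWeighted_spec 12 h (code w) (Nat.div_eq_of_lt (code_lt w))
  rwa [Nat.zero_add, ← hammingNorm_eq_sum] at this

/-- The mask of the numbers below `2 ^ n` of weight `k`. -/
def levelMask : ℕ → ℕ → ℕ
  | 0, 0 => 1
  | 0, _ + 1 => 0
  | n + 1, 0 => Nat.shiftLeft (levelMask n 0) (cond (digit offset n) (Nat.pow 2 n) 0)
  | n + 1, k + 1 =>
    Nat.lor
      (Nat.shiftLeft (levelMask n (k + 1)) (cond (digit offset n) (Nat.pow 2 n) 0))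
      (Nat.shiftLeft (levelMask n k) (cond (digit offset n) 0 (Nat.pow 2 n)))

/-- The mask of the words of weight 6. -/
def sixMask : ℕ := levelMask 12 6

/-- The mask of the words of weight 5 or 7. -/
def fiveSevenMask : ℕ := Nat.lor (levelMask 12 5) (levelMask 12 7)

/-- One pass over all codes, with the weight accumulated along the binary tree, certifies both
masks; nothing has to be proved about the recursion that produces them. -/
theorem levelMask_check : allWords (fun n s =>
    and (not (xor (digit sixMask n) (Nat.beq s 6)))
      (not (xor (digit fiveSevenMask n) (or (Nat.beq s 5) (Nat.beq s 7))))) = true := by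
  decide +kernel

theorem mem_toSet_sixMask {w : Word 12} : w ∈ toSet sixMask ↔ hammingNorm w = 6 := by
  have := allWords_spec levelMask_check w
  simp only [Bool.and_eq_true, digit_eq] at this
  have h := this.1
  rw [mem_toSet]
  rw [← Nat.beq_eq]
  cases h1 : sixMask.testBit (code w) <;> cases h2 : Nat.beq (hammingNorm w) 6 <;> simp_all

theorem mem_toSet_fiveSevenMask {w : Word 12} :
    w ∈ toSet fiveSevenMask ↔ hammingNorm w = 5 ∨ hammingNorm w = 7 := by
  have := allWords_spec levelMask_check w
  simp only [Bool.and_eq_true, digit_eq] at this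
  have h := this.2
  rw [mem_toSet, ← Nat.beq_eq, ← Nat.beq_eq, ← Bool.or_eq_true]
  cases h1 : fiveSevenMask.testBit (code w) <;>
    cases h2 : (Nat.beq (hammingNorm w) 5 || Nat.beq (hammingNorm w) 7) <;> simp_all

/-! ### Orbits -/

/-- The union of a mask and its images under the given permutations. -/
def orbitStep : List (List (List (Fin 12))) → ℕ → ℕ
  | [], M => M
  | g :: gs, M => force (orbitStep gs M) fun R => Nat.lor R (permMask g R)

/-- At most `k` iterations of `orbitStep`. -/
def orbitMask (gs : List (List (List (Fin 12)))) : ℕ → ℕ → ℕ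
  | 0, M => M
  | k + 1, M => force (orbitStep gs M) fun R => cond (Nat.beq M R) M (orbitMask gs k R)

/-- The mask of the set of the words in a list. -/
def listMask : List (Word 12) → ℕ
  | [] => 0
  | w :: ws => Nat.lor (Nat.shiftLeft 1 (code w)) (listMask ws)

theorem mem_toSet_listMask {ws : List (Word 12)} {w : Word 12} :
    w ∈ toSet (listMask ws) ↔ w ∈ ws := by
  induction ws with
  | nil => simp [listMask, toSet_zero]
  | cons v ws ih =>
    have : listMask (v :: ws) = 1 <<< code v ||| listMask ws := rfl
    rw [this, toSet_or, toSet_single, Set.mem_union, ih, Set.mem_singleton_iff, List.mem_cons]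

theorem toSet_orbitStep_cons (g : List (List (Fin 12))) (gs : List (List (List (Fin 12))))
    (M : ℕ) : toSet (orbitStep (g :: gs) M) =
      toSet (orbitStep gs M) ∪ permute (cycles g) '' toSet (orbitStep gs M) := by
  rw [← toSet_permMask, ← toSet_or, orbitStep, force_eq]; rfl

theorem subset_orbitStep (gs : List (List (List (Fin 12)))) (M : ℕ) :
    toSet M ⊆ toSet (orbitStep gs M) := by
  induction gs with
  | nil => exact subset_rfl
  | cons g gs ih =>
    rw [toSet_orbitStep_cons]
    exact ih.trans Set.subset_union_left

theorem image_subset_of_orbitStep {gs : List (List (List (Fin 12)))} {M : ℕ}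
    (h : toSet (orbitStep gs M) ⊆ toSet M) : ∀ g ∈ gs, permute (cycles g) '' toSet M ⊆ toSet M := by
  induction gs with
  | nil => simp
  | cons g gs ih =>
    rw [toSet_orbitStep_cons, Set.union_subset_iff] at h
    intro g' hg'
    rcases List.mem_cons.1 hg' with rfl | hg'
    · exact (Set.image_mono (subset_orbitStep gs M)).trans h.2
    · exact ih h.1 g' hg'

theorem orbitStep_subset {gs : List (List (List (Fin 12)))} {S : Set (Word 12)}
    (hS : ∀ g ∈ gs, permute (cycles g) '' S ⊆ S) {M : ℕ} (hM : toSet M ⊆ S) :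
    toSet (orbitStep gs M) ⊆ S := by
  induction gs with
  | nil => exact hM
  | cons g gs ih =>
    have h := ih fun g' hg' => hS g' (List.mem_cons_of_mem _ hg')
    rw [toSet_orbitStep_cons]
    exact Set.union_subset h ((Set.image_mono h).trans (hS g List.mem_cons_self))

theorem orbitMask_subset {gs : List (List (List (Fin 12)))} {S : Set (Word 12)}
    (hS : ∀ g ∈ gs, permute (cycles g) '' S ⊆ S) (k : ℕ) :
    ∀ {M : ℕ}, toSet M ⊆ S → toSet (orbitMask gs k M) ⊆ S := by
  induction k with
  | zero => exact fun h => h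
  | succ k ih =>
    intro M hM
    rw [orbitMask, force_eq]
    cases Nat.beq M (orbitStep gs M)
    · exact ih (orbitStep_subset hS hM)
    · exact hM

theorem subset_orbitMask (gs : List (List (List (Fin 12)))) (k : ℕ) :
    ∀ M : ℕ, toSet M ⊆ toSet (orbitMask gs k M) := by
  induction k with
  | zero => exact fun M => subset_rfl
  | succ k ih =>
    intro M
    rw [orbitMask, force_eq]
    cases Nat.beq M (orbitStep gs M)
    · exact (subset_orbitStep gs M).trans (ih _)
    · exact subset_rfl

theorem permute_image_orbits {gens : List (Equiv.Perm (Fin 12))} {reps : List (Word 12)}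
    {g : Equiv.Perm (Fin 12)} (hg : g ∈ Subgroup.closure {h | h ∈ gens}) :
    permute g '' orbits gens reps ⊆ orbits gens reps := by
  rintro _ ⟨_, ⟨h, hh, r, hr, rfl⟩, rfl⟩
  exact ⟨g * h, mul_mem hg hh, r, hr, rfl⟩

/-- The iteration bound `k` needs no justification, because the second hypothesis certifies that the
result is closed. A generator maps the finite set into itself, hence onto itself, and so does the
whole group. Conversely, the iteration never leaves the union of the orbits. -/
theorem orbits_eq_toSet {gs : List (List (List (Fin 12)))} {reps : List (Word 12)} {M k : ℕ}
    (hM : orbitMask gs k (listMask reps) = M) (h : orbitStep gs M = M) :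
    orbits (gs.map cycles) reps = toSet M := by
  have himg := image_subset_of_orbitStep (gs := gs) (M := M) (by rw [h])
  have hreps : ∀ r ∈ reps, r ∈ toSet M := fun r hr => by
    rw [← hM]
    exact subset_orbitMask gs k _ (mem_toSet_listMask.2 hr)
  refine Set.Subset.antisymm ?_ ?_
  · rintro _ ⟨g, hg, r, hr, rfl⟩
    suffices permute g '' toSet M = toSet M by
      rw [← this]; exact Set.mem_image_of_mem _ (hreps r hr)
    induction hg using Subgroup.closure_induction with
    | mem g hg =>
      obtain ⟨c, hc, rfl⟩ := List.mem_map.1 hg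
      exact Set.eq_of_subset_of_ncard_le (himg c hc)
        (Set.ncard_image_of_injective _ (permute_injective _)).ge (Set.toFinite _)
    | one => exact image_permute_one _
    | mul x y _ _ hx hy => rw [image_permute_mul, hy, hx]
    | inv x _ hx =>
      conv_lhs => rw [← hx]
      rw [← image_permute_mul, inv_mul_cancel, image_permute_one]
  · rw [← hM]
    refine orbitMask_subset (fun g hg => permute_image_orbits
      (Subgroup.subset_closure (List.mem_map_of_mem hg))) k fun w hw => ?_
    exact ⟨1, one_mem _, w, mem_toSet_listMask.1 hw, rfl⟩

/-! ### The table -/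

/-- The generators, the representatives of the first component, and either the representatives
of the second component or the permutation that maps the first component to the second one. -/
structure TradeData where
  /-- The generators, as products of cycles. -/
  gens : List (List (List (Fin 12)))
  /-- The representatives of the first component. -/
  reps : List (Word 12)
  /-- The description of the second component. -/
  second : List (Word 12) ⊕ List (List (Fin 12))

/-- The pair described by `d`. -/
def TradeData.toPair (d : TradeData) : Set (Word 12) × Set (Word 12) :=
  match d.second with
  | .inl reps₁ => pairOfOrbits (d.gens.map cycles) d.reps reps₁
  | .inr s => pairOfSwap (d.gens.map cycles) d.reps (cycles s)

/-- The mask of the first component. -/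
def TradeData.fst (d : TradeData) : ℕ := orbitMask d.gens 8 (listMask d.reps)

/-- The mask of the second component. -/
def TradeData.snd (d : TradeData) : ℕ :=
  match d.second with
  | .inl reps₁ => orbitMask d.gens 8 (listMask reps₁)
  | .inr s => permMask s d.fst

/-- The masks of the components describe unions of orbits. -/
def TradeData.closed (d : TradeData) : Bool :=
  force d.fst fun M => and (Nat.beq (orbitStep d.gens M) M)
    (match d.second with
    | .inl _ => force d.snd fun N => Nat.beq (orbitStep d.gens N) N
    | .inr _ => true)

theorem TradeData.toPair_eq {d : TradeData} (h : d.closed = true) :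
    d.toPair = (toSet d.fst, toSet d.snd) := by
  rw [closed, force_eq, Bool.and_eq_true, Nat.beq_eq] at h
  obtain ⟨h1, h2⟩ := h
  have e := orbits_eq_toSet (M := d.fst) rfl h1
  rcases d with ⟨gens, reps, reps₁ | s⟩
  · simp only [force_eq, Nat.beq_eq] at h2
    exact Prod.ext e (orbits_eq_toSet (M := TradeData.snd _) rfl h2)
  · refine Prod.ext e ?_
    change permute (cycles s) '' orbits _ _ = toSet (permMask s _)
    rw [toSet_permMask]
    exact congrArg _ e

/-- The generators, the representatives of the first component, and either the representatives
of the second component or the permutation that maps the first component to the second one. -/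
def tradeData : TradeName → TradeData
  | .t32 =>
    ⟨[[[8, 9], [10, 11]], [[8, 10], [9, 11]], [[0, 2, 4, 6, 8], [1, 3, 5, 7, 9]]],
      [![0,1,0,1,0,1,0,1,0,1,0,1]],
      .inr [[10, 11]]⟩
  | .t48 =>
    ⟨[[[0, 1, 2], [4, 6, 5]], [[0, 1], [2, 3]], [[4, 5], [6, 7]], [[0, 2], [4, 6], [8, 9]], [[8,
      9], [10, 11]], [[8, 10], [9, 11]], [[0, 4], [1, 5], [2, 6], [3, 7]]],
      [![0,1,0,1,0,0,1,1,0,1,0,1]],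
      .inr [[10, 11]]⟩
  | .t56a =>
    ⟨[[[0, 1, 2, 3, 4, 5, 6]], [[1, 3], [2, 4], [6, 7], [8, 9]], [[8, 9], [10, 11]], [[8, 10],
      [9, 11]]],
      [![0,1,0,0,0,1,1,1,0,1,0,1]],
      .inr [[10, 11]]⟩
  | .t56b =>
    ⟨[[[0, 1], [2, 3]], [[0, 2], [1, 3]], [[0, 4, 8], [1, 5, 9], [2, 6, 10], [3, 7, 11]], [[0,
      4], [1, 5], [2, 6], [3, 7]]],
      [![0,1,1,0,0,1,1,0,0,1,1,0], ![0,0,1,1,0,1,0,1,0,1,0,1], ![0,0,1,1,0,0,1,1,0,1,1,0]],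
      .inr [[0, 1], [4, 5], [8, 9]]⟩
  | .t68 =>
    ⟨[[[1, 2, 3], [5, 6, 7]], [[0, 5], [1, 4], [2, 6], [3, 7]], [[8, 9], [10, 11]], [[8, 10], [9,
      11]]],
      [![0,0,0,0,1,1,1,1,0,1,1,0], ![0,0,1,1,0,0,1,1,0,1,0,1], ![0,0,1,1,1,1,0,0,0,1,0,1],
        ![0,0,0,1,1,1,1,0,0,0,1,1], ![0,0,1,1,0,1,1,0,0,1,1,0]],
      .inl [![0,0,0,0,1,1,1,1,0,0,1,1], ![0,0,1,1,0,0,1,1,0,1,1,0], ![0,0,1,1,1,1,0,0,0,0,1,1],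
        ![0,0,0,1,1,1,1,0,0,1,1,0], ![0,0,1,1,0,1,1,0,0,1,0,1]]⟩
  | .t72a =>
    ⟨[[[0, 1], [2, 3]], [[0, 1, 2], [4, 6, 5]], [[0, 4, 8], [1, 5, 9], [2, 6, 10], [3, 7, 11]],
      [[0, 4], [1, 5], [2, 6], [3, 7]]],
      [![0,0,1,1,0,0,1,1,0,0,1,1]],
      .inr [[0, 1], [4, 5], [8, 10]]⟩
  | .t72b =>
    ⟨[[[0, 1, 8, 7], [2, 3, 6, 5]], [[0, 9], [4, 8], [5, 7], [10, 11]]],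
      [![0,0,0,0,1,1,1,1,0,1,0,1]],
      .inr [[10, 11]]⟩
  | .t72c =>
    ⟨[[[0, 1], [2, 3], [4, 5], [6, 7]], [[8, 9], [10, 11]], [[1, 2, 3], [5, 6, 7], [9, 10, 11]],
      [[0, 4], [1, 5], [2, 6], [3, 7]]],
      [![0,1,1,0,1,0,0,1,0,0,1,1], ![0,1,0,1,0,1,0,1,0,0,1,1], ![0,0,0,1,1,0,1,1,0,0,1,1]],
      .inr [[0, 1], [4, 5], [8, 9]]⟩
  | .t72d =>
    ⟨[[[0, 1, 2], [6, 7, 8]], [[1, 2], [4, 5], [7, 8], [10, 11]], [[0, 3], [1, 4], [2, 5], [6,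
      9], [7, 10], [8, 11]], [[0, 6], [1, 7], [2, 8], [3, 9], [4, 10], [5, 11]]],
      [![0,0,1,1,0,1,0,1,0,0,1,1], ![0,0,1,1,0,1,0,1,1,1,0,0]],
      .inr [[1, 2], [7, 8]]⟩
  | .t80a =>
    ⟨[[[0, 1, 2, 3, 4], [6, 7, 8, 9, 10]], [[1, 3, 4, 2], [7, 9, 10, 8]], [[0, 5], [2, 3], [6,
      11], [8, 9]], [[0, 6], [1, 7], [2, 8], [3, 9], [4, 10], [5, 11]]],
      [![0,0,0,1,1,1,1,1,1,0,0,0], ![0,0,0,1,1,1,0,1,0,1,1,0]],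
      .inl [![0,0,0,1,1,1,0,0,0,1,1,1], ![0,0,0,1,1,1,1,0,1,0,0,1]]⟩
  | .t80b =>
    ⟨[[[0, 1], [2, 3], [4, 5], [6, 7]], [[1, 2, 3], [5, 6, 7]], [[0, 4], [1, 5], [2, 7], [3, 6]],
      [[8, 9], [10, 11]], [[8, 10], [9, 11]]],
      [![0,0,0,0,1,1,1,1,0,1,1,0], ![0,0,1,1,0,0,1,1,0,0,1,1], ![0,0,0,1,1,1,1,0,0,0,1,1],
        ![0,0,1,1,0,1,1,0,0,1,0,1], ![0,0,1,1,0,1,0,1,0,1,1,0]],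
      .inr [[2, 3], [6, 7], [9, 11]]⟩
  | .t86 =>
    ⟨[[[0, 1, 2], [3, 4, 5]], [[0, 5], [1, 4], [2, 3], [6, 11], [7, 10], [8, 9]], [[0, 6], [1,
      7], [2, 8], [3, 9], [4, 10], [5, 11]]],
      [![0,0,0,1,1,1,1,1,1,0,0,0], ![0,0,0,1,1,1,0,0,1,1,1,0], ![0,0,1,1,0,0,0,1,1,1,0,1],
        ![0,0,1,0,0,1,0,1,1,0,1,1], ![0,0,1,0,1,1,0,1,1,1,0,0]],
      .inl [![0,0,0,1,1,1,0,0,0,1,1,1], ![0,0,0,1,1,1,0,1,1,1,0,0], ![0,0,1,0,1,1,0,1,1,0,1,0],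
        ![0,0,1,1,1,0,0,0,1,1,1,0], ![0,0,1,0,0,1,0,1,1,1,0,1], ![1,1,0,1,1,0,1,0,0,0,1,0]]⟩
  | .t92a =>
    ⟨[[[0, 1, 2, 3, 4], [6, 7, 8, 9, 10]], [[1, 3, 4, 2], [7, 9, 10, 8]], [[0, 5], [2, 3], [6,
      11], [8, 9]], [[0, 6], [1, 7], [2, 8], [3, 9], [4, 10], [5, 11]]],
      [![0,0,0,0,0,0,1,1,1,1,1,1], ![0,0,1,1,1,1,1,1,0,0,0,0], ![0,0,0,1,1,1,1,0,0,0,1,1]],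
      .inl [![0,1,1,1,1,1,1,0,0,0,0,0], ![0,0,0,1,1,1,0,0,0,1,1,1], ![0,0,0,1,1,1,1,0,1,0,0,1]]⟩
  | .t92b =>
    ⟨[[[0, 2, 1, 3], [6, 8, 7, 9]], [[2, 4, 3, 5], [8, 10, 9, 11]], [[0, 6], [1, 7], [2, 8], [3,
      9], [4, 10], [5, 11]]],
      [![0,0,0,0,0,0,1,1,1,1,1,1], ![0,0,0,0,1,1,1,1,1,1,0,0], ![0,0,0,1,1,1,0,0,0,1,1,1],
        ![0,0,0,1,0,1,1,1,0,1,0,1], ![0,0,0,1,1,1,1,0,1,0,0,1]],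
      .inl [![0,1,0,1,0,1,1,0,1,0,1,0], ![0,0,0,1,1,1,1,1,1,0,0,0], ![0,0,0,1,1,1,0,0,1,0,1,1],
        ![0,0,0,0,0,1,1,1,1,1,0,1], ![0,0,0,1,1,1,1,0,0,1,0,1]]⟩
  | .t96a =>
    ⟨[[[0, 5, 2, 7], [1, 6, 3, 4]], [[0, 4, 8], [1, 5, 9], [2, 6, 10], [3, 7, 11]], [[0, 1], [2,
      3], [4, 5], [6, 7], [8, 9], [10, 11]]],
      [![0,0,0,1,0,0,1,1,0,1,1,1]],
      .inr [[0, 2], [1, 3]]⟩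
  | .t96b =>
    ⟨[[[0, 2, 1, 3], [6, 8, 7, 9]], [[2, 4, 3, 5], [8, 10, 9, 11]], [[0, 6], [1, 7], [2, 8], [3,
      9], [4, 10], [5, 11]]],
      [![0,0,0,1,1,1,0,0,1,0,1,1], ![0,0,0,0,0,1,1,1,1,1,0,1], ![0,0,0,1,0,1,1,1,1,0,1,0],
        ![0,0,0,1,1,1,0,1,0,1,1,0]],
      .inl [![0,0,0,1,1,1,0,0,0,1,1,1], ![0,0,0,0,0,1,1,1,1,1,1,0], ![0,0,0,1,0,1,1,1,0,1,0,1],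
        ![0,0,0,1,1,1,0,1,1,0,1,0]]⟩
  | .t98 =>
    ⟨[[[0, 1, 2, 3, 4, 5], [6, 7, 8, 9, 10, 11]], [[0, 11], [1, 10], [2, 9], [3, 8], [4, 7], [5,
      6]]],
      [![1,1,1,1,1,1,0,0,0,0,0,0], ![0,0,1,1,1,0,1,0,0,0,1,1], ![0,1,1,0,1,1,0,0,1,0,0,1],
        ![0,1,0,1,1,0,0,0,1,1,0,1], ![1,0,1,0,0,1,1,1,0,0,1,0], ![0,1,1,0,1,0,0,1,0,1,1,0],
        ![1,0,0,1,0,1,1,0,1,0,0,1], ![0,0,1,1,0,0,1,1,1,0,0,1], ![0,1,0,1,0,0,1,1,0,1,0,1],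
        ![0,0,1,0,1,0,1,1,0,1,0,1], ![0,0,0,1,0,1,1,0,0,1,1,1], ![1,1,1,0,1,0,0,1,1,0,0,0]],
      .inl [![0,1,0,1,0,1,1,0,1,0,1,0], ![0,1,1,1,0,0,1,1,0,0,0,1], ![0,1,1,1,0,0,0,0,1,1,1,0],
        ![0,0,1,0,1,1,0,0,1,0,1,1], ![0,1,0,1,1,0,0,0,1,0,1,1], ![0,0,1,0,1,1,0,1,0,1,1,0],
        ![0,0,0,0,0,1,1,0,1,1,1,1], ![0,0,0,1,0,1,0,1,0,1,1,1], ![0,0,0,1,0,1,1,1,1,0,0,1],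
        ![1,1,1,0,1,0,0,0,0,1,1,0]]⟩
  | .t102 =>
    ⟨[[[0, 2, 4, 6, 8], [1, 3, 5, 7, 9]], [[0, 1], [2, 3], [4, 8], [5, 9], [6, 10], [7, 11]]],
      [![1,0,0,1,0,1,0,1,1,0,0,1], ![1,0,0,1,1,1,0,0,0,1,1,0], ![1,1,1,1,0,0,1,0,0,0,1,0],
        ![0,0,0,0,1,1,0,1,1,1,0,1]],
      .inl [![1,0,0,1,0,1,1,0,0,1,1,0], ![0,0,0,1,0,1,0,1,1,1,0,1], ![0,1,0,0,0,0,1,1,1,0,1,1]]⟩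
  | .t108a =>
    ⟨[[[0, 1, 2], [3, 4, 5], [6, 7, 8]], [[0, 1, 2], [8, 7, 6], [9, 10, 11]], [[6, 3, 0], [2, 5,
      8], [9, 10, 11]]],
      [![0,0,0,0,1,1,0,1,1,1,1,0], ![1,1,1,1,0,0,1,0,0,0,0,1]],
      .inr [[0, 6], [1, 7], [2, 8], [9, 11]]⟩
  | .t108b =>
    ⟨[[[0, 1], [2, 3], [4, 5], [6, 7], [8, 9], [10, 11]], [[1, 2, 3], [5, 6, 7], [9, 10, 11]],
      [[0, 4], [1, 5], [2, 6], [3, 7]], [[0, 8], [1, 9], [2, 10], [3, 11]]],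
      [![0,0,0,1,0,1,1,0,1,1,0,1], ![0,0,1,1,0,0,1,1,0,1,1,0]],
      .inr [[0, 1], [4, 5], [8, 9]]⟩
  | .t110a =>
    ⟨[[[0, 1, 2, 3, 4, 5, 6, 7, 8, 9, 10]], [[1, 3, 9, 5, 4], [2, 6, 7, 10, 8]], [[0, 11], [1,
      10], [2, 5], [3, 7], [4, 8], [6, 9]]],
      [![0,0,0,0,1,0,0,1,1,1,1,1]],
      .inr [[0, 10], [1, 9], [2, 8], [3, 7], [4, 6]]⟩
  | .t110b =>
    ⟨[[[0, 1, 2, 3, 4, 5, 6, 7, 8, 9, 10]], [[1, 3, 9, 5, 4], [2, 6, 7, 10, 8]], [[0, 11], [1,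
      10], [2, 5], [3, 7], [4, 8], [6, 9]]],
      [![0,0,0,0,1,0,1,1,1,0,1,1]],
      .inl [![0,0,0,0,1,0,0,1,1,1,1,1]]⟩
  | .t120a =>
    ⟨[[[0, 5, 2, 7], [1, 6, 3, 4]], [[0, 4, 8], [1, 5, 9], [2, 6, 10], [3, 7, 11]]],
      [![0,0,1,1,0,1,0,1,0,1,0,1], ![0,0,0,1,0,0,1,1,1,0,1,1]],
      .inr [[0, 2], [4, 6], [9, 11]]⟩
  | .t120b =>
    ⟨[[[0, 2, 4, 6, 8], [1, 3, 5, 7, 9]], [[0, 1], [2, 3], [4, 8], [5, 9], [6, 10], [7, 11]]],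
      [![0,1,1,1,1,0,1,0,1,0,0,0], ![0,0,0,0,1,0,0,1,1,1,1,1]],
      .inr [[0, 1], [2, 3], [4, 5], [6, 7], [8, 9], [10, 11]]⟩
  | .t132 =>
    ⟨[[[0, 1, 2, 3, 4, 5, 6, 7, 8, 9, 10]], [[1, 3, 9, 5, 4], [2, 6, 7, 10, 8]], [[0, 11], [1,
      10], [2, 5], [3, 7], [4, 8], [6, 9]]],
      [![0,0,0,0,0,1,0,1,1,1,1,1]],
      .inr [[0, 10], [1, 9], [2, 8], [3, 7], [4, 6]]⟩

/-- The table is repeated with permutations kept as lists of cycles, which is what the computation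
of masks consumes. -/
theorem trade_eq_toPair (i : TradeName) : trade i = (tradeData i).toPair := by
  cases i <;> rfl

/-! ### Verification of the trades -/

theorem degree_pos_iff {T : Set (Word 12)} {c : Word 12} :
    0 < degree T c ↔ ∃ i, flipWord i c ∈ T := by
  rw [degree, Set.ncard_pos]; rfl

theorem degree_le_one_iff {T : Set (Word 12)} {c : Word 12} :
    degree T c ≤ 1 ↔ ∀ i j, flipWord i c ∈ T → flipWord j c ∈ T → i = j := by
  rw [degree, Set.ncard_le_one]
  exact ⟨fun h i j hi hj => h i hi j hj, fun h i hi j hj => h i j hi hj⟩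

theorem degree_toSet_pos_iff {M : ℕ} {c : Word 12} :
    0 < degree (toSet M) c ↔ c ∈ toSet (nbrs M) := by
  rw [degree_pos_iff, mem_toSet_nbrs]

theorem degree_toSet_le_one {M : ℕ} (h : (covers M).2 = 0) (c : Word 12) :
    degree (toSet M) c ≤ 1 := by
  rw [degree_le_one_iff]
  intro i j hi hj
  by_contra hij
  have := mem_toSet_covers_snd.2 ⟨i, j, hij, hi, hj⟩
  rw [h, toSet_zero] at this
  exact this

theorem image_evenPart {T : Set (Word 12)} (hT : ∀ w ∈ T, hammingNorm w = 6) :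
    Subtype.val '' evenPart T = T := by
  ext w
  refine ⟨fun ⟨v, hv, h⟩ => h ▸ hv, fun hw => ⟨⟨w, ?_⟩, hw, rfl⟩⟩
  rw [hT w hw]; decide

theorem degree_eq_zero_of_even {T : Set (Word 12)} (hT : ∀ w ∈ T, hammingNorm w = 6)
    {c : Word 12} (hc : ¬ Odd (hammingNorm c)) : degree T c = 0 := by
  by_contra h
  obtain ⟨i, hi⟩ := degree_pos_iff.1 (Nat.pos_of_ne_zero h)
  rw [← even_hammingNorm_flipWord (i := i), hT _ hi] at hc
  exact hc (by decide)

/-- The degree condition may be imposed on all words `c`, since a word of even weight has no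
neighbour of weight 6. -/
theorem isConstantWeightTrade_iff {T : Set (Word 12) × Set (Word 12)} :
    IsConstantWeightTrade T ↔ (∀ w ∈ T.1, hammingNorm w = 6) ∧ (∀ w ∈ T.2, hammingNorm w = 6) ∧
      Disjoint T.1 T.2 ∧ T.1.Nonempty ∧ T.2.Nonempty ∧
      ∀ c, degree T.1 c = degree T.2 c ∧ degree T.1 c ≤ 1 := by
  have h0 : (∀ w ∈ T.1 ∪ T.2, hammingNorm w = 6) ↔
      (∀ w ∈ T.1, hammingNorm w = 6) ∧ (∀ w ∈ T.2, hammingNorm w = 6) := by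
    simp only [Set.mem_union, or_imp, forall_and]
  rw [IsConstantWeightTrade, h0, and_assoc]
  refine and_congr_right fun h1 => and_congr_right fun h2 => ?_
  rw [isCliqueTrade_iff, image_evenPart h1, image_evenPart h2]
  have e1 : Disjoint (evenPart T.1) (evenPart T.2) ↔ Disjoint T.1 T.2 := by
    conv_rhs => rw [← image_evenPart h1, ← image_evenPart h2]
    exact (Set.disjoint_image_iff Subtype.val_injective).symm
  have e2 : ∀ S : Set (Word 12), (∀ w ∈ S, hammingNorm w = 6) →
      ((evenPart S).Nonempty ↔ S.Nonempty) := by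
    intro S hS
    conv_rhs => rw [← image_evenPart hS]
    exact Set.image_nonempty.symm
  rw [e1, e2 _ h1, e2 _ h2]
  refine and_congr_right fun _ => and_congr_right fun _ => and_congr_right fun _ =>
    forall_congr' fun c => ⟨fun h => ?_, fun h _ => h⟩
  by_cases hc : Odd (hammingNorm c)
  · exact h hc
  · rw [degree_eq_zero_of_even h1 hc, degree_eq_zero_of_even h2 hc]
    exact ⟨rfl, zero_le_one⟩

/-- The elements of `A` at distance at most two from elements of `R`. -/
def growMask (A R : ℕ) : ℕ := Nat.land A (nbrs (nbrs R))

/-- The elements of `A` that can be reached by `k` steps from elements of `R`. -/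
def reachMask (A : ℕ) : ℕ → ℕ → ℕ
  | 0, R => R
  | k + 1, R => force (growMask A R) fun R' => reachMask A k R'

/-- The pair of sets with masks `M` and `N` is a trade with `v` words in both components. -/
def isTradeMask (M N v : ℕ) : Bool :=
  and (Nat.beq (Nat.land M sixMask) M) (and (Nat.beq (Nat.land N sixMask) N)
    (and (Nat.beq (Nat.land M N) 0) (and (Nat.beq (maskCard M) v) (and (Nat.beq (maskCard N) v)
      (and (Nat.beq (covers M).2 0) (and (Nat.beq (covers N).2 0)
        (Nat.beq (covers M).1 (covers N).1)))))))

/-- Once all degrees are at most 1, equality of degrees only says that both components have the same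
set of neighbours, so comparing the first masks of `covers` is enough. -/
theorem isConstantWeightTrade_of_isTradeMask {M N v : ℕ} (h : isTradeMask M N v = true)
    (hv : v ≠ 0) :
    IsConstantWeightTrade (toSet M, toSet N) ∧ volume (toSet M, toSet N) = v := by
  simp only [isTradeMask, Bool.and_eq_true, Nat.beq_eq] at h
  obtain ⟨h1, h2, h3, h4, h5, h6, h7, h8⟩ := h
  have e0 : ∀ a b, Nat.land a b = a &&& b := fun _ _ => rfl
  rw [e0] at h1 h2 h3
  refine ⟨isConstantWeightTrade_iff.2 ⟨?_, ?_, ?_, ?_, ?_, ?_⟩, (ncard_toSet M).trans h4⟩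
  · exact fun w hw => mem_toSet_sixMask.1 (toSet_subset_of_and_eq h1 hw)
  · exact fun w hw => mem_toSet_sixMask.1 (toSet_subset_of_and_eq h2 hw)
  · rw [Set.disjoint_iff_inter_eq_empty, ← toSet_and, h3, toSet_zero]
  · exact Set.nonempty_of_ncard_ne_zero (by rw [ncard_toSet, h4]; exact hv)
  · exact Set.nonempty_of_ncard_ne_zero (by rw [ncard_toSet, h5]; exact hv)
  · intro c
    have a1 := degree_toSet_le_one h6 c
    have a2 := degree_toSet_le_one h7 c
    have a3 : 0 < degree (toSet M) c ↔ 0 < degree (toSet N) c := by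
      rw [degree_toSet_pos_iff, degree_toSet_pos_iff, ← covers_fst, ← covers_fst, h8]
    exact ⟨show degree (toSet M) c = degree (toSet N) c by omega, a1⟩

/-- Balance of the subtrade at `c` gives it a neighbour of `c` in the other component too. The whole
trade has at most one neighbour of `c` in each component, so all its words next to `c` are in the
subtrade. -/
theorem mem_of_adjacent_aux {A₀ A₁ T₀ T₁ : Set (Word 12)} {c : Word 12}
    (hA : degree A₀ c = degree A₁ c) (hT : degree T₀ c = degree T₁ c) (hT' : degree T₀ c ≤ 1)
    (h0 : A₀ ⊆ T₀) (h1 : A₁ ⊆ T₁) {i j : Fin 12} (hi : flipWord i c ∈ A₀)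
    (hj : flipWord j c ∈ T₀ ∪ T₁) : flipWord j c ∈ A₀ ∪ A₁ := by
  obtain ⟨k, hk⟩ := degree_pos_iff.1 (hA ▸ degree_pos_iff.2 ⟨i, hi⟩)
  rcases hj with hj | hj
  · rw [degree_le_one_iff.1 hT' j i hj (h0 hi)]
    exact .inl hi
  · rw [degree_le_one_iff.1 (hT ▸ hT') j k hj (h1 hk)]
    exact .inr hk

theorem reachMask_subset {A : ℕ} {S : Set (Word 12)}
    (hS : ∀ c i j, flipWord i c ∈ S → flipWord j c ∈ toSet A → flipWord j c ∈ S) (k : ℕ) :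
    ∀ {R : ℕ}, toSet R ⊆ S → toSet (reachMask A k R) ⊆ S := by
  induction k with
  | zero => exact fun h => h
  | succ k ih =>
    intro R hR
    rw [reachMask, force_eq]
    refine ih fun w hw => ?_
    have e : growMask A R = A &&& nbrs (nbrs R) := rfl
    rw [e, toSet_and] at hw
    obtain ⟨hA, hN⟩ := hw
    obtain ⟨j, hj⟩ := mem_toSet_nbrs.1 hN
    obtain ⟨i, hi⟩ := mem_toSet_nbrs.1 hj
    have := hS (flipWord j w) i j (hR hi)
    rw [flipWord_flipWord] at this
    exact this hA

/-- The trade with masks `M` and `N` is connected. -/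
def isConnectedMask (M N : ℕ) : Bool :=
  force (Nat.lor M N) fun A => force (Nat.pow 2 (Nat.log2 A)) fun b =>
    and (Nat.beq (Nat.land A b) b) (Nat.beq (reachMask A 7 b) A)

/-- By `mem_of_adjacent_aux` both parts of a decomposition are closed under adjacency inside the
support. The part that contains the starting word therefore contains the first component of the
trade, and the other part has nothing left there. -/
theorem isPrimary_of_isConnectedMask {M N : ℕ} (hT : IsConstantWeightTrade (toSet M, toSet N))
    (h : isConnectedMask M N = true) : IsPrimaryConstantWeightTrade (toSet M, toSet N) := by
  refine ⟨hT.1, hT.2, ?_⟩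
  rintro ⟨A₀, A₁, B₀, B₁, hA, hB, h0, h1, hT0, hT1⟩
  obtain ⟨hw0, hw1, hd, -, -, hdeg⟩ := isConstantWeightTrade_iff.1 hT
  dsimp only at hw0 hw1 hd hdeg
  have hdT : Disjoint (evenPart (toSet M)) (evenPart (toSet N)) := hT.2.disjoint
  simp only [isConnectedMask, force_eq, Bool.and_eq_true, Nat.beq_eq] at h
  obtain ⟨hb, hr⟩ := h
  have e1 : Nat.land (Nat.lor M N) (Nat.pow 2 (Nat.log2 (Nat.lor M N))) =
    (M ||| N) &&& 2 ^ (M ||| N).log2 := rfl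
  have e2 : Nat.pow 2 (Nat.log2 (Nat.lor M N)) = 2 ^ (M ||| N).log2 := rfl
  have e3 : Nat.lor M N = M ||| N := rfl
  rw [e1, e2] at hb
  rw [e2, e3] at hr
  have hsub : ∀ A₀ A₁ : Set {w : Word 12 // Even (hammingNorm w)},
      IsCliqueTrade (halvedCube 12) A₀ A₁ → A₀ ⊆ evenPart (toSet M) → A₁ ⊆ evenPart (toSet N) →
      toSet (2 ^ (M ||| N).log2) ⊆ Subtype.val '' A₀ ∪ Subtype.val '' A₁ →
      toSet M ⊆ Subtype.val '' A₀ ∪ Subtype.val '' A₁ := by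
    intro A₀ A₁ hA hs0 hs1 hstart
    have hs0' : Subtype.val '' A₀ ⊆ toSet M := by
      rw [← image_evenPart hw0]; exact Set.image_mono hs0
    have hs1' : Subtype.val '' A₁ ⊆ toSet N := by
      rw [← image_evenPart hw1]; exact Set.image_mono hs1
    have := reachMask_subset (A := M ||| N) (S := Subtype.val '' A₀ ∪ Subtype.val '' A₁) (by
      intro c i j hi hj
      rw [toSet_or] at hj
      have hc : Odd (hammingNorm c) := by
        rw [← even_hammingNorm_flipWord (i := i)]
        rcases hi with ⟨v, -, h⟩ | ⟨v, -, h⟩ <;> rw [← h] <;> exact v.2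
      have hAc := ((isCliqueTrade_iff.1 hA).2.2.2 c hc).1
      rcases hi with hi | hi
      · exact mem_of_adjacent_aux hAc (hdeg c).1 (hdeg c).2 hs0' hs1' hi hj
      · rw [Set.union_comm] at hj ⊢
        exact mem_of_adjacent_aux hAc.symm (hdeg c).1.symm ((hdeg c).1 ▸ (hdeg c).2) hs1' hs0'
          hi hj) 7 hstart
    rw [hr, toSet_or] at this
    exact Set.subset_union_left.trans this
  have hfin : ∀ A₀ A₁ B₀ B₁ : Set {w : Word 12 // Even (hammingNorm w)},
      B₀.Nonempty → Disjoint A₀ B₀ →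
      B₀ ⊆ evenPart (toSet M) → A₁ ⊆ evenPart (toSet N) →
      ¬ toSet M ⊆ Subtype.val '' A₀ ∪ Subtype.val '' A₁ := by
    rintro A₀ A₁ B₀ B₁ ⟨b, hb⟩ hdis hB0 hA1 hsub
    rcases hsub (hB0 hb) with ⟨v, hv, h⟩ | ⟨v, hv, h⟩
    · rw [Subtype.ext h] at hv
      exact Set.disjoint_left.1 hdis hv hb
    · rw [Subtype.ext h] at hv
      exact Set.disjoint_left.1 hdT (hB0 hb) (hA1 hv)
  have hA0 : A₀ ⊆ evenPart (toSet M) := hT0 ▸ Set.subset_union_left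
  have hA1 : A₁ ⊆ evenPart (toSet N) := hT1 ▸ Set.subset_union_left
  have hB0 : B₀ ⊆ evenPart (toSet M) := hT0 ▸ Set.subset_union_right
  have hB1 : B₁ ⊆ evenPart (toSet N) := hT1 ▸ Set.subset_union_right
  -- The starting word is the one with the largest code in the support. The two parts play symmetric
  -- roles, according to which of them contains it.
  by_cases hs : toSet (2 ^ (M ||| N).log2) ⊆ Subtype.val '' A₀ ∪ Subtype.val '' A₁
  · exact hfin A₀ A₁ B₀ B₁ hB.nonempty₀ h0 hB0 hA1 (hsub A₀ A₁ hA hA0 hA1 hs)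
  · refine hfin B₀ B₁ A₀ A₁ hA.nonempty₀ h0.symm hA0 hB1 (hsub B₀ B₁ hB hB0 hB1 ?_)
    obtain ⟨w, hw, hw'⟩ := Set.not_subset.1 hs
    have hmem : w ∈ Subtype.val '' B₀ ∪ Subtype.val '' B₁ := by
      have : w ∈ toSet (M ||| N) := toSet_subset_of_and_eq (by rw [Nat.land_comm]; exact hb) hw
      rw [toSet_or, ← image_evenPart hw0, ← image_evenPart hw1] at this
      dsimp only at hT0 hT1
      rw [hT0, hT1, Set.image_union, Set.image_union] at this
      rcases this with (h | h) | (h | h)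
      exacts [absurd (.inl h) hw', .inl h, absurd (.inr h) hw', .inr h]
    intro v hv
    rw [mem_toSet, Nat.testBit_two_pow, decide_eq_true_iff] at hv hw
    rwa [code_injective (hv.symm.trans hw)]

/-! ### Invariants -/

/-- The vertices of the halved 12-cube. -/
abbrev EvenWord : Type := {w : Word 12 // Even (hammingNorm w)}

/-- The vertices in `S` or adjacent to an element of `S`. -/
def closedNbhd (S : Set EvenWord) : Set EvenWord :=
  {v | v ∈ S ∨ ∃ s ∈ S, (halvedCube 12).Adj s v}

theorem closedNbhd_image (π : halvedCube 12 ≃g halvedCube 12) (S : Set EvenWord) :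
    closedNbhd (π '' S) = π '' closedNbhd S := by
  ext v
  obtain ⟨u, rfl⟩ := π.surjective v
  rw [π.injective.mem_set_image]
  refine or_congr π.injective.mem_set_image ?_
  constructor
  · rintro ⟨_, ⟨s, hs, rfl⟩, h⟩
    exact ⟨s, hs, π.map_adj_iff.1 h⟩
  · rintro ⟨s, hs, h⟩
    exact ⟨π s, ⟨s, hs, rfl⟩, π.map_adj_iff.2 h⟩

/-- Changing the same digit twice returns the word, and changing two different digits gives an
adjacent vertex. -/
theorem evenPart_nbrs_nbrs (M : ℕ) :
    evenPart (toSet (nbrs (nbrs M))) = closedNbhd (evenPart (toSet M)) := by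
  ext v
  change v.1 ∈ toSet (nbrs (nbrs M)) ↔ v.1 ∈ toSet M ∨ _
  simp only [mem_toSet_nbrs]
  constructor
  · rintro ⟨i, j, h⟩
    by_cases hij : j = i
    · subst hij
      rw [flipWord_flipWord] at h
      exact .inl h
    · refine .inr ⟨⟨flipWord j (flipWord i v.1), ?_⟩, h, ?_⟩
      · rw [even_hammingNorm_flipWord, ← Nat.not_even_iff_odd, even_hammingNorm_flipWord,
          Nat.not_odd_iff_even]
        exact v.2
      · change hammingDist (flipWord j (flipWord i v.1)) v.1 = 2
        rw [hammingDist_comm]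
        exact hammingDist_eq_two_iff.2 ⟨j, i, hij, rfl⟩
  · rintro (h | ⟨s, hs, h⟩)
    · exact ⟨0, 0, by rwa [flipWord_flipWord]⟩
    · have h' : hammingDist v.1 s.1 = 2 := by rw [hammingDist_comm]; exact h
      obtain ⟨i, j, -, e⟩ := hammingDist_eq_two_iff.1 h'
      exact ⟨j, i, by rw [← e]; exact hs⟩

theorem ncard_evenPart {M : ℕ} (hM : ∀ w ∈ toSet M, Even (hammingNorm w)) :
    (evenPart (toSet M)).ncard = maskCard M := by
  rw [← ncard_toSet, evenPart, Set.ncard_preimage_of_injective_subset_range Subtype.val_injective]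
  rw [Subtype.range_coe_subtype]
  exact hM

theorem even_of_mem_nbrs_nbrs {M : ℕ} (hM : ∀ w ∈ toSet M, Even (hammingNorm w)) :
    ∀ w ∈ toSet (nbrs (nbrs M)), Even (hammingNorm w) := by
  intro w hw
  obtain ⟨i, hi⟩ := mem_toSet_nbrs.1 hw
  obtain ⟨j, hj⟩ := mem_toSet_nbrs.1 hi
  have := hM _ hj
  rwa [even_hammingNorm_flipWord, ← Nat.not_even_iff_odd, even_hammingNorm_flipWord,
    Nat.not_odd_iff_even] at this

/-- The union of the components of a pair. -/
def support (T : Set (Word 12) × Set (Word 12)) : Set EvenWord := evenPart T.1 ∪ evenPart T.2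

theorem Equivalent.exists_image_support {S T : Set (Word 12) × Set (Word 12)}
    (h : Equivalent S T) : ∃ π : halvedCube 12 ≃g halvedCube 12, π '' support S = support T := by
  obtain ⟨π, ⟨h1, h2⟩ | ⟨h1, h2⟩⟩ := h
  · exact ⟨π, by rw [support, Set.image_union, h1, h2, support]⟩
  · exact ⟨π, by rw [support, Set.image_union, h1, h2, support, Set.union_comm]⟩

theorem Equivalent.symm {S T : Set (Word 12) × Set (Word 12)} (h : Equivalent S T) :
    Equivalent T S := by
  obtain ⟨π, h⟩ := h
  have key : ∀ A B : Set EvenWord, π '' A = B → π.symm '' B = A := by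
    rintro A _ rfl
    rw [← Set.image_comp]
    simp
  exact ⟨π.symm, h.imp (fun h => ⟨key _ _ h.1, key _ _ h.2⟩) fun h => ⟨key _ _ h.2, key _ _ h.1⟩⟩

theorem Equivalent.trans {S T U : Set (Word 12) × Set (Word 12)} (h : Equivalent S T)
    (h' : Equivalent T U) : Equivalent S U := by
  obtain ⟨π, h⟩ := h
  obtain ⟨ρ, h'⟩ := h'
  have key : ∀ A B C : Set EvenWord, π '' A = B → ρ '' B = C → (π.trans ρ) '' A = C := by
    rintro A _ _ rfl rfl
    rw [← Set.image_comp]; rfl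
  refine ⟨π.trans ρ, ?_⟩
  rcases h with ⟨h1, h2⟩ | ⟨h1, h2⟩ <;> rcases h' with ⟨h3, h4⟩ | ⟨h3, h4⟩
  · exact .inl ⟨key _ _ _ h1 h3, key _ _ _ h2 h4⟩
  · exact .inr ⟨key _ _ _ h1 h3, key _ _ _ h2 h4⟩
  · exact .inr ⟨key _ _ _ h1 h4, key _ _ _ h2 h3⟩
  · exact .inl ⟨key _ _ _ h1 h4, key _ _ _ h2 h3⟩

/-! ### Coordinate permutations as automorphisms of the halved 12-cube. -/

theorem hammingDist_permute (g : Equiv.Perm (Fin 12)) (v w : Word 12) :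
    hammingDist (permute g v) (permute g w) = hammingDist v w := by
  rw [hammingDist, hammingDist, ← Finset.card_map g.symm.toEmbedding]
  congr 1
  ext i
  rw [Finset.mem_map_equiv, Finset.mem_filter, Finset.mem_filter]
  simp [permute]

theorem hammingNorm_permute (g : Equiv.Perm (Fin 12)) (w : Word 12) :
    hammingNorm (permute g w) = hammingNorm w := by
  rw [← hammingDist_zero_right, ← hammingDist_zero_right w]
  exact hammingDist_permute g w 0

/-- The automorphism of the halved 12-cube given by a permutation of the coordinates. -/
def permuteIso (g : Equiv.Perm (Fin 12)) : halvedCube 12 ≃g halvedCube 12 where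
  toFun v := ⟨permute g v.1, by rw [hammingNorm_permute]; exact v.2⟩
  invFun v := ⟨permute g⁻¹ v.1, by rw [hammingNorm_permute]; exact v.2⟩
  left_inv v := Subtype.ext (permute_inv_permute g v.1)
  right_inv v := Subtype.ext (permute_permute_inv g v.1)
  map_rel_iff' {v w} := by
    change hammingDist (permute g v.1) (permute g w.1) = 2 ↔ hammingDist v.1 w.1 = 2
    rw [hammingDist_permute]

theorem permuteIso_image_evenPart (g : Equiv.Perm (Fin 12)) (T : Set (Word 12)) :
    permuteIso g '' evenPart T = evenPart (permute g '' T) := by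
  ext v
  constructor
  · rintro ⟨u, hu, rfl⟩
    exact ⟨u.1, hu, rfl⟩
  · intro hv
    refine ⟨(permuteIso g).symm v, mem_permute_image.1 hv, (permuteIso g).apply_symm_apply v⟩

theorem permute_image_orbits_eq {gens : List (Equiv.Perm (Fin 12))} {reps : List (Word 12)}
    {g : Equiv.Perm (Fin 12)} (hg : g ∈ Subgroup.closure {h | h ∈ gens}) :
    permute g '' orbits gens reps = orbits gens reps := by
  refine (permute_image_orbits hg).antisymm fun w hw => mem_permute_image.2 ?_
  exact permute_image_orbits (inv_mem hg) (Set.mem_image_of_mem _ hw)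

/-- The number of elements of `A` that can be reached from `x` by two steps inside `A`. -/
noncomputable def localSize (A : Set EvenWord) (x : EvenWord) : ℕ :=
  (A ∩ closedNbhd (A ∩ closedNbhd {x})).ncard

theorem localSize_image (π : halvedCube 12 ≃g halvedCube 12) (A : Set EvenWord) (x : EvenWord) :
    localSize (π '' A) (π x) = localSize A x := by
  rw [localSize, ← Set.image_singleton, closedNbhd_image, ← Set.image_inter π.injective,
    closedNbhd_image, ← Set.image_inter π.injective, Set.ncard_image_of_injective _ π.injective,
    localSize]

/-- `localSize` for masks. -/
def localSizeMask (A n : ℕ) : ℕ :=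
  force (Nat.land A (nbrs (nbrs (Nat.shiftLeft 1 n)))) fun B =>
    force (Nat.land A (nbrs (nbrs B))) maskCard

theorem localSize_evenPart {A : ℕ} (hA : ∀ w ∈ toSet A, Even (hammingNorm w)) (x : EvenWord) :
    localSize (evenPart (toSet A)) x = localSizeMask A (code x.1) := by
  have hx : ({x} : Set EvenWord) = evenPart (toSet (1 <<< code x.1)) := by
    rw [toSet_single]
    ext v
    exact Subtype.ext_iff
  have hand : ∀ M N, evenPart (toSet M) ∩ evenPart (toSet N) = evenPart (toSet (M &&& N)) := by
    intro M N; rw [toSet_and]; rfl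
  rw [localSize, hx, ← evenPart_nbrs_nbrs, hand, ← evenPart_nbrs_nbrs, hand, ncard_evenPart,
    localSizeMask, force_eq, force_eq]
  · rfl
  · intro w hw
    rw [toSet_and] at hw
    exact hA w hw.1

/-! ### The 25 trades -/

/-- The mask of the union of the components of the trade with name `i`. -/
def supportMask (i : TradeName) : ℕ := Nat.lor (tradeData i).fst (tradeData i).snd

/-- The numbers of vertices at distance at most one from the 25 trades. -/
def nbhdCard : TradeName → ℕ
  | .t32 => 1024
  | .t48 => 1360
  | .t56a => 1512
  | .t56b => 1536
  | .t68 => 1704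
  | .t72a => 1584
  | .t72b => 1704
  | .t72c => 1724
  | .t72d => 1704
  | .t80a => 1780
  | .t80b => 1732
  | .t86 => 1876
  | .t92a => 1914
  | .t92b => 1914
  | .t96a => 1840
  | .t96b => 1902
  | .t98 => 1914
  | .t102 => 1914
  | .t108a => 1872
  | .t108b => 1884
  | .t110a => 1914
  | .t110b => 1914
  | .t120a => 1896
  | .t120b => 1902
  | .t132 => 1914

/-- All computations for the trade with name `i`. -/
def tradeCheck (i : TradeName) : Bool :=
  and (tradeData i).closed (force (tradeData i).fst fun M => force (tradeData i).snd fun N =>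
    and (isTradeMask M N i.nominalVolume) (and (isConnectedMask M N)
      (Nat.beq (maskCard (nbrs (nbrs (Nat.lor M N)))) (nbhdCard i))))

theorem tradeCheck_eq_true (i : TradeName) : tradeCheck i = true := by
  cases i <;> decide +kernel

theorem trade_eq (i : TradeName) :
    trade i = (toSet (tradeData i).fst, toSet (tradeData i).snd) := by
  have h := tradeCheck_eq_true i
  rw [tradeCheck, Bool.and_eq_true] at h
  rw [trade_eq_toPair, TradeData.toPair_eq h.1]

theorem nominalVolume_ne_zero (i : TradeName) : i.nominalVolume ≠ 0 := by
  cases i <;> simp [TradeName.nominalVolume]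

theorem isConstantWeightTrade_trade (i : TradeName) :
    IsConstantWeightTrade (trade i) ∧ volume (trade i) = i.nominalVolume := by
  have h := tradeCheck_eq_true i
  simp only [tradeCheck, force_eq, Bool.and_eq_true] at h
  rw [trade_eq]
  exact isConstantWeightTrade_of_isTradeMask h.2.1 (nominalVolume_ne_zero i)

theorem isPrimaryConstantWeightTrade_trade (i : TradeName) :
    IsPrimaryConstantWeightTrade (trade i) := by
  have h := tradeCheck_eq_true i
  simp only [tradeCheck, force_eq, Bool.and_eq_true] at h
  have h' := (isConstantWeightTrade_trade i).1
  rw [trade_eq] at h' ⊢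
  exact isPrimary_of_isConnectedMask h' h.2.2.1

theorem support_trade (i : TradeName) : support (trade i) = evenPart (toSet (supportMask i)) := by
  have : supportMask i = (tradeData i).fst ||| (tradeData i).snd := rfl
  rw [trade_eq, support, this, toSet_or]; rfl

theorem even_of_mem_supportMask (i : TradeName) :
    ∀ w ∈ toSet (supportMask i), Even (hammingNorm w) := by
  intro w hw
  have : supportMask i = (tradeData i).fst ||| (tradeData i).snd := rfl
  rw [this, toSet_or] at hw
  have := (isConstantWeightTrade_trade i).1.1 w (by rw [trade_eq]; exact hw)
  rw [this]; decide

theorem ncard_support_trade (i : TradeName) : (support (trade i)).ncard = 2 * i.nominalVolume := by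
  have h := tradeCheck_eq_true i
  simp only [tradeCheck, isTradeMask, force_eq, Bool.and_eq_true, Nat.beq_eq] at h
  obtain ⟨-, ⟨-, -, -, h1, h2, -⟩, -⟩ := h
  have hT := (isConstantWeightTrade_trade i).1
  have hdis := hT.2.disjoint
  obtain ⟨hw1, hw2, -⟩ := isConstantWeightTrade_iff.1 hT
  rw [trade_eq] at hdis hw1 hw2 ⊢
  rw [support, Set.ncard_union_eq hdis, ncard_evenPart, ncard_evenPart, h1, h2, two_mul]
  · intro w hw; rw [hw2 w hw]; decide
  · intro w hw; rw [hw1 w hw]; decide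

theorem ncard_closedNbhd_trade (i : TradeName) :
    (closedNbhd (support (trade i))).ncard = nbhdCard i := by
  have h := tradeCheck_eq_true i
  simp only [tradeCheck, force_eq, Bool.and_eq_true, Nat.beq_eq] at h
  rw [support_trade, ← evenPart_nbrs_nbrs,
    ncard_evenPart (even_of_mem_nbrs_nbrs (even_of_mem_supportMask i))]
  exact h.2.2.2

/-- The code `n` belongs to an element with local size `k` in the trade with name `i`. -/
def hasLocalSize (i : TradeName) (k n : ℕ) : Bool :=
  force (supportMask i) fun A => and (digit A n) (Nat.beq (localSizeMask A n) k)

/-- The trade with name `i` is the union of the orbits of the words in `reps`, and these do not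
have local size `k`. -/
def hasNoLocalSize (i : TradeName) (k : ℕ) (reps : List (Word 12)) : Bool :=
  force (supportMask i) fun A => and (Nat.beq (orbitMask (tradeData i).gens 16 (listMask reps)) A)
    (and (Nat.beq (orbitStep (tradeData i).gens A) A)
      (reps.all fun r => not (Nat.beq (localSizeMask A (code r)) k)))

/-- An equivalence maps support onto support and preserves local sizes, so the vertex with code `n`
would have an image of local size `k`. The group of the second trade preserves its support, hence
testing one word from each of its orbits excludes this. -/
theorem not_equivalent_of_localSize {i j : TradeName} {k n : ℕ} {reps : List (Word 12)}
    (hn : n < 4096) (hi : hasLocalSize i k n = true) (hj : hasNoLocalSize j k reps = true) :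
    ¬ Equivalent (trade i) (trade j) := by
  intro h
  obtain ⟨π, hπ⟩ := h.exists_image_support
  simp only [hasLocalSize, force_eq, Bool.and_eq_true, Nat.beq_eq, digit_eq] at hi
  simp only [hasNoLocalSize, force_eq, Bool.and_eq_true, Nat.beq_eq, List.all_eq_true] at hj
  obtain ⟨h1, h2, h3⟩ := hj
  have hmem : ofCode n ∈ toSet (supportMask i) := by rw [mem_toSet, code_ofCode hn]; exact hi.1
  set x : EvenWord := ⟨ofCode n, even_of_mem_supportMask i _ hmem⟩
  have hx : localSize (support (trade i)) x = k := by
    rw [support_trade, localSize_evenPart (even_of_mem_supportMask i), ← hi.2]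
    exact congrArg _ (code_ofCode hn)
  rw [← localSize_image π, hπ, support_trade] at hx
  have hy : π x ∈ evenPart (toSet (supportMask j)) := by
    rw [← support_trade, ← hπ]
    refine Set.mem_image_of_mem _ ?_
    rw [support_trade]
    exact hmem
  have horb := orbits_eq_toSet h1 h2
  have hy' : (π x).1 ∈ orbits _ reps := horb ▸ hy
  obtain ⟨g, hg, r, hr, hgr⟩ := hy'
  have hr' : r ∈ toSet (supportMask j) := by
    rw [← horb]
    exact ⟨1, one_mem _, r, hr, rfl⟩
  have e1 : π x = permuteIso g ⟨r, even_of_mem_supportMask j _ hr'⟩ := Subtype.ext hgr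
  have e2 : permuteIso g '' evenPart (toSet (supportMask j)) =
      evenPart (toSet (supportMask j)) := by
    rw [permuteIso_image_evenPart, ← horb, permute_image_orbits_eq hg]
  rw [e1, ← e2, localSize_image, localSize_evenPart (even_of_mem_supportMask j)] at hx
  have := h3 r hr
  rw [Bool.not_eq_true', ← Bool.not_eq_true, Nat.beq_eq] at this
  exact this hx

/-- Separates the three pairs of trades that share volume and `nbhdCard`. The codes `2133`, `3061`,
`2799` are support words whose local sizes `29`, `36`, `31` do not occur in the partner. -/
theorem localSize_checks :
    and (hasLocalSize .t72d 29 2133)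
      (and (hasNoLocalSize .t72b 29 [![1,1,1,0,1,0,1,0,0,0,1,0], ![1,0,1,1,1,0,1,0,0,0,1,0]])
      (and (hasLocalSize .t92b 36 3061)
      (and (hasNoLocalSize .t92a 36 [![1,1,1,1,1,1,0,0,0,0,0,0], ![0,1,1,1,1,1,1,0,0,0,0,0],
        ![0,0,1,1,1,1,1,1,0,0,0,0], ![1,1,1,0,0,0,1,1,1,0,0,0], ![0,1,1,1,0,0,1,1,1,0,0,0],
        ![0,1,0,1,1,0,1,1,1,0,0,0]])
      (and (hasLocalSize .t110a 31 2799)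
      (hasNoLocalSize .t110b 31 [![1,1,1,1,0,1,1,0,0,0,0,0], ![1,1,1,0,1,1,1,0,0,0,0,0]]))))) =
      true := by
  decide +kernel

theorem eq_or_of_invariants {i j : TradeName} (h1 : i.nominalVolume = j.nominalVolume)
    (h2 : nbhdCard i = nbhdCard j) : i = j ∨
      (i = .t72b ∧ j = .t72d ∨ i = .t72d ∧ j = .t72b) ∨
      (i = .t92a ∧ j = .t92b ∨ i = .t92b ∧ j = .t92a) ∨
      (i = .t110a ∧ j = .t110b ∨ i = .t110b ∧ j = .t110a) := by
  cases i <;> cases j <;> first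
    | exact .inl rfl
    | exact absurd h1 (by decide)
    | exact absurd h2 (by decide)
    | simp

theorem eq_of_equivalent {i j : TradeName} (h : Equivalent (trade i) (trade j)) : i = j := by
  have hc := localSize_checks
  simp only [Bool.and_eq_true] at hc
  obtain ⟨h1, h2, h3, h4, h5, h6⟩ := hc
  obtain ⟨π, hπ⟩ := h.exists_image_support
  have e1 : 2 * i.nominalVolume = 2 * j.nominalVolume := by
    rw [← ncard_support_trade, ← ncard_support_trade, ← hπ,
      Set.ncard_image_of_injective _ π.injective]
  have e2 : nbhdCard i = nbhdCard j := by
    rw [← ncard_closedNbhd_trade, ← ncard_closedNbhd_trade, ← hπ, closedNbhd_image,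
      Set.ncard_image_of_injective _ π.injective]
  rcases eq_or_of_invariants (by omega) e2 with h' | (⟨rfl, rfl⟩ | ⟨rfl, rfl⟩) |
    (⟨rfl, rfl⟩ | ⟨rfl, rfl⟩) | (⟨rfl, rfl⟩ | ⟨rfl, rfl⟩)
  · exact h'
  · exact absurd h.symm (not_equivalent_of_localSize (by norm_num) h1 h2)
  · exact absurd h (not_equivalent_of_localSize (by norm_num) h1 h2)
  · exact absurd h.symm (not_equivalent_of_localSize (by norm_num) h3 h4)
  · exact absurd h (not_equivalent_of_localSize (by norm_num) h3 h4)
  · exact absurd h (not_equivalent_of_localSize (by norm_num) h5 h6)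
  · exact absurd h.symm (not_equivalent_of_localSize (by norm_num) h5 h6)

/-! ### Steiner systems -/

theorem hammingNorm_of_flipWord {c : Word 12} {i : Fin 12} (h : hammingNorm (flipWord i c) = 6) :
    hammingNorm c = 5 ∨ hammingNorm c = 7 := by
  rcases zmod_two_cases (c i) with h' | h'
  · have := hammingNorm_flipWord_of_zero h'
    omega
  · have := hammingNorm_flipWord_of_one h'
    omega

theorem permute_flipWord (g : Equiv.Perm (Fin 12)) (i : Fin 12) (w : Word 12) :
    permute g (flipWord i w) = flipWord (g i) (permute g w) := by
  funext j
  simp only [permute, flipWord, Function.update_apply, Equiv.symm_apply_apply,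
    Equiv.symm_apply_eq]

theorem degree_permute (g : Equiv.Perm (Fin 12)) (T : Set (Word 12)) (c : Word 12) :
    degree (permute g '' T) (permute g c) = degree T c := by
  rw [degree, degree, ← Set.ncard_image_of_injective {i | flipWord i c ∈ T} g.injective]
  congr 1
  ext i
  obtain ⟨j, rfl⟩ := g.surjective i
  rw [Set.mem_ofPred_eq, ← permute_flipWord, (permute_injective g).mem_set_image,
    g.injective.mem_set_image, Set.mem_ofPred_eq]

theorem IsSteinerSystem.exists_mem {W : Set (Word 12)} (hW : IsSteinerSystem 6 12 W) {c : Word 12}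
    (hc : hammingNorm c = 5 ∨ hammingNorm c = 7) : ∃ i, flipWord i c ∈ W :=
  degree_pos_iff.1 (by rw [(isSteinerSystem_iff.1 hW).2 c hc]; exact one_pos)

theorem IsSteinerSystem.eq_of_mem {W : Set (Word 12)} (hW : IsSteinerSystem 6 12 W) {c : Word 12}
    {i j : Fin 12} (hi : flipWord i c ∈ W) (hj : flipWord j c ∈ W) : i = j :=
  degree_le_one_iff.1 ((isSteinerSystem_iff.1 hW).2 c (hammingNorm_of_flipWord (hW.1 _ hi))).le
    i j hi hj

theorem IsSteinerSystem.image {W : Set (Word 12)} (hW : IsSteinerSystem 6 12 W)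
    (g : Equiv.Perm (Fin 12)) : IsSteinerSystem 6 12 (permute g '' W) := by
  obtain ⟨h1, h2⟩ := isSteinerSystem_iff.1 hW
  refine isSteinerSystem_iff.2 ⟨?_, fun c hc => ?_⟩
  · rintro _ ⟨w, hw, rfl⟩
    rw [hammingNorm_permute, h1 w hw]
  · rw [← permute_permute_inv g c, degree_permute]
    exact h2 _ (by rwa [hammingNorm_permute])

/-- A neighbour of `v` is next to some block of `W`. This block is also in `V`, so it is `v`. In the
searches it therefore suffices to enclose a system in the mask of a known one. -/
theorem IsSteinerSystem.eq_of_subset {V W : Set (Word 12)} (hV : IsSteinerSystem 6 12 V)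
    (hW : IsSteinerSystem 6 12 W) (h : W ⊆ V) : W = V := by
  refine h.antisymm fun v hv => ?_
  -- Any position would do; only some neighbour of `v` is needed.
  have hv' : flipWord 0 (flipWord 0 v) ∈ V := by rwa [flipWord_flipWord]
  obtain ⟨i, hi⟩ := hW.exists_mem (hammingNorm_of_flipWord (hV.1 _ hv'))
  rw [hV.eq_of_mem (h hi) hv', flipWord_flipWord] at hi
  exact hi

/-- The set with mask `M` is an `S(5,6,12)`. -/
def steinerCheck (M : ℕ) : Bool :=
  force M fun M => and (Nat.beq (Nat.land M sixMask) M) (and (Nat.beq (covers M).2 0)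
    (Nat.beq (Nat.land (nbrs M) fiveSevenMask) fiveSevenMask))

theorem isSteinerSystem_of_check {M : ℕ} (h : steinerCheck M = true) :
    IsSteinerSystem 6 12 (toSet M) := by
  simp only [steinerCheck, force_eq, Bool.and_eq_true, Nat.beq_eq] at h
  obtain ⟨h1, h2, h3⟩ := h
  refine isSteinerSystem_iff.2 ⟨fun w hw => mem_toSet_sixMask.1 (toSet_subset_of_and_eq h1 hw),
    fun c hc => le_antisymm (degree_toSet_le_one h2 c) (degree_toSet_pos_iff.2 ?_)⟩
  have e : fiveSevenMask &&& nbrs M = fiveSevenMask := by rw [Nat.land_comm]; exact h3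
  exact toSet_subset_of_and_eq e (mem_toSet_fiveSevenMask.2 hc)

/-! ### A search for Steiner systems -/

/-- The elements of `K` that do not have distance two from an element of `F`. -/
def chooseMask (K F : ℕ) : ℕ :=
  match covers F with
  | (N, D) => sdiffMask K (Nat.lor (sdiffMask (nbrs N) F) (nbrs D))

/-- The elements of `K` that are contained in all Steiner systems contained in `K`, as follows from
the words of weight 5 and 7 with a unique neighbour in `K`. -/
def forcedMask (K : ℕ) : ℕ :=
  match covers K with
  | (N, D) => Nat.land K (nbrs (Nat.land fiveSevenMask (sdiffMask N D)))

/-- Different blocks have no common neighbour. The first removed part consists of the words outside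
`F` at distance two from `F`. The second one covers conflicts among the elements of `F` themselves,
which cannot arise when `F` is part of a system. -/
theorem subset_chooseMask {W : Set (Word 12)} (hW : IsSteinerSystem 6 12 W) {K F : ℕ}
    (hK : W ⊆ toSet K) (hF : toSet F ⊆ W) : W ⊆ toSet (chooseMask K F) := by
  intro w hw
  have e : chooseMask K F =
      sdiffMask K (sdiffMask (nbrs (covers F).1) F ||| nbrs (covers F).2) := rfl
  rw [e, toSet_sdiff, toSet_or, toSet_sdiff]
  refine ⟨hK hw, fun h => ?_⟩
  rcases h with ⟨h1, h2⟩ | h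
  · refine h2 ?_
    obtain ⟨i, hi⟩ := mem_toSet_nbrs.1 h1
    rw [covers_fst] at hi
    obtain ⟨j, hj⟩ := mem_toSet_nbrs.1 hi
    have hw' : flipWord i (flipWord i w) ∈ W := by rwa [flipWord_flipWord]
    rwa [hW.eq_of_mem (hF hj) hw', flipWord_flipWord] at hj
  · obtain ⟨i, hi⟩ := mem_toSet_nbrs.1 h
    obtain ⟨j, k, hjk, hj, hk⟩ := mem_toSet_covers_snd.1 hi
    exact hjk (hW.eq_of_mem (hF hj) (hF hk))

theorem toSet_forcedMask_subset {W : Set (Word 12)} (hW : IsSteinerSystem 6 12 W) {K : ℕ}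
    (hK : W ⊆ toSet K) : toSet (forcedMask K) ⊆ W := by
  intro w hw
  have e : forcedMask K = K &&& nbrs (fiveSevenMask &&& sdiffMask (covers K).1 (covers K).2) := rfl
  rw [e, toSet_and] at hw
  obtain ⟨hw, hw'⟩ := hw
  obtain ⟨i, hi⟩ := mem_toSet_nbrs.1 hw'
  rw [toSet_and, toSet_sdiff] at hi
  obtain ⟨h57, -, hD⟩ := hi
  obtain ⟨j, hj⟩ := hW.exists_mem (mem_toSet_fiveSevenMask.1 h57)
  have : j = i := by
    by_contra hne
    exact hD (mem_toSet_covers_snd.2 ⟨j, i, hne, hK hj, by rwa [flipWord_flipWord]⟩)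
  rwa [this, flipWord_flipWord] at hj

/-- A search tree. A node deals with the Steiner systems contained in a mask `R`, where a mask `K`
containing `R` is kept in mind for the branches. -/
inductive SearchTree
  /-- There is no Steiner system, since `R` contains no neighbour of the word with code `x`. -/
  | fail (x : ℕ) : SearchTree
  /-- The mask `K` has the form described by `n` and `s`, and is stored. -/
  | leaf (n : ℕ) (s : List (List (Fin 12))) : SearchTree
  /-- The permutation `s` maps `R` into the stored mask number `j`. -/
  | ref (j : ℕ) (s : List (List (Fin 12))) : SearchTree
  /-- Use the forced elements of `K`. -/
  | propagate (t : SearchTree) : SearchTree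
  /-- Distinguish whether the word with code `b` belongs to the Steiner system. -/
  | split (b : ℕ) (t₁ t₂ : SearchTree) : SearchTree
  /-- Store `K` at the end. -/
  | save (t : SearchTree) : SearchTree

/-- Verifies a search tree, where the permutations are required to fix the mask `base`, and returns
the list of the stored masks. -/
def SearchTree.check (base : ℕ) (isLeaf : ℕ → List (List (Fin 12)) → ℕ → Bool) :
    SearchTree → List ℕ → ℕ → ℕ → Option (List ℕ)
  | .fail x, L, _, R =>
    cond (and (Nat.blt x 4096) (and (digit fiveSevenMask x)
      (Nat.beq (Nat.land R (nbrs (Nat.shiftLeft 1 x))) 0))) (some L) none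
  | .leaf n s, L, K, _ => cond (isLeaf n s K) (some (L ++ [K])) none
  | .ref j s, L, _, R =>
    match L[j]? with
    | none => none
    | some M => cond (and (Nat.beq (permMask s base) base)
        (force (permMask s R) fun R' => Nat.beq (Nat.land R' M) R')) (some L) none
  | .propagate t, L, K, _ =>
    force (chooseMask K (forcedMask K)) fun K' => t.check base isLeaf L K' K'
  | .split b t₁ t₂, L, K, R =>
    cond (Nat.blt b 4096)
      (match force (chooseMask K (Nat.shiftLeft 1 b)) fun K' => t₁.check base isLeaf L K' K' with
      | none => none
      | some L' =>
        force (sdiffMask R (Nat.shiftLeft 1 b)) fun R' => t₂.check base isLeaf L' K R') none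
  | .save t, L, K, _ =>
    match t.check base isLeaf L K K with
    | none => none
    | some L' => some (L' ++ [K])

/-- The induction carries along that the goal holds for every system inside a stored mask; this
justifies replacing `R` by its image in a stored mask. In a `split` the excluded word is removed
from `R` only, while the branch that includes it starts from `K`. Stored masks thus do not depend on
earlier exclusions, which lets symmetries map later cases into them. -/
theorem SearchTree.check_spec {base : ℕ} {isLeaf : ℕ → List (List (Fin 12)) → ℕ → Bool}
    {goal : Set (Word 12) → Prop}
    (hgoal : ∀ g W, permute g '' toSet base = toSet base → goal (permute g '' W) → goal W)
    (hleaf : ∀ n s K, isLeaf n s K = true → ∀ W, IsSteinerSystem 6 12 W → W ⊆ toSet K → goal W)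
    (t : SearchTree) : ∀ {L L' : List ℕ} {K R : ℕ}, t.check base isLeaf L K R = some L' →
      toSet R ⊆ toSet K →
      (∀ M ∈ L, ∀ W, IsSteinerSystem 6 12 W → W ⊆ toSet M → goal W) →
      (∀ W, IsSteinerSystem 6 12 W → W ⊆ toSet R → goal W) ∧
        ∀ M ∈ L', ∀ W, IsSteinerSystem 6 12 W → W ⊆ toSet M → goal W := by
  induction t with
  | fail x =>
    intro L L' K R h hRK hL
    rw [check] at h
    cases h' : and (Nat.blt x 4096) (and (digit fiveSevenMask x)
      (Nat.beq (Nat.land R (nbrs (Nat.shiftLeft 1 x))) 0)) <;> rw [h'] at h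
    · simp at h
    · simp only [cond_true, Option.some.injEq] at h
      subst h
      refine ⟨fun W hW hWR => ?_, hL⟩
      simp only [Bool.and_eq_true, Nat.blt_eq, digit_eq, Nat.beq_eq] at h'
      obtain ⟨hx, h57, h0⟩ := h'
      have hx' := code_ofCode hx
      obtain ⟨i, hi⟩ := hW.exists_mem (c := ofCode x)
        (mem_toSet_fiveSevenMask.1 (by rw [mem_toSet, hx']; exact h57))
      have e : Nat.land R (nbrs (Nat.shiftLeft 1 x)) = R &&& nbrs (1 <<< code (ofCode x)) := by
        rw [hx']; rfl
      rw [e] at h0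
      have : flipWord i (ofCode x) ∈ toSet (R &&& nbrs (1 <<< code (ofCode x))) := by
        rw [toSet_and]
        exact ⟨hWR hi, mem_toSet_nbrs.2 ⟨i, by rw [toSet_single, flipWord_flipWord]; rfl⟩⟩
      rw [h0, toSet_zero] at this
      exact this.elim
  | leaf n s =>
    intro L L' K R h hRK hL
    rw [check] at h
    cases h' : isLeaf n s K <;> rw [h'] at h
    · simp at h
    · simp only [cond_true, Option.some.injEq] at h
      subst h
      refine ⟨fun W hW hWR => hleaf n s K h' W hW (hWR.trans hRK), fun M hM => ?_⟩
      rcases List.mem_append.1 hM with hM | hM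
      · exact hL M hM
      · rw [List.mem_singleton.1 hM]
        exact hleaf n s K h'
  | ref j s =>
    intro L L' K R h hRK hL
    rw [check] at h
    cases hj : L[j]? with
    | none => rw [hj] at h; simp at h
    | some M =>
      rw [hj] at h
      dsimp only at h
      cases h' : and (Nat.beq (permMask s base) base)
        (force (permMask s R) fun R' => Nat.beq (Nat.land R' M) R') <;> rw [h'] at h
      · simp at h
      · simp only [cond_true, Option.some.injEq] at h
        subst h
        refine ⟨fun W hW hWR => ?_, hL⟩
        simp only [force_eq, Bool.and_eq_true, Nat.beq_eq] at h'
        obtain ⟨h1, h2⟩ := h'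
        refine hgoal (cycles s) W (by rw [← toSet_permMask, h1]) ?_
        refine hL M (List.mem_of_getElem? hj) _ (hW.image _) ?_
        refine (Set.image_mono hWR).trans ?_
        rw [← toSet_permMask]
        exact toSet_subset_of_and_eq h2
  | propagate t ih =>
    intro L L' K R h hRK hL
    rw [check, force_eq] at h
    obtain ⟨h1, h2⟩ := ih h subset_rfl hL
    refine ⟨fun W hW hWR => h1 W hW ?_, h2⟩
    exact subset_chooseMask hW (hWR.trans hRK) (toSet_forcedMask_subset hW (hWR.trans hRK))
  | split b t₁ t₂ ih₁ ih₂ =>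
    intro L L' K R h hRK hL
    rw [check, force_eq] at h
    cases hb : Nat.blt b 4096 <;> rw [hb] at h
    · simp at h
    rw [cond_true] at h
    have e : Nat.shiftLeft 1 b = 1 <<< code (ofCode b) := by
      rw [code_ofCode (by rwa [Nat.blt_eq] at hb)]; rfl
    rw [e] at h
    cases h₁ : t₁.check base isLeaf L (chooseMask K (1 <<< code (ofCode b)))
        (chooseMask K (1 <<< code (ofCode b))) with
    | none => rw [h₁] at h; simp at h
    | some L₁ =>
      rw [h₁] at h
      dsimp only at h
      rw [force_eq] at h
      obtain ⟨g1, g2⟩ := ih₁ h₁ subset_rfl hL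
      obtain ⟨g3, g4⟩ := ih₂ h (by rw [toSet_sdiff]; exact Set.sdiff_subset.trans hRK) g2
      refine ⟨fun W hW hWR => ?_, g4⟩
      by_cases hbW : ofCode b ∈ W
      · refine g1 W hW (subset_chooseMask hW (hWR.trans hRK) ?_)
        rw [toSet_single]
        exact Set.singleton_subset_iff.2 hbW
      · refine g3 W hW fun w hw => ?_
        rw [toSet_sdiff, toSet_single]
        exact ⟨hWR hw, fun h => hbW (by rw [← Set.mem_singleton_iff.1 h]; exact hw)⟩
  | save t ih =>
    intro L L' K R h hRK hL
    rw [check] at h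
    cases h' : t.check base isLeaf L K K with
    | none => rw [h'] at h; simp at h
    | some L₁ =>
      rw [h'] at h
      simp only [Option.some.injEq] at h
      subst h
      obtain ⟨h1, h2⟩ := ih h' subset_rfl hL
      refine ⟨fun W hW hWR => h1 W hW (hWR.trans hRK), fun M hM => ?_⟩
      rcases List.mem_append.1 hM with hM | hM
      · exact h2 M hM
      · rw [List.mem_singleton.1 hM]
        exact h1

/-- A verified search tree deals with all Steiner systems. -/
theorem SearchTree.goal_of_check {base : ℕ} {isLeaf : ℕ → List (List (Fin 12)) → ℕ → Bool}
    {goal : Set (Word 12) → Prop}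
    (hgoal : ∀ g W, permute g '' toSet base = toSet base → goal (permute g '' W) → goal W)
    (hleaf : ∀ n s K, isLeaf n s K = true → ∀ W, IsSteinerSystem 6 12 W → W ⊆ toSet K → goal W)
    {t : SearchTree} (h : (t.check base isLeaf [] sixMask sixMask).isSome = true)
    {W : Set (Word 12)} (hW : IsSteinerSystem 6 12 W) : goal W := by
  obtain ⟨L, hL⟩ := Option.isSome_iff_exists.1 h
  exact (t.check_spec hgoal hleaf hL subset_rfl (by simp)).1 W hW
    fun w hw => mem_toSet_sixMask.2 (hW.1 w hw)

/-! ### Uniqueness of the small Witt design -/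

/-- The mask of a particular `S(5,6,12)`. -/
def wittMask : ℕ := (tradeData .t132).fst

/-- The blocks form one orbit of `PSL(2,11)`. On the projective line over the field with 11
elements, with position 11 as the point at infinity, the generators are `x ↦ x + 1`, `x ↦ 3x` and `x
↦ -1/x`. -/
theorem isSteinerSystem_wittMask : IsSteinerSystem 6 12 (toSet wittMask) :=
  isSteinerSystem_of_check (by decide +kernel)

/-- A search tree for the uniqueness of the Steiner system. -/
def uniquenessTree : SearchTree :=
  .split 2751 (.save (.split 1687 (.save (.split 2263 (.propagate (.save (.split 2374 (.propagate
  (.save (.split 2283 (.propagate (.save (.split 3065 (.propagate (.propagate (.propagate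
  (.propagate (.save (.split 2459 (.propagate (.propagate (.propagate (.propagate (.save (.split
  4028 (.propagate (.propagate (.leaf 0 [[5, 6, 8, 9], [7, 10, 11]]))) (.split 3512 (.propagate
  (.propagate (.ref 0 [[10, 11]]))) (.fail 4024)))))))) (.split 2522 (.propagate (.propagate
  (.propagate (.propagate (.ref 1 [[6, 9], [7, 8]]))))) (.fail 2523)))))))) (.split 2489
  (.propagate (.propagate (.propagate (.propagate (.ref 2 [[7, 8]]))))) (.fail 2553))))) (.split
  2285 (.propagate (.ref 3 [[1, 2]])) (.split 2286 (.propagate (.propagate (.save (.split 2862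
  (.propagate (.propagate (.save (.split 1413 (.save (.split 967 (.propagate (.fail 853)) (.split
  451 (.propagate (.fail 142)) (.fail 455)))) (.split 1420 (.ref 4 [[0, 3], [4, 5]]) (.split 1428
  (.ref 4 [[0, 1, 4, 2]]) (.split 1444 (.ref 4 [[0, 3, 4, 5]]) (.fail 1412)))))))) (.split 2874
  (.propagate (.fail 2605)) (.split 2876 (.propagate (.fail 2603)) (.fail 2878))))))) (.fail
  2287)))))) (.split 2386 (.propagate (.ref 7 [[2, 4]])) (.split 2388 (.propagate (.ref 7 [[1, 4,
  2]])) (.fail 2390)))))) (.split 2071 (.propagate (.ref 8 [[8, 9]])) (.split 2455 (.propagate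
  (.ref 8 [[7, 9, 8]])) (.fail 2199))))) (.split 1703 (.ref 9 [[4, 5]]) (.split 1715 (.ref 9 [[2,
  3, 5, 4]]) (.split 1717 (.ref 9 [[1, 3, 5, 4, 2]]) (.split 1718 (.ref 9 [[0, 3, 5, 4, 2, 1]])
  (.fail 1719))))))) (.split 2783 (.ref 10 [[5, 6]]) (.split 2591 (.ref 10 [[5, 7]]) (.split 2975
  (.ref 10 [[5, 8]]) (.split 2207 (.ref 10 [[5, 9]]) (.split 3743 (.ref 10 [[5, 10]]) (.split 671
  (.ref 10 [[5, 11]]) (.fail 2719)))))))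

/-- The permutation `s` maps `K` into the mask `wittMask`. -/
def mapsIntoWitt (_ : ℕ) (s : List (List (Fin 12))) (K : ℕ) : Bool :=
  force (permMask s K) fun K' => Nat.beq (Nat.land K' wittMask) K'

/-- With base mask `0` every permutation may serve as a symmetry. The first branching runs over the
seven candidates for the block through `{0,1,2,3,4}`, the word with code `2719`. Every chain of
splits ends in a word of weight 5 or 7 that has no candidate left. -/
theorem uniquenessTree_check :
    (uniquenessTree.check 0 mapsIntoWitt [] sixMask sixMask).isSome = true := by
  decide +kernel

/-- Every `S(5,6,12)` is isomorphic to the one with mask `wittMask`. -/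
theorem IsSteinerSystem.exists_image_eq {W : Set (Word 12)} (hW : IsSteinerSystem 6 12 W) :
    ∃ g, permute g '' W = toSet wittMask := by
  refine SearchTree.goal_of_check (goal := fun W => ∃ g, permute g '' W = toSet wittMask)
    ?_ ?_ uniquenessTree_check hW
  · rintro g W - ⟨h, hh⟩
    exact ⟨h * g, by rw [image_permute_mul, hh]⟩
  · intro n s K h W hW hWK
    simp only [mapsIntoWitt, force_eq, Nat.beq_eq] at h
    refine ⟨cycles s, isSteinerSystem_wittMask.eq_of_subset (hW.image _) ?_⟩
    refine (Set.image_mono hWK).trans ?_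
    rw [← toSet_permMask]
    exact toSet_subset_of_and_eq h

/-! ### Witt difference pairs -/

/-- The numbering of the trades that are differences of Steiner systems. -/
def wittName : ℕ → TradeName
  | 0 => .t72b
  | 1 => .t96a
  | 2 => .t108a
  | 3 => .t108b
  | 4 => .t120a
  | 5 => .t120b
  | _ => .t132

/-- A permutation that maps `wittMask` to a Steiner system containing the first component of
`wittName n`. -/
def wittIso : ℕ → List (List (Fin 12))
  | 0 => [[5, 6], [7, 8, 10, 9]]
  | 1 => [[5, 8], [9, 11]]
  | 2 => [[5, 6], [7, 8, 9], [10, 11]]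
  | 3 => [[5, 9, 6, 8, 11, 10]]
  | 4 => [[5, 9, 8], [10, 11]]
  | 5 => [[5, 7, 9], [6, 11], [8, 10]]
  | _ => []

/-- The mask of the Steiner system containing the first component of `wittName n`. -/
def wittFst (n : ℕ) : ℕ := permMask (wittIso n) wittMask

/-- The mask of the Steiner system containing the second component of `wittName n`. -/
def wittSnd (n : ℕ) : ℕ :=
  Nat.lor (sdiffMask (wittFst n) (tradeData (wittName n)).fst) (tradeData (wittName n)).snd

/-- The trade `wittName n` is the difference of the sets with masks `wittFst n` and `wittSnd n`,
and the second one is a Steiner system. -/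
def wittCheck (n : ℕ) : Bool :=
  force (wittFst n) fun A => force (wittSnd n) fun B =>
    and (steinerCheck B) (and (Nat.beq (sdiffMask A B) (tradeData (wittName n)).fst)
      (Nat.beq (sdiffMask B A) (tradeData (wittName n)).snd))

/-- Exchanging the first component of the trade for the second one inside `wittFst n` yields another
system. Only the new one is tested, since `wittFst n` is a permuted copy of `wittMask`. -/
theorem wittCheck_eq_true : ((List.range 7).all fun n => wittCheck n) = true := by decide +kernel

theorem wittCheck_eq_true_of_lt {n : ℕ} (hn : n < 7) : wittCheck n = true :=
  List.all_eq_true.1 wittCheck_eq_true n (List.mem_range.2 hn)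

theorem isSteinerSystem_wittFst (n : ℕ) : IsSteinerSystem 6 12 (toSet (wittFst n)) := by
  rw [wittFst, toSet_permMask]
  exact isSteinerSystem_wittMask.image _

theorem isSteinerSystem_wittSnd {n : ℕ} (hn : n < 7) :
    IsSteinerSystem 6 12 (toSet (wittSnd n)) := by
  have h := wittCheck_eq_true_of_lt hn
  simp only [wittCheck, force_eq, Bool.and_eq_true] at h
  exact isSteinerSystem_of_check h.1

theorem trade_wittName {n : ℕ} (hn : n < 7) : trade (wittName n) =
    (toSet (wittFst n) \ toSet (wittSnd n), toSet (wittSnd n) \ toSet (wittFst n)) := by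
  have h := wittCheck_eq_true_of_lt hn
  simp only [wittCheck, force_eq, Bool.and_eq_true, Nat.beq_eq] at h
  rw [trade_eq, ← toSet_sdiff, ← toSet_sdiff, h.2.1, h.2.2]

theorem isWittDifference_wittName {n : ℕ} (hn : n < 7) :
    IsWittDifference (trade (wittName n)) := by
  refine ⟨_, _, isSteinerSystem_wittFst n, isSteinerSystem_wittSnd hn, fun h => ?_,
    trade_wittName hn⟩
  have h1 := trade_wittName hn
  rw [← h, Set.sdiff_self] at h1
  obtain ⟨-, -, -, h2, -⟩ :=
    isConstantWeightTrade_iff.1 (isConstantWeightTrade_trade (wittName n)).1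
  rw [h1] at h2
  exact Set.not_nonempty_empty h2

theorem wittName_mem_wittNames (n : ℕ) : wittName n ∈ wittNames := by
  rcases n with _ | _ | _ | _ | _ | _ | n <;> simp [wittName, wittNames]

theorem exists_wittName_eq {i : TradeName} (hi : i ∈ wittNames) : ∃ n < 7, wittName n = i := by
  simp only [wittNames, Set.mem_insert_iff, Set.mem_singleton_iff] at hi
  rcases hi with rfl | rfl | rfl | rfl | rfl | rfl | rfl
  exacts [⟨0, by norm_num, rfl⟩, ⟨1, by norm_num, rfl⟩, ⟨2, by norm_num, rfl⟩,
    ⟨3, by norm_num, rfl⟩, ⟨4, by norm_num, rfl⟩, ⟨5, by norm_num, rfl⟩, ⟨6, by norm_num, rfl⟩]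

/-- A search tree for the pairs of Steiner systems. -/
def pairTree : SearchTree :=
  .save (.split 971 (.save (.split 3037 (.save (.split 4073 (.propagate (.save (.split 3176
  (.propagate (.save (.split 3822 (.propagate (.save (.split 601 (.propagate (.propagate
  (.propagate (.propagate (.save (.split 2138 (.propagate (.save (.split 2894 (.propagate (.save
  (.split 454 (.propagate (.propagate (.propagate (.save (.split 2540 (.propagate (.propagate
  (.leaf 5 [[1, 2, 8], [3, 7], [6, 9, 11, 10]]))) (.split 3532 (.propagate (.propagate (.leaf 3
  [[1, 9, 8, 11, 3, 4, 7, 6, 2, 5]]))) (.fail 2508))))))) (.split 322 (.propagate (.propagate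
  (.propagate (.save (.split 2531 (.propagate (.propagate (.leaf 4 [[1, 4, 2, 5, 10, 7, 9, 6, 3,
  11]]))) (.split 2545 (.propagate (.propagate (.ref 0 [[2, 11, 9, 10, 8, 5, 6, 4], [3, 7]])))
  (.fail 2529))))))) (.fail 326))))) (.split 2510 (.fail 2536) (.fail 3022))))) (.split 2140
  (.fail 2812) (.fail 2136)))))))) (.split 217 (.propagate (.propagate (.propagate (.propagate
  (.save (.split 2283 (.propagate (.propagate (.propagate (.ref 4 [[0, 9, 1, 4, 3, 10, 8, 11],
  [5, 6]])))) (.split 2285 (.propagate (.propagate (.propagate (.save (.split 2843 (.propagate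
  (.propagate (.leaf 6 [[2, 4, 6, 9, 5], [3, 11, 10, 7, 8]]))) (.split 2459 (.propagate
  (.propagate (.ref 0 [[2, 10, 8, 3, 6], [4, 7, 11, 9, 5]]))) (.fail 2331))))))) (.fail
  2281)))))))) (.fail 729))))) (.split 3836 (.propagate (.propagate (.save (.split 2311
  (.propagate (.fail 2967)) (.split 2323 (.propagate (.fail 2967)) (.split 259 (.propagate
  (.propagate (.save (.split 3275 (.save (.split 3743 (.propagate (.fail 2775)) (.split 3799
  (.propagate (.fail 2719)) (.fail 3807)))) (.split 3277 (.save (.split 3613 (.propagate (.fail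
  2062)) (.split 3097 (.propagate (.fail 2206)) (.fail 3101)))) (.split 3289 (.save (.split 3613
  (.propagate (.fail 2074)) (.split 3085 (.propagate (.fail 2206)) (.fail 3101)))) (.split 1225
  (.ref 14 [[0, 9, 10, 4, 11], [1, 8, 7, 5, 2]]) (.fail 3273)))))))) (.fail 2307))))))) (.split
  1772 (.propagate (.save (.split 589 (.propagate (.propagate (.propagate (.propagate (.save
  (.split 551 (.propagate (.propagate (.propagate (.save (.split 2332 (.propagate (.propagate
  (.ref 3 [[2, 7], [3, 5, 11, 6, 8, 9, 4, 10]]))) (.split 2360 (.propagate (.propagate (.leaf 1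
  [[1, 4], [2, 10, 11, 7, 3, 8, 6, 9]]))) (.fail 2328))))))) (.split 1543 (.propagate (.propagate
  (.propagate (.ref 2 [[0, 4], [1, 7, 11], [3, 5, 8, 6, 10, 9]])))) (.fail 519)))))))) (.split
  205 (.propagate (.propagate (.propagate (.propagate (.save (.split 2283 (.propagate (.propagate
  (.propagate (.ref 2 [[0, 7, 11, 9, 3, 5], [1, 4, 8, 2, 6, 10]])))) (.split 2297 (.propagate
  (.propagate (.propagate (.ref 4 [[0, 11, 7], [2, 8, 9, 4, 6, 10], [3, 5]])))) (.fail
  2281)))))))) (.fail 717))))) (.fail 3820)))))) (.split 3368 (.propagate (.save (.split 3815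
  (.propagate (.save (.split 601 (.propagate (.propagate (.propagate (.propagate (.save (.split
  570 (.propagate (.propagate (.propagate (.save (.split 2455 (.propagate (.propagate (.leaf 2
  [[1, 9, 7, 8, 10, 11, 2], [3, 5, 4]]))) (.split 2325 (.propagate (.propagate (.ref 1 [[2, 5,
  11, 7], [3, 4, 9, 6]]))) (.fail 2327))))))) (.split 1562 (.propagate (.propagate (.propagate
  (.ref 4 [[0, 10, 11, 8, 6, 5, 4, 7, 2, 9, 1]])))) (.fail 538)))))))) (.split 217 (.propagate
  (.propagate (.propagate (.propagate (.save (.split 2522 (.propagate (.propagate (.propagate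
  (.propagate (.ref 4 [[0, 11, 7, 3, 2], [1, 9, 6, 4, 8]]))))) (.split 466 (.propagate
  (.propagate (.propagate (.propagate (.ref 24 [[0, 1, 3, 5], [2, 8, 7, 9, 10, 6, 11, 4]])))))
  (.fail 474)))))))) (.fail 729))))) (.split 3829 (.propagate (.propagate (.save (.split 2318
  (.propagate (.fail 2974)) (.split 2330 (.propagate (.fail 2974)) (.split 266 (.propagate
  (.propagate (.save (.split 3271 (.save (.split 3983 (.propagate (.fail 2583)) (.split 4046
  (.propagate (.fail 2646)) (.fail 4047)))) (.split 3275 (.save (.split 3743 (.propagate (.fail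
  2782)) (.split 3806 (.propagate (.fail 2719)) (.fail 3807)))) (.split 3283 (.ref 29 [[1, 9],
  [2, 8], [3, 4], [7, 11]]) (.split 3523 (.ref 28 [[1, 9], [2, 8], [3, 4], [7, 11]]) (.fail
  3267)))))))) (.fail 2314))))))) (.split 1765 (.propagate (.save (.split 589 (.propagate
  (.propagate (.propagate (.propagate (.save (.split 558 (.propagate (.propagate (.propagate
  (.ref 2 [[0, 5, 1, 3], [2, 11, 9, 6, 10, 7, 4, 8]])))) (.split 1550 (.propagate (.propagate
  (.propagate (.ref 9 [[0, 6, 3, 1, 8, 5], [2, 10, 4], [7, 11]])))) (.fail 526)))))))) (.split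
  205 (.propagate (.propagate (.propagate (.propagate (.save (.split 2283 (.propagate (.propagate
  (.propagate (.ref 4 [[0, 10, 11], [1, 6, 5, 8, 4, 9], [3, 7]])))) (.split 2297 (.propagate
  (.propagate (.propagate (.ref 4 [[0, 10, 3, 11, 8, 2, 4, 1], [5, 9, 7, 6]])))) (.fail
  2281)))))))) (.fail 717))))) (.fail 3813)))))) (.split 3424 (.propagate (.save (.split 3759
  (.propagate (.save (.split 555 (.propagate (.propagate (.propagate (.propagate (.save (.split
  614 (.propagate (.propagate (.propagate (.ref 2 [[0, 5, 1, 9, 11, 2], [3, 10, 6, 7, 8, 4]]))))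
  (.split 806 (.propagate (.propagate (.propagate (.save (.split 2325 (.propagate (.propagate
  (.ref 17 [[2, 8, 7, 3], [5, 9, 10, 6]]))) (.split 3345 (.propagate (.propagate (.ref 1 [[1, 3,
  6, 10, 2, 7, 11, 9], [4, 8]]))) (.fail 2321))))))) (.fail 550)))))))) (.split 171 (.propagate
  (.propagate (.propagate (.propagate (.save (.split 793 (.propagate (.propagate (.propagate
  (.ref 4 [[0, 10, 8, 11, 4, 6], [1, 9, 7, 3, 5, 2]])))) (.split 409 (.propagate (.propagate
  (.propagate (.ref 24 [[1, 11, 8, 7, 4], [2, 3, 6, 10, 9]])))) (.fail 921)))))))) (.fail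
  683))))) (.split 3773 (.propagate (.propagate (.save (.split 2077 (.propagate (.propagate
  (.save (.split 97 (.save (.split 2915 (.propagate (.fail 3691)) (.split 803 (.propagate (.fail
  836)) (.fail 867)))) (.split 1633 (.save (.split 2915 (.propagate (.fail 2155)) (.split 803
  (.propagate (.fail 996)) (.fail 867)))) (.split 1249 (.save (.split 2147 (.propagate (.fail
  2539)) (.split 611 (.propagate (.fail 873)) (.fail 99)))) (.split 1089 (.save (.split 597
  (.propagate (.fail 2659)) (.split 213 (.propagate (.fail 2645)) (.fail 85)))) (.fail
  1121)))))))) (.split 2325 (.propagate (.fail 2620)) (.split 2332 (.propagate (.fail 2613))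
  (.fail 2333))))))) (.split 1709 (.propagate (.save (.split 555 (.propagate (.propagate
  (.propagate (.propagate (.save (.split 1989 (.propagate (.propagate (.propagate (.ref 4 [[0,
  11, 3], [1, 7, 4, 2, 8, 10], [5, 6]])))) (.split 1996 (.propagate (.propagate (.propagate (.ref
  24 [[0, 11, 4, 2, 5, 10, 7, 1, 9, 3, 8]])))) (.fail 1997)))))))) (.split 171 (.propagate
  (.propagate (.propagate (.propagate (.save (.split 781 (.propagate (.propagate (.propagate
  (.ref 4 [[0, 10, 7, 3, 5, 8, 1, 11], [2, 9]])))) (.split 397 (.propagate (.propagate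
  (.propagate (.ref 4 [[0, 10, 2, 11, 6, 4], [3, 5, 7], [8, 9]])))) (.fail 909)))))))) (.fail
  683))))) (.fail 3757)))))) (.fail 3432)))))) (.split 3913 (.propagate (.save (.split 3176
  (.propagate (.save (.split 419 (.propagate (.propagate (.ref 45 [[0, 5, 8, 10, 7, 9, 6, 3], [1,
  11]]))) (.split 421 (.propagate (.save (.split 781 (.propagate (.propagate (.propagate
  (.propagate (.save (.split 2447 (.propagate (.propagate (.propagate (.propagate (.ref 4 [[0,
  10, 8, 5, 6, 1], [2, 11, 3, 9, 4, 7]]))))) (.split 3469 (.propagate (.propagate (.propagate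
  (.propagate (.ref 24 [[2, 10, 7, 3, 11], [4, 5, 9, 8, 6]]))))) (.fail 2445)))))))) (.split 1933
  (.propagate (.propagate (.propagate (.propagate (.save (.split 2447 (.propagate (.propagate
  (.propagate (.propagate (.ref 2 [[0, 5, 3, 9, 2, 4, 11, 8, 10, 6], [1, 7]]))))) (.split 2317
  (.propagate (.propagate (.propagate (.propagate (.ref 36 [[1, 2, 10, 7, 4, 6, 5, 9], [3,
  8]]))))) (.fail 2445)))))))) (.fail 909))))) (.split 433 (.propagate (.ref 48 [[1, 11, 2], [3,
  5, 8], [6, 10, 9]])) (.fail 417)))))) (.split 3368 (.propagate (.ref 54 [[1, 4], [2, 11], [5,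
  9], [6, 8]])) (.split 3424 (.propagate (.save (.split 727 (.propagate (.save (.split 2534
  (.propagate (.fail 1014)) (.split 2546 (.propagate (.fail 1014)) (.split 482 (.propagate (.fail
  1014)) (.fail 2530)))))) (.split 919 (.propagate (.ref 55 [[1, 4], [2, 11], [5, 9], [6, 8]]))
  (.split 982 (.propagate (.save (.split 2534 (.propagate (.propagate (.propagate (.save (.split
  761 (.propagate (.propagate (.propagate (.save (.split 2807 (.propagate (.propagate (.propagate
  (.ref 2 [[0, 6, 1, 4, 3], [5, 11, 8, 9, 7]])))) (.split 743 (.propagate (.propagate (.propagate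
  (.ref 36 [[0, 1, 10], [2, 6, 11, 9, 8, 5], [3, 7]])))) (.fail 759))))))) (.split 953
  (.propagate (.propagate (.propagate (.save (.split 818 (.propagate (.propagate (.propagate
  (.ref 36 [[1, 2, 9, 5], [4, 10, 11, 8]])))) (.split 1970 (.propagate (.propagate (.propagate
  (.ref 2 [[0, 5, 6, 9, 11, 4], [1, 7, 8, 2, 3, 10]])))) (.fail 946))))))) (.fail 1017)))))))
  (.split 2546 (.propagate (.propagate (.propagate (.save (.split 749 (.propagate (.propagate
  (.propagate (.save (.split 2807 (.propagate (.propagate (.propagate (.ref 36 [[0, 7], [1, 10,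
  3, 5, 6, 4, 9, 2]])))) (.split 755 (.propagate (.propagate (.propagate (.ref 36 [[0, 7], [2, 9,
  4, 11, 10, 3, 5, 8]])))) (.fail 759))))))) (.split 941 (.propagate (.propagate (.propagate
  (.save (.split 2223 (.propagate (.save (.split 3003 (.fail 2857) (.split 2459 (.propagate
  (.save (.split 227 (.propagate (.propagate (.propagate (.save (.split 2839 (.propagate
  (.propagate (.ref 3 [[2, 5, 7, 11, 8], [3, 6, 10, 4, 9]]))) (.split 2326 (.propagate
  (.propagate (.ref 23 [[0, 1], [3, 8, 11, 7, 10, 4, 6, 9]]))) (.fail 2327))))))) (.split 419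
  (.propagate (.propagate (.propagate (.save (.split 2326 (.propagate (.propagate (.leaf 0 [[3,
  10, 4], [5, 6, 8, 9], [7, 11]]))) (.split 2388 (.propagate (.propagate (.ref 23 [[1, 2, 9, 5,
  7], [3, 8, 6, 4, 11]]))) (.fail 2324))))))) (.fail 483))))) (.fail 2971))))) (.split 2237
  (.fail 2589) (.fail 2221))))))) (.fail 1005))))))) (.split 482 (.propagate (.propagate
  (.propagate (.ref 44 [[1, 11], [2, 6], [4, 8], [9, 10]])))) (.fail 2530)))))) (.fail 983))))))
  (.fail 3432)))))) (.split 3529 (.propagate (.ref 50 [[1, 4], [2, 11], [5, 9], [6, 8]])) (.fail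
  4041))))) (.split 733 (.ref 70 [[0, 3], [5, 10], [7, 9], [8, 11]]) (.split 925 (.save (.split
  3031 (.propagate (.save (.split 4067 (.propagate (.save (.split 3767 (.propagate (.save (.split
  1004 (.propagate (.propagate (.propagate (.propagate (.save (.split 3861 (.propagate
  (.propagate (.propagate (.ref 4 [[1, 6, 9, 7, 4, 8, 2, 11, 5, 3, 10]])))) (.split 3477
  (.propagate (.propagate (.propagate (.ref 2 [[0, 11, 5, 3, 10, 1, 4, 6], [8, 9]])))) (.fail
  3989)))))))) (.split 1016 (.propagate (.propagate (.propagate (.propagate (.save (.split 3861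
  (.propagate (.propagate (.propagate (.ref 4 [[0, 2, 1, 4, 7, 8], [3, 5, 11, 10, 9, 6]]))))
  (.split 3477 (.propagate (.propagate (.propagate (.ref 9 [[1, 11, 3, 6, 7], [4, 9, 8, 5,
  10]])))) (.fail 3989)))))))) (.fail 1020))))) (.split 3829 (.propagate (.save (.split 942
  (.propagate (.propagate (.propagate (.propagate (.save (.split 3859 (.propagate (.propagate
  (.propagate (.ref 2 [[0, 11, 5, 2, 1, 8, 9, 6, 3, 10], [4, 7]])))) (.split 3475 (.propagate
  (.propagate (.propagate (.ref 4 [[1, 3, 10, 6, 4], [2, 7, 11, 5, 8]])))) (.fail 3987))))))))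
  (.split 954 (.propagate (.propagate (.propagate (.propagate (.save (.split 3847 (.propagate
  (.propagate (.propagate (.ref 9 [[2, 10], [3, 6, 4, 8, 5, 7, 9, 11]])))) (.split 3463
  (.propagate (.propagate (.propagate (.ref 4 [[0, 2, 8], [1, 9], [3, 5, 4, 11, 10, 7]]))))
  (.fail 3975)))))))) (.fail 958))))) (.split 3830 (.propagate (.propagate (.save (.split 3881
  (.propagate (.fail 2473)) (.split 3361 (.propagate (.propagate (.ref 44 [[2, 8, 3, 7], [4, 6,
  11, 9]]))) (.split 1825 (.propagate (.fail 2857)) (.fail 3873))))))) (.fail 3831)))))) (.split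
  3907 (.propagate (.save (.split 3607 (.propagate (.save (.split 844 (.propagate (.propagate
  (.propagate (.propagate (.save (.split 4021 (.propagate (.propagate (.propagate (.ref 4 [[2, 4,
  3, 10, 8], [5, 6, 7, 9, 11]])))) (.split 3477 (.propagate (.propagate (.propagate (.ref 36 [[0,
  1, 4, 10, 5, 11], [2, 6, 9], [7, 8]])))) (.fail 3989)))))))) (.split 856 (.propagate
  (.propagate (.propagate (.propagate (.save (.split 4021 (.propagate (.propagate (.propagate
  (.ref 4 [[1, 8, 2, 9, 4, 6, 11, 5], [3, 10]])))) (.split 3477 (.propagate (.propagate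
  (.propagate (.ref 2 [[1, 8, 6, 3, 10, 11, 5, 7], [2, 4]])))) (.fail 3989)))))))) (.fail
  860))))) (.split 3669 (.propagate (.save (.split 782 (.propagate (.propagate (.propagate
  (.propagate (.save (.split 4019 (.propagate (.propagate (.propagate (.ref 36 [[0, 7, 1, 10, 6,
  8, 11, 3], [2, 9, 5, 4]])))) (.split 3475 (.propagate (.propagate (.propagate (.ref 4 [[0, 2,
  6, 8], [1, 11, 10, 4, 9, 3, 5, 7]])))) (.fail 3987)))))))) (.split 794 (.propagate (.propagate
  (.propagate (.propagate (.save (.split 4007 (.propagate (.propagate (.propagate (.ref 2 [[0, 6,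
  8], [1, 3, 5], [9, 11, 10]])))) (.split 3463 (.propagate (.propagate (.propagate (.ref 4 [[0,
  2, 3, 5, 9, 8], [1, 7, 6], [10, 11]])))) (.fail 3975)))))))) (.fail 798))))) (.split 3670
  (.propagate (.propagate (.ref 31 [[0, 8, 3, 2, 5, 11, 4, 10, 7, 9, 1]]))) (.fail 3671))))))
  (.split 3523 (.propagate (.save (.split 4021 (.propagate (.save (.split 4011 (.propagate
  (.propagate (.propagate (.propagate (.save (.split 2677 (.propagate (.propagate (.propagate
  (.ref 2 [[0, 6, 9, 8, 2, 5, 3, 4, 10, 1, 11]])))) (.split 2932 (.propagate (.propagate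
  (.propagate (.ref 9 [[1, 7, 5, 11, 2, 3, 8, 4, 6, 10, 9]])))) (.fail 2933)))))))) (.split 1955
  (.propagate (.propagate (.propagate (.propagate (.save (.split 2677 (.propagate (.propagate
  (.propagate (.ref 2 [[0, 7, 4, 10], [1, 11, 3, 8], [2, 5], [6, 9]])))) (.split 2932 (.propagate
  (.propagate (.propagate (.ref 9 [[1, 8, 2, 6, 4, 3, 9, 7], [5, 11]])))) (.fail 2933))))))))
  (.fail 4003))))) (.split 3861 (.propagate (.save (.split 3851 (.propagate (.propagate
  (.propagate (.propagate (.save (.split 2677 (.propagate (.propagate (.propagate (.ref 36 [[0,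
  4], [1, 6, 5, 2, 3, 10, 7, 9, 11, 8]])))) (.split 2932 (.propagate (.propagate (.propagate
  (.ref 2 [[0, 7, 6, 1, 8, 3], [2, 10, 9, 11, 4, 5]])))) (.fail 2933)))))))) (.split 1795
  (.propagate (.propagate (.propagate (.propagate (.save (.split 2677 (.propagate (.propagate
  (.propagate (.ref 36 [[0, 1, 5, 9, 7, 2], [3, 8, 4], [10, 11]])))) (.split 2932 (.propagate
  (.propagate (.propagate (.ref 2 [[0, 4, 5, 1, 6], [2, 10, 9, 11, 8]])))) (.fail 2933))))))))
  (.fail 3843))))) (.split 3477 (.propagate (.propagate (.save (.split 3306 (.propagate (.fail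
  2666)) (.split 3146 (.propagate (.fail 2666)) (.split 1226 (.propagate (.propagate (.save
  (.split 3243 (.save (.split 3086 (.propagate (.fail 3237)) (.split 3470 (.propagate (.fail
  3237)) (.fail 3214)))) (.split 3246 (.save (.split 3277 (.propagate (.fail 3235)) (.split 3085
  (.propagate (.fail 3235)) (.fail 3213)))) (.split 3258 (.ref 92 [[0, 4, 3, 1], [2, 11, 6, 8]])
  (.split 3498 (.ref 93 [[0, 4], [1, 5], [2, 8], [6, 7]]) (.fail 3242)))))))) (.fail 3274)))))))
  (.fail 3989)))))) (.fail 4035)))))) (.split 727 (.propagate (.ref 97 [[1, 2], [4, 6], [7, 9],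
  [8, 11]])) (.split 982 (.propagate (.save (.split 2018 (.propagate (.save (.split 3819
  (.propagate (.propagate (.save (.split 2134 (.propagate (.propagate (.save (.split 1413 (.save
  (.split 997 (.propagate (.fail 2525)) (.split 837 (.propagate (.fail 4061)) (.fail 965))))
  (.split 1414 (.ref 98 [[0, 6, 7, 4, 3, 1, 9, 2], [8, 11]]) (.split 1420 (.save (.split 1004
  (.propagate (.fail 2525)) (.split 844 (.propagate (.fail 4061)) (.fail 972)))) (.split 1476
  (.save (.split 1004 (.propagate (.fail 2526)) (.split 844 (.propagate (.fail 4062)) (.fail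
  972)))) (.fail 1412)))))))) (.split 2162 (.propagate (.fail 2806)) (.split 3154 (.propagate
  (.fail 2806)) (.fail 2130))))))) (.split 1707 (.propagate (.save (.split 3815 (.propagate
  (.propagate (.propagate (.propagate (.save (.split 3512 (.propagate (.propagate (.propagate
  (.ref 36 [[0, 1, 9, 2, 10], [3, 8, 6, 11, 5]])))) (.split 1208 (.propagate (.propagate
  (.propagate (.ref 2 [[1, 9, 11, 8], [2, 3, 7, 6]])))) (.fail 3256)))))))) (.split 3822
  (.propagate (.propagate (.propagate (.propagate (.ref 103 [[1, 6], [2, 4], [5, 10], [8,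
  11]]))))) (.fail 3823))))) (.split 1769 (.propagate (.ref 104 [[0, 3], [5, 10], [7, 9], [8,
  11]])) (.fail 1771)))))) (.split 1858 (.propagate (.ref 68 [[0, 5, 2, 7, 1, 3, 9, 4, 10, 11,
  6]])) (.split 1474 (.propagate (.ref 68 [[0, 5, 11, 8, 6, 3, 9, 4, 7, 1], [2, 10]])) (.fail
  1986)))))) (.fail 983))))) (.split 981 (.ref 70 [[0, 6, 8, 3, 2, 11], [1, 4], [7, 9, 10]])
  (.split 988 (.ref 70 [[0, 2, 11, 3, 6, 8], [1, 4], [5, 7, 10]]) (.fail 989))))))) (.split 974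
  (.ref 108 [[0, 10, 7, 4, 2], [1, 8, 6, 11, 3]]) (.split 986 (.ref 108 [[0, 10, 9, 4, 6, 8, 11,
  1], [2, 7]]) (.split 1002 (.ref 108 [[0, 10, 5, 6, 3, 11, 8, 1], [2, 7, 9, 4]]) (.split 842
  (.ref 108 [[0, 10, 2, 7, 6, 1], [3, 8], [4, 5, 9]]) (.split 458 (.save (.split 3560 (.save
  (.split 1770 (.propagate (.ref 106 [[0, 5, 11, 3, 1], [2, 9, 4, 10, 8]])) (.split 1194
  (.propagate (.save (.split 3113 (.propagate (.save (.split 3068 (.propagate (.save (.split 220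
  (.propagate (.propagate (.propagate (.propagate (.save (.split 3830 (.propagate (.save (.split
  182 (.propagate (.save (.split 1252 (.propagate (.propagate (.propagate (.save (.split 2475
  (.propagate (.propagate (.ref 17 [[2, 7, 9, 3], [5, 6, 11, 8]]))) (.split 2346 (.propagate
  (.propagate (.ref 61 [[2, 3], [4, 7, 11, 5, 6, 8, 9, 10]]))) (.fail 2347))))))) (.split 1264
  (.propagate (.propagate (.propagate (.save (.split 2475 (.propagate (.propagate (.ref 61 [[0,
  3, 2, 1], [5, 11, 10, 9]]))) (.split 2346 (.propagate (.propagate (.leaf 7 []))) (.fail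
  2347))))))) (.fail 1268))))) (.split 1174 (.fail 3221) (.fail 150))))) (.split 4022 (.fail
  2967) (.fail 4086)))))))) (.split 412 (.propagate (.propagate (.propagate (.propagate (.save
  (.split 2861 (.propagate (.propagate (.propagate (.ref 109 [[2, 8, 4, 6], [3, 9, 5, 10]]))))
  (.split 2873 (.propagate (.propagate (.propagate (.ref 109 [[1, 2], [3, 10], [4, 11], [6,
  8]])))) (.fail 2877)))))))) (.fail 476))))) (.split 4060 (.propagate (.save (.split 242
  (.propagate (.propagate (.propagate (.propagate (.save (.split 4081 (.propagate (.propagate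
  (.propagate (.ref 18 [[1, 3, 4, 5, 8, 10], [2, 11, 6], [7, 9]])))) (.split 3952 (.propagate
  (.propagate (.propagate (.ref 109 [[0, 1], [2, 11, 7, 8, 10, 9, 4, 6, 5, 3]])))) (.fail
  4080)))))))) (.split 434 (.propagate (.propagate (.propagate (.propagate (.ref 117 [[1, 11],
  [2, 4], [3, 10], [5, 9]]))))) (.fail 498))))) (.split 4084 (.propagate (.propagate (.save
  (.split 2063 (.propagate (.fail 2203)) (.split 2077 (.propagate (.propagate (.ref 101 [[2, 7,
  3, 8], [4, 9, 11, 6]]))) (.split 13 (.propagate (.fail 2719)) (.fail 2061))))))) (.fail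
  4092)))))) (.split 3116 (.propagate (.save (.split 3065 (.propagate (.save (.split 217
  (.propagate (.propagate (.propagate (.propagate (.ref 65 [[0, 3, 8, 11, 4], [2, 7, 10, 9,
  6]]))))) (.split 409 (.propagate (.propagate (.propagate (.propagate (.ref 59 [[2, 10, 9, 8],
  [3, 6, 11, 4]]))))) (.fail 473))))) (.split 4057 (.propagate (.ref 121 [[0, 4], [2, 7], [3, 9],
  [6, 8]])) (.split 4081 (.propagate (.propagate (.ref 119 [[3, 9], [4, 7], [5, 6], [8, 10]])))
  (.fail 4089)))))) (.split 3128 (.propagate (.ref 122 [[2, 4], [3, 5], [6, 8], [9, 10]])) (.fail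
  3112)))))) (.split 1250 (.propagate (.ref 106 [[0, 5], [1, 8, 4, 10, 3, 2, 9, 6]])) (.fail
  1258))))) (.split 2024 (.save (.split 985 (.propagate (.ref 69 [[0, 9, 7, 2, 4, 5, 11, 3, 8,
  6], [1, 10]])) (.split 988 (.propagate (.ref 69 [[0, 9, 10, 11, 8, 6], [1, 7, 5], [2, 4]]))
  (.split 856 (.propagate (.save (.split 2447 (.propagate (.save (.split 3997 (.propagate (.save
  (.split 4058 (.propagate (.propagate (.propagate (.propagate (.save (.split 3667 (.propagate
  (.propagate (.propagate (.ref 36 [[0, 7, 8, 3], [1, 10, 4, 11, 2, 6, 5, 9]])))) (.split 3670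
  (.propagate (.propagate (.propagate (.ref 2 [[0, 6, 8, 5, 3, 10, 7, 4], [1, 9, 2, 11]]))))
  (.fail 3666)))))))) (.split 3544 (.propagate (.propagate (.propagate (.propagate (.ref 125 [[0,
  2], [1, 9], [4, 10], [5, 7]]))))) (.fail 4056))))) (.split 4013 (.propagate (.propagate (.save
  (.split 2490 (.propagate (.fail 2842)) (.split 2346 (.propagate (.fail 3002)) (.split 3498
  (.propagate (.propagate (.ref 44 [[0, 10, 8, 3], [1, 2, 5, 6, 9, 4, 11, 7]]))) (.fail
  2474))))))) (.split 3853 (.propagate (.save (.split 4014 (.propagate (.propagate (.propagate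
  (.propagate (.ref 57 [[0, 6, 10, 11, 7, 1, 5, 4, 2, 8, 3]]))))) (.split 3500 (.propagate
  (.propagate (.propagate (.propagate (.ref 56 [[0, 6, 10, 11, 7, 1, 5, 4, 2, 8, 3]]))))) (.fail
  4012))))) (.fail 3981)))))) (.split 143 (.propagate (.ref 122 [[0, 1, 6, 5, 7], [2, 11, 9, 8,
  10]])) (.split 391 (.propagate (.ref 129 [[1, 9], [4, 5], [6, 8], [7, 10]])) (.fail 399))))))
  (.fail 984))))) (.split 1256 (.ref 131 [[0, 4], [3, 6], [5, 10], [8, 9]]) (.split 1448 (.ref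
  131 [[2, 7], [3, 8], [5, 10], [6, 9]]) (.split 1504 (.ref 131 [[0, 4], [2, 7], [3, 9], [6, 8]])
  (.fail 1512))))))) (.split 1994 (.ref 108 [[0, 10, 6, 11, 3, 1], [2, 7, 5], [4, 9]]) (.fail
  970))))))))

/-- The permutation `s` maps `wittMask` to `wittFst n` and `K` into `wittSnd n` or, if `n` is at
least 7, the mask `K` is contained in `wittMask`. -/
def isWittLeaf (n : ℕ) (s : List (List (Fin 12))) (K : ℕ) : Bool :=
  cond (Nat.blt n 7)
    (and (Nat.beq (permMask s wittMask) (wittFst n))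
      (force (permMask s K) fun K' => Nat.beq (Nat.land K' (wittSnd n)) K'))
    (Nat.beq (Nat.land K wittMask) K)

/-- Symmetries now have to fix `wittMask`, so that they act on pairs whose first member is this
system. The leaves numbered 0 to 6 recognize the second member up to a permutation of the pair, and
leaf 7 is the case of equal systems. -/
theorem pairTree_check :
    (pairTree.check wittMask isWittLeaf [] sixMask sixMask).isSome = true := by
  decide +kernel

theorem equivalent_image (g : Equiv.Perm (Fin 12)) (S T : Set (Word 12)) :
    Equivalent (S, T) (permute g '' S, permute g '' T) :=
  ⟨permuteIso g, .inl ⟨permuteIso_image_evenPart g S, permuteIso_image_evenPart g T⟩⟩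

theorem equivalent_image_sdiff (g : Equiv.Perm (Fin 12)) (V W : Set (Word 12)) :
    Equivalent (V \ W, W \ V)
      (permute g '' V \ permute g '' W, permute g '' W \ permute g '' V) := by
  have := equivalent_image g (V \ W) (W \ V)
  rwa [Set.image_sdiff (permute_injective g), Set.image_sdiff (permute_injective g)] at this

theorem IsSteinerSystem.eq_or_equivalent {W : Set (Word 12)} (hW : IsSteinerSystem 6 12 W) :
    W = toSet wittMask ∨ ∃ i ∈ wittNames,
      Equivalent (toSet wittMask \ W, W \ toSet wittMask) (trade i) := by
  refine SearchTree.goal_of_check (goal := fun W => W = toSet wittMask ∨ ∃ i ∈ wittNames,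
      Equivalent (toSet wittMask \ W, W \ toSet wittMask) (trade i)) ?_ ?_ pairTree_check hW
  · rintro g W hg (h | ⟨i, hi, h⟩)
    · exact .inl ((permute_injective g).image_injective (h.trans hg.symm))
    · refine .inr ⟨i, hi, Equivalent.trans ?_ h⟩
      have := equivalent_image_sdiff g (toSet wittMask) W
      rwa [hg] at this
  · intro n s K h W hW hWK
    rw [isWittLeaf] at h
    cases hn : Nat.blt n 7 <;> rw [hn] at h
    · rw [cond_false, Nat.beq_eq] at h
      exact .inl (isSteinerSystem_wittMask.eq_of_subset hW (hWK.trans (toSet_subset_of_and_eq h)))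
    · simp only [cond_true, force_eq, Bool.and_eq_true, Nat.beq_eq] at h
      obtain ⟨h1, h2⟩ := h
      rw [Nat.blt_eq] at hn
      refine .inr ⟨wittName n, wittName_mem_wittNames n, ?_⟩
      have e1 : permute (cycles s) '' toSet wittMask = toSet (wittFst n) := by
        rw [← toSet_permMask, h1]
      have e2 : permute (cycles s) '' W = toSet (wittSnd n) := by
        refine (isSteinerSystem_wittSnd hn).eq_of_subset (hW.image _) ?_
        refine (Set.image_mono hWK).trans ?_
        rw [← toSet_permMask]
        exact toSet_subset_of_and_eq h2
      rw [trade_wittName hn, ← e1, ← e2]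
      exact equivalent_image_sdiff _ _ _

theorem IsWittDifference.exists_equivalent {T : Set (Word 12) × Set (Word 12)}
    (hT : IsWittDifference T) : ∃ i ∈ wittNames, Equivalent T (trade i) := by
  obtain ⟨V, W, hV, hW, hne, rfl⟩ := hT
  obtain ⟨g, hg⟩ := hV.exists_image_eq
  have h := equivalent_image_sdiff g V W
  rw [hg] at h
  rcases (hW.image g).eq_or_equivalent with h' | ⟨i, hi, h'⟩
  · exact absurd ((permute_injective g).image_injective (hg.trans h'.symm)) hne
  · exact ⟨i, hi, h.trans h'⟩

/-- The classification provides one of the seven, and nonequivalence of the 25 trades excludes the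
other names. -/
theorem exists_isWittDifference_iff (i : TradeName) :
    (∃ T, IsWittDifference T ∧ Equivalent T (trade i)) ↔ i ∈ wittNames := by
  constructor
  · rintro ⟨T, hT, h⟩
    obtain ⟨j, hj, h'⟩ := hT.exists_equivalent
    rwa [eq_of_equivalent (h.symm.trans h')]
  · intro hi
    obtain ⟨n, hn, rfl⟩ := exists_wittName_eq hi
    exact ⟨_, isWittDifference_wittName hn, RelIso.refl _, .inl ⟨Set.image_id _, Set.image_id _⟩⟩

/-! ### Counting -/

section Counting

open Classical

theorem degree_eq_sum (U : Set (Word 12)) (y : Word 12) :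
    degree U y = ∑ i, if flipWord i y ∈ U then 1 else 0 := by
  rw [degree, ← Finset.card_filter, ← Set.ncard_coe_finset, Finset.coe_filter]
  simp

/-- The number of pairs of a word in `T` and a word in `U` that differ in one position. -/
theorem sum_degree_comm (T U : Set (Word 12)) :
    ∑ y with y ∈ T, degree U y = ∑ x with x ∈ U, degree T x := by
  have key : ∀ A B : Set (Word 12), ∑ y with y ∈ A, degree B y =
      ∑ i, ∑ y, if y ∈ A ∧ flipWord i y ∈ B then 1 else 0 := by
    intro A B
    rw [Finset.sum_comm, Finset.sum_filter]
    refine Finset.sum_congr rfl fun y _ => ?_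
    by_cases hy : y ∈ A
    · simp [hy, degree_eq_sum]
    · simp [hy]
  rw [key, key]
  refine Finset.sum_congr rfl fun i _ => ?_
  -- For a fixed position, changing its symbol is an involution that exchanges the two ends of a
  -- counted pair.
  refine Finset.sum_bij' (fun y _ => flipWord i y) (fun y _ => flipWord i y)
    (fun _ _ => Finset.mem_univ _) (fun _ _ => Finset.mem_univ _)
    (fun y _ => flipWord_flipWord i y) (fun y _ => flipWord_flipWord i y) fun y _ => ?_
  simp only [flipWord_flipWord, and_comm]

/-- The mask of the elements of `B` such that changing one of the first `k` digits yields an element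
of `M` in exactly `m` cases. -/
def exactMask (B M : ℕ) : ℕ → ℕ → ℕ
  | 0, 0 => B
  | 0, _ + 1 => 0
  | k + 1, 0 => sdiffMask (exactMask B M k 0) (flipMask k M)
  | k + 1, m + 1 => Nat.lor (sdiffMask (exactMask B M k (m + 1)) (flipMask k M))
      (Nat.land (exactMask B M k m) (flipMask k M))

theorem testBit_exactMask {B M : ℕ} {w : Word 12} (k : ℕ) (hk : k ≤ 12) : ∀ m : ℕ,
    (exactMask B M k m).testBit (code w) = true ↔ B.testBit (code w) = true ∧
      ∑ i ∈ Finset.range k, (M.testBit (code w ^^^ 2 ^ i)).toNat = m := by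
  induction k with
  | zero =>
    rintro (_ | m)
    · simp [exactMask]
    · simp [exactMask]
  | succ k ih =>
    have hf := testBit_flipMask (show k < 12 by omega) (code_lt w) M
    rintro (_ | m)
    · rw [exactMask, testBit_sdiffMask, Bool.and_eq_true, ih (by omega), Finset.sum_range_succ, hf]
      cases M.testBit (code w ^^^ 2 ^ k) <;> simp
    · have e : exactMask B M (k + 1) (m + 1) =
        sdiffMask (exactMask B M k (m + 1)) (flipMask k M) |||
        exactMask B M k m &&& flipMask k M := rfl
      rw [e, Nat.testBit_or, Nat.testBit_and, testBit_sdiffMask, Bool.or_eq_true, Bool.and_eq_true,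
        Bool.and_eq_true, ih (by omega), ih (by omega), Finset.sum_range_succ, hf]
      cases M.testBit (code w ^^^ 2 ^ k) <;> simp

theorem mem_toSet_exactMask {B M m : ℕ} {w : Word 12} :
    w ∈ toSet (exactMask B M 12 m) ↔ w ∈ toSet B ∧ degree (toSet M) w = m := by
  rw [mem_toSet, testBit_exactMask 12 le_rfl, degree_eq_sum, Finset.sum_range]
  refine and_congr Iff.rfl (Eq.congr_left (Finset.sum_congr rfl fun i _ => ?_))
  rw [mem_toSet, code_flipWord]
  cases M.testBit (code w ^^^ 2 ^ i.1) <;> simp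

/-- The words of weight 6 in the disjoint masks `V` and `V'` have `a` and `b` neighbours in `U`, and
the other words of weight 6 have none. -/
def profileCheck (U V V' a b : ℕ) : Bool :=
  force U fun U => force V fun V => force V' fun V' =>
    and (Nat.beq (Nat.land V V') 0) (and (Nat.beq (exactMask V U 12 a) V)
      (and (Nat.beq (exactMask V' U 12 b) V')
        (Nat.beq (Nat.land (sdiffMask (sdiffMask sixMask V) V') (nbrs U)) 0)))

theorem sum_degree_of_profileCheck {U V V' a b : ℕ} (h : profileCheck U V V' a b = true)
    {t : Finset (Word 12)} (ht : ∀ w ∈ t, hammingNorm w = 6) :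
    ∑ y ∈ t, degree (toSet U) y =
      a * (t.filter (· ∈ toSet V)).card + b * (t.filter (· ∈ toSet V')).card := by
  simp only [profileCheck, force_eq, Bool.and_eq_true, Nat.beq_eq] at h
  obtain ⟨h1, h2, h3, h4⟩ := h
  rw [Finset.card_filter, Finset.card_filter, Finset.mul_sum, Finset.mul_sum,
    ← Finset.sum_add_distrib]
  refine Finset.sum_congr rfl fun y hy => ?_
  have e1 : toSet V ∩ toSet V' = ∅ := by rw [← toSet_and, ← toSet_zero, ← h1]; rfl
  by_cases hV : y ∈ toSet V
  · have hV' : y ∉ toSet V' := fun h => (e1 ▸ (⟨hV, h⟩ : y ∈ toSet V ∩ toSet V') : y ∈ (∅ : Set _))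
    have := hV
    rw [← h2, mem_toSet_exactMask] at this
    simp [hV, hV', this.2]
  · by_cases hV' : y ∈ toSet V'
    · have := hV'
      rw [← h3, mem_toSet_exactMask] at this
      simp [hV, hV', this.2]
    · have e2 : toSet (sdiffMask (sdiffMask sixMask V) V') ∩ toSet (nbrs U) = ∅ := by
        rw [← toSet_and, ← toSet_zero, ← h4]; rfl
      rw [toSet_sdiff, toSet_sdiff] at e2
      have : ¬ 0 < degree (toSet U) y := fun h0 =>
        (e2 ▸ (⟨⟨⟨mem_toSet_sixMask.2 (ht y hy), hV⟩, hV'⟩, degree_toSet_pos_iff.1 h0⟩ :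
          y ∈ (toSet sixMask \ toSet V) \ toSet V' ∩ toSet (nbrs U)) : y ∈ (∅ : Set _))
      simp [hV, hV', Nat.eq_zero_of_not_pos this]

end Counting

/-! ### Trades contained in a Steiner system -/

/-- A block of the Steiner system with mask `wittMask`. -/
def wittBlock : Word 12 := ![0, 0, 0, 0, 0, 1, 0, 1, 1, 1, 1, 1]

/-- The complement of `wittBlock`. -/
def coBlock : Word 12 := ![1, 1, 1, 1, 1, 0, 1, 0, 0, 0, 0, 0]

/-- The mask of the words at distance `d` from `wittBlock`. -/
def sphereMask : ℕ → ℕ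
  | 0 => Nat.shiftLeft 1 (code wittBlock)
  | 1 => nbrs (Nat.shiftLeft 1 (code wittBlock))
  | d + 2 => sdiffMask (nbrs (sphereMask (d + 1))) (sphereMask d)

/-- The mask of the words in the Steiner system at distance `d` from `wittBlock`. -/
def wittSphere (d : ℕ) : ℕ := Nat.land wittMask (sphereMask d)

/-- The mask of the words of weight 6 at distance `d` from `wittBlock`. -/
def sixSphere (d : ℕ) : ℕ := Nat.land sixMask (sphereMask d)

/-- The mask of the words of weight 5 at distance `d` from `wittBlock`. -/
def fiveSphere (d : ℕ) : ℕ := Nat.land (levelMask 12 5) (sphereMask d)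

/-- A word `c` of weight 5 at distance `11 - 2m` from `wittBlock` shares `m` ones with it. Adding a
one gives a word of weight 6 that shares `m` or `m + 1` ones. Conversely such words have `6 - m` and
`m + 1` neighbours of this kind. The lines are `m = 0, …, 5`. -/
theorem profileChecks :
    and (profileCheck (fiveSphere 11) (sixSphere 12) (sixSphere 10) 6 1)
      (and (profileCheck (fiveSphere 9) (sixSphere 10) (sixSphere 8) 5 2)
      (and (profileCheck (fiveSphere 7) (sixSphere 8) (sixSphere 6) 4 3)
      (and (profileCheck (fiveSphere 5) (sixSphere 6) (sixSphere 4) 3 4)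
      (and (profileCheck (fiveSphere 3) (sixSphere 4) (sixSphere 2) 2 5)
      (profileCheck (fiveSphere 1) (sixSphere 2) (sixSphere 0) 1 6))))) = true := by
  decide +kernel

/-- For all injective maps from `is` to `bs`, the union of `acc` and the sets of the elements of `D`
at distance at most two from `X`, with the digits in `is` and their images changed, has at least 25
elements. -/
def spreadCheck (D X : ℕ) : List (Fin 12) → List (Fin 12) → ℕ → Bool
  | [], _, acc => Nat.ble 25 (maskCard acc)
  | i :: is, bs, acc => bs.all fun b =>
      force b.1 fun n =>
        force (Nat.lor acc (Nat.land D (nbrs (nbrs (flipMask n (flipMask i.1 X)))))) fun acc' =>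
          spreadCheck D X is (bs.erase b) acc'

/-- Runs through all 720 bijections from the ones of `wittBlock` to its zeros. -/
theorem spreadCheck_wittBlock : spreadCheck (wittSphere 4) (Nat.shiftLeft 1 (code wittBlock))
    [5, 7, 8, 9, 10, 11] [0, 1, 2, 3, 4, 6] 0 = true := by
  decide +kernel

/-- Distance 8 from `wittBlock` is distance 4 from its complement. -/
theorem spreadCheck_coBlock : spreadCheck (wittSphere 8) (Nat.shiftLeft 1 (code coBlock))
    [0, 1, 2, 3, 4, 6] [5, 7, 8, 9, 10, 11] 0 = true := by
  decide +kernel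

/-- The facts about the Steiner system with mask `wittMask` that are needed for the lower bound. -/
def sphereCheck : Bool :=
  force (wittSphere 6) fun A₆ => force (wittSphere 4) fun A₄ => force (wittSphere 8) fun A₈ =>
  force (Nat.lor (sphereMask 0) (sphereMask 12)) fun X =>
  force (sdiffMask sixMask wittMask) fun Y =>
    and (Nat.beq (sixSphere 0) (Nat.shiftLeft 1 (code wittBlock)))
    (and (Nat.beq (sixSphere 12) (Nat.shiftLeft 1 (code coBlock)))
    (and (Nat.beq X (Nat.lor (Nat.shiftLeft 1 (code wittBlock)) (Nat.shiftLeft 1 (code coBlock))))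
    (and (Nat.beq (Nat.land X wittMask) X)
    (and (Nat.beq (Nat.land A₄ A₆) 0) (and (Nat.beq (Nat.land A₈ A₆) 0)
    (and (Nat.beq (Nat.land A₄ A₈) 0) (and (Nat.beq (Nat.land X (Nat.lor A₄ (Nat.lor A₆ A₈))) 0)
    (Nat.beq (Nat.lor (exactMask (exactMask Y (nbrs A₆) 12 4) (nbrs X) 12 0)
      (exactMask (exactMask Y (nbrs A₆) 12 0) (nbrs X) 12 2)) Y))))))))

/-- The last clause drives the weighted count. Among the twelve neighbours of a nonblock of weight
6, either four are next to blocks at distance 6 and none is next to `wittBlock` or `coBlock`, or the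
numbers are zero and two. With weights 1 and 2 the total is always 4. -/
theorem sphereCheck_eq_true : sphereCheck = true := by decide +kernel

theorem IsConstantWeightTrade.image {T : Set (Word 12) × Set (Word 12)}
    (hT : IsConstantWeightTrade T) (g : Equiv.Perm (Fin 12)) :
    IsConstantWeightTrade (permute g '' T.1, permute g '' T.2) := by
  obtain ⟨h1, h2, h3, h4, h5, h6⟩ := isConstantWeightTrade_iff.1 hT
  refine isConstantWeightTrade_iff.2 ⟨?_, ?_, (Set.disjoint_image_iff (permute_injective g)).2 h3,
    h4.image _, h5.image _, fun c => ?_⟩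
  · rintro _ ⟨w, hw, rfl⟩
    rw [hammingNorm_permute, h1 w hw]
  · rintro _ ⟨w, hw, rfl⟩
    rw [hammingNorm_permute, h2 w hw]
  · rw [← permute_permute_inv g c, degree_permute, degree_permute]
    exact h6 _

/-- The check tries every injective assignment of images, in particular the one given by `β`. Along
that branch all collected words are in `S`. -/
theorem spreadCheck_spec {D : ℕ} {x : Word 12} {S : Set (Word 12)} {β : Fin 12 → Fin 12}
    (is : List (Fin 12)) : ∀ {bs : List (Fin 12)} {acc : ℕ},
      spreadCheck D (1 <<< code x) is bs acc = true → is.Nodup → (∀ i ∈ is, β i ∈ bs) →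
      (∀ i ∈ is, ∀ j ∈ is, β i = β j → i = j) → toSet acc ⊆ S →
      (∀ i ∈ is, ∀ z ∈ toSet D, ∀ j k,
        flipWord j (flipWord k z) = flipWord (β i) (flipWord i x) → z ∈ S) → 25 ≤ S.ncard := by
  induction is with
  | nil =>
    intro bs acc h _ _ _ hacc _
    rw [spreadCheck, Nat.ble_eq, ← ncard_toSet] at h
    exact h.trans (Set.ncard_le_ncard hacc (Set.toFinite _))
  | cons i is ih =>
    intro bs acc h hnd hbs hinj hacc hS
    rw [spreadCheck, List.all_eq_true] at h
    have h' := h (β i) (hbs i List.mem_cons_self)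
    rw [force_eq, force_eq] at h'
    have hi := (List.nodup_cons.1 hnd).1
    refine ih h' (List.nodup_cons.1 hnd).2 (fun j hj => ?_)
      (fun j hj k hk => hinj j (List.mem_cons_of_mem _ hj) k (List.mem_cons_of_mem _ hk)) ?_
      (fun j hj => hS j (List.mem_cons_of_mem _ hj))
    · refine (List.mem_erase_of_ne fun e => hi ?_).2 (hbs j (List.mem_cons_of_mem _ hj))
      rw [← hinj j (List.mem_cons_of_mem _ hj) i List.mem_cons_self e]
      exact hj
    · have e : Nat.lor acc (Nat.land D (nbrs (nbrs (flipMask (β i).1 (flipMask i.1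
          (1 <<< code x)))))) = acc ||| (D &&& nbrs (nbrs (flipMask (β i).1 (flipMask i.1
          (1 <<< code x))))) := rfl
      rw [e, toSet_or, toSet_and]
      refine Set.union_subset hacc ?_
      rintro z ⟨hz, hz'⟩
      obtain ⟨k, hk⟩ := mem_toSet_nbrs.1 hz'
      obtain ⟨j, hj⟩ := mem_toSet_nbrs.1 hk
      rw [mem_toSet_flipMask, mem_toSet_flipMask, toSet_single, Set.mem_singleton_iff] at hj
      refine hS i List.mem_cons_self z hz j k ?_
      rw [← hj, flipWord_flipWord, flipWord_flipWord]

/-- The components of a trade contained in a Steiner system: all blocks adjacent to a word of the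
second component belong to the first one. -/
theorem mem_fst_of_flipWord {W : Set (Word 12)} (hW : IsSteinerSystem 6 12 W)
    {T : Set (Word 12) × Set (Word 12)} (hT : IsConstantWeightTrade T) (hTW : T.1 ⊆ W)
    {c : Word 12} {i j : Fin 12} (hi : flipWord i c ∈ T.2) (hj : flipWord j c ∈ W) :
    flipWord j c ∈ T.1 := by
  have h := ((isConstantWeightTrade_iff.1 hT).2.2.2.2.2 c).1
  obtain ⟨k, hk⟩ := degree_pos_iff.1 (h ▸ degree_pos_iff.2 ⟨i, hi⟩)
  rwa [hW.eq_of_mem hj (hTW hk)]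

/-- For every one `i` of `x`, balance at `flipWord i x` gives a word of `T.2` obtained by also
changing a position `β i`. This is a zero of `x` because weights are 6 and `x ∉ T.2`. The map `β` is
injective since `flipWord (β i) x` has at most one neighbour in `T.2`. All blocks adjacent to these
words are in `T.1`, and `spreadCheck` bounds their number within `D` for every such `β`. -/
theorem le_ncard_of_spreadCheck {W : Set (Word 12)} (hW : IsSteinerSystem 6 12 W)
    {T : Set (Word 12) × Set (Word 12)} (hT : IsConstantWeightTrade T) (hTW : T.1 ⊆ W)
    {x : Word 12} (hx : x ∈ T.1) {D : ℕ} (hD : toSet D ⊆ W) {is bs : List (Fin 12)}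
    (his : is.Nodup) (hxi : ∀ i ∈ is, x i = 1) (hbs : ∀ j, x j = 0 → j ∈ bs)
    (h : spreadCheck D (1 <<< code x) is bs 0 = true) : 25 ≤ (T.1 ∩ toSet D).ncard := by
  obtain ⟨h1, h2, h3, -, -, h6⟩ := isConstantWeightTrade_iff.1 hT
  have hex : ∀ i, ∃ j, flipWord j (flipWord i x) ∈ T.2 := fun i =>
    degree_pos_iff.1 ((h6 _).1 ▸ degree_pos_iff.2 ⟨i, by rwa [flipWord_flipWord]⟩)
  choose β hβ using hex
  have hne : ∀ i, β i ≠ i := fun i hi => by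
    have := hβ i
    rw [hi, flipWord_flipWord] at this
    exact Set.disjoint_left.1 h3 hx this
  refine spreadCheck_spec (β := β) is h his (fun i hi => hbs _ ?_) (fun i _ j _ hij => ?_)
    (by rw [toSet_zero]; exact Set.empty_subset _) (fun i _ z hz j k e => ⟨?_, hz⟩)
  · refine (zmod_two_cases _).resolve_right fun hb => ?_
    have e1 := hammingNorm_flipWord_of_one (hxi i hi)
    have hb' : flipWord i x (β i) = 1 := by simp [flipWord, hne i, hb]
    have e2 := hammingNorm_flipWord_of_one hb'
    rw [h2 _ (hβ i)] at e2
    rw [h1 x hx] at e1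
    omega
  · have hi := hβ i
    have hj := hβ j
    rw [flipWord_comm] at hi hj
    rw [← hij] at hj
    exact degree_le_one_iff.1 ((h6 (flipWord (β i) x)).1 ▸ (h6 (flipWord (β i) x)).2) i j hi hj
  · have hz' : flipWord k (flipWord k z) ∈ W := by rw [flipWord_flipWord]; exact hD hz
    have := mem_fst_of_flipWord hW hT hTW (c := flipWord k z) (i := j) (by rw [e]; exact hβ i) hz'
    rwa [flipWord_flipWord] at this

theorem degree_nbrs_of_mem {M : ℕ} {y : Word 12} (hy : y ∈ toSet M) :
    degree (toSet (nbrs M)) y = 12 := by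
  have : {i : Fin 12 | flipWord i y ∈ toSet (nbrs M)} = Set.univ :=
    Set.eq_univ_of_forall fun i => mem_toSet_nbrs.2 ⟨i, by rwa [flipWord_flipWord]⟩
  rw [degree, this, Set.ncard_univ, Nat.card_eq_fintype_card, Fintype.card_fin]

/-- Different blocks of a system have no common neighbour. -/
theorem degree_nbrs_of_notMem {W : Set (Word 12)} (hW : IsSteinerSystem 6 12 W) {M : ℕ}
    (hM : toSet M ⊆ W) {y : Word 12} (hy : y ∈ W) (hy' : y ∉ toSet M) :
    degree (toSet (nbrs M)) y = 0 := by
  by_contra h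
  obtain ⟨i, hi⟩ := degree_pos_iff.1 (Nat.pos_of_ne_zero h)
  obtain ⟨j, hj⟩ := mem_toSet_nbrs.1 hi
  have e : flipWord i (flipWord i y) ∈ W := by rwa [flipWord_flipWord]
  rw [hW.eq_of_mem (hM hj) e, flipWord_flipWord] at hj
  exact hy' hj

section Counting

open Classical

theorem sum_degree_nbrs {W : Set (Word 12)} (hW : IsSteinerSystem 6 12 W) {M : ℕ}
    (hM : toSet M ⊆ W) {t : Finset (Word 12)} (ht : ∀ y ∈ t, y ∈ W) :
    ∑ y ∈ t, degree (toSet (nbrs M)) y = 12 * (t.filter (· ∈ toSet M)).card := by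
  rw [Finset.card_filter, Finset.mul_sum]
  refine Finset.sum_congr rfl fun y hy => ?_
  by_cases hyM : y ∈ toSet M
  · simp [degree_nbrs_of_mem hyM, hyM]
  · simp [degree_nbrs_of_notMem hW hM (ht y hy) hyM, hyM]

theorem toSet_wittSphere_subset (d : ℕ) : toSet (wittSphere d) ⊆ toSet wittMask := by
  have e : wittSphere d = wittMask &&& sphereMask d := rfl
  rw [e, toSet_and]
  exact Set.inter_subset_left

theorem card_filter_single (t : Finset (Word 12)) (x : Word 12) :
    (t.filter (· ∈ toSet (1 <<< code x))).card = if x ∈ t then 1 else 0 := by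
  simp only [toSet_single, Set.mem_singleton_iff]
  rw [Finset.filter_eq']
  split_ifs <;> simp

/-- A trade contained in a Steiner system contains at least 72 blocks of it. -/
theorem le_ncard_of_wittBlock_mem {T : Set (Word 12) × Set (Word 12)}
    (hT : IsConstantWeightTrade T) (hTW : T.1 ⊆ toSet wittMask) (hx : wittBlock ∈ T.1) :
    72 ≤ T.1.ncard := by
  have hW := isSteinerSystem_wittMask
  obtain ⟨h1, h2, h3, -, -, h6⟩ := isConstantWeightTrade_iff.1 hT
  have hc := sphereCheck_eq_true
  simp only [sphereCheck, force_eq, Bool.and_eq_true, Nat.beq_eq] at hc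
  obtain ⟨c1, c2, c3, c4, c5, c6, c7, c8, c9⟩ := hc
  obtain ⟨p1, p2, p3, p4, p5, p6⟩ : _ ∧ _ ∧ _ ∧ _ ∧ _ ∧ _ := by
    have := profileChecks
    simp only [Bool.and_eq_true] at this
    exact this
  set t : Finset (Word 12) := Finset.univ.filter (· ∈ T.1) with ht
  set u : Finset (Word 12) := Finset.univ.filter (· ∈ T.2) with hu
  have mt : ∀ y, y ∈ t ↔ y ∈ T.1 := fun y => by simp [ht]
  have mu : ∀ y, y ∈ u ↔ y ∈ T.2 := fun y => by simp [hu]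
  have hbal : ∀ U : Set (Word 12), ∑ y ∈ t, degree U y = ∑ y ∈ u, degree U y := fun U => by
    rw [ht, hu, sum_degree_comm T.1, sum_degree_comm T.2]
    exact Finset.sum_congr rfl fun x _ => (h6 x).1
  have hprofile : ∀ {U V V' a b : ℕ}, profileCheck U V V' a b = true →
      a * (t.filter (· ∈ toSet V)).card + b * (t.filter (· ∈ toSet V')).card =
      a * (u.filter (· ∈ toSet V)).card + b * (u.filter (· ∈ toSet V')).card := fun h => by
    rw [← sum_degree_of_profileCheck h fun w hw => h1 w ((mt w).1 hw),
      ← sum_degree_of_profileCheck h fun w hw => h2 w ((mu w).1 hw), hbal]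
  have hcard : ∀ M, (t.filter (· ∈ toSet M)).card = (T.1 ∩ toSet M).ncard := fun M => by
    rw [← Set.ncard_coe_finset]
    congr 1
    ext y
    simp [mt]
  have htn : t.card = T.1.ncard := by
    rw [← Set.ncard_coe_finset]
    congr 1
    ext y
    simp [mt]
  -- the complement of the block belongs to the trade
  have hco : coBlock ∈ T.1 := by
    have q1 := hprofile p1
    have q2 := hprofile p2
    have q3 := hprofile p3
    have q4 := hprofile p4
    have q5 := hprofile p5
    have q6 := hprofile p6
    have e0 : sixSphere 0 = 1 <<< code wittBlock := c1
    have e12 : sixSphere 12 = 1 <<< code coBlock := c2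
    rw [e0, card_filter_single, card_filter_single, if_pos ((mt _).2 hx),
      if_neg fun h => Set.disjoint_left.1 h3 hx ((mu _).1 h)] at q6
    rw [e12, card_filter_single, card_filter_single] at q1
    -- Let `δ d` be the number of words of `T.1` at distance `d` from `wittBlock` minus the number
    -- of those of `T.2`. The equations read `6 δ 12 + δ 10 = 0`, `5 δ 10 + 2 δ 8 = 0`, …, `δ 2 + 6
    -- δ 0 = 0`. Six sign changes give `δ 12 = δ 0 = 1`.
    by_contra hco
    rw [if_neg fun h => hco ((mt _).1 h)] at q1
    split_ifs at q1 <;> omega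
  have a4 : 25 ≤ (T.1 ∩ toSet (wittSphere 4)).ncard :=
    le_ncard_of_spreadCheck hW hT hTW hx (toSet_wittSphere_subset 4) (by decide) (by decide)
      (by decide) spreadCheck_wittBlock
  have a8 : 25 ≤ (T.1 ∩ toSet (wittSphere 8)).ncard :=
    le_ncard_of_spreadCheck hW hT hTW hco (toSet_wittSphere_subset 8) (by decide) (by decide)
      (by decide) spreadCheck_coBlock
  rw [← hcard] at a4 a8
  set X := Nat.lor (sphereMask 0) (sphereMask 12) with hX
  have hXW : toSet X ⊆ toSet wittMask := toSet_subset_of_and_eq c4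
  have hXx : ∀ y, y ∈ toSet X ↔ y = wittBlock ∨ y = coBlock := fun y => by
    rw [c3]
    have e : ∀ w : Word 12, toSet (Nat.shiftLeft 1 (code w)) = {w} := toSet_single
    rw [Nat.lor_eq, toSet_or, e, e]
    rfl
  have aX : (t.filter (· ∈ toSet X)).card = 2 := by
    have : t.filter (· ∈ toSet X) = {wittBlock, coBlock} := by
      ext y
      rw [Finset.mem_filter, hXx, mt, Finset.mem_insert, Finset.mem_singleton]
      refine ⟨fun h => h.2, fun h => ⟨?_, h⟩⟩
      rcases h with rfl | rfl
      exacts [hx, hco]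
    rw [this, Finset.card_pair (by decide)]
  -- the weighted count
  have s1 := sum_degree_nbrs hW (toSet_wittSphere_subset 6) fun y hy => hTW ((mt y).1 hy)
  have s2 := sum_degree_nbrs hW hXW fun y hy => hTW ((mt y).1 hy)
  have s3 := hbal Set.univ
  have s4 : ∑ y ∈ u, degree (toSet (nbrs (wittSphere 6))) y +
      2 * ∑ y ∈ u, degree (toSet (nbrs X)) y = 4 * u.card := by
    rw [Finset.mul_sum, ← Finset.sum_add_distrib, Finset.sum_const_nat (m := 4), mul_comm]
    intro y hy
    have hy2 := (mu y).1 hy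
    -- A word of `T.2` is not a block: being next to its own neighbour, it would belong to `T.1` as
    -- well.
    have hyY : y ∈ toSet (sdiffMask sixMask wittMask) := by
      rw [toSet_sdiff]
      refine ⟨mem_toSet_sixMask.2 (h2 y hy2), fun hyW => Set.disjoint_left.1 h3 ?_ hy2⟩
      have e : flipWord 0 (flipWord 0 y) = y := flipWord_flipWord 0 y
      rw [← e] at hy2 hyW ⊢
      exact mem_fst_of_flipWord hW hT hTW hy2 hyW
    rw [← c9] at hyY
    rw [Nat.lor_eq, toSet_or, Set.mem_union, mem_toSet_exactMask, mem_toSet_exactMask,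
      mem_toSet_exactMask, mem_toSet_exactMask] at hyY
    omega
  have huniv : ∀ y, degree Set.univ y = 12 := fun y => by
    have : {i : Fin 12 | flipWord i y ∈ (Set.univ : Set (Word 12))} = Set.univ := by simp
    rw [degree, this, Set.ncard_univ, Nat.card_eq_fintype_card, Fintype.card_fin]
  simp only [huniv, Finset.sum_const, smul_eq_mul] at s3
  rw [← hbal, ← hbal] at s4
  -- the disjoint union
  have hdis : ∀ M N : ℕ, Nat.land M N = 0 → ∀ y, y ∈ toSet M → y ∉ toSet N := by
    intro M N h y hM hN
    have : y ∈ toSet (M &&& N) := by rw [toSet_and]; exact ⟨hM, hN⟩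
    have h' : M &&& N = 0 := h
    rw [h', toSet_zero] at this
    exact this
  have s5 : (t.filter (· ∈ toSet X)).card + (t.filter (· ∈ toSet (wittSphere 4))).card +
      (t.filter (· ∈ toSet (wittSphere 8))).card + (t.filter (· ∈ toSet (wittSphere 6))).card ≤
      t.card := by
    rw [Finset.card_filter, Finset.card_filter, Finset.card_filter, Finset.card_filter,
      ← Finset.sum_add_distrib, ← Finset.sum_add_distrib, ← Finset.sum_add_distrib,
      Finset.card_eq_sum_ones]
    refine Finset.sum_le_sum fun y _ => ?_
    have d1 := hdis _ _ c5 y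
    have d2 := hdis _ _ c6 y
    have d3 := hdis _ _ c7 y
    have d4 := hdis _ _ c8 y
    rw [Nat.lor_eq, Nat.lor_eq, toSet_or, toSet_or] at d4
    simp only [Set.mem_union, not_or] at d4
    split_ifs <;> simp_all
  -- Let `n = |T.1|` and let `a₆` count its blocks at distance 6. Then `12 a₆ + 2 * 12 * 2 = 4 n`
  -- and `2 + 25 + 25 + a₆ ≤ n`, whence `n ≥ 72`.
  rw [← htn]
  omega

end Counting

/-- The system is a single orbit, with `wittBlock` as its listed representative, so its
automorphisms are transitive on blocks. -/
theorem exists_permute_wittBlock {w : Word 12} (hw : w ∈ toSet wittMask) :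
    ∃ g, permute g '' toSet wittMask = toSet wittMask ∧ permute g w = wittBlock := by
  have e : toSet wittMask = (trade .t132).1 := by rw [trade_eq]; rfl
  rw [e] at hw ⊢
  obtain ⟨g, hg, r, hr, rfl⟩ := hw
  refine ⟨g⁻¹, permute_image_orbits_eq (inv_mem hg), ?_⟩
  rw [permute_inv_permute, List.mem_singleton.1 hr]
  rfl

/-- Uniqueness moves `W` to the system with mask `wittMask`, and transitivity on blocks moves a word
of `T.1` to `wittBlock`. -/
theorem le_volume {W : Set (Word 12)} {T : Set (Word 12) × Set (Word 12)}
    (hW : IsSteinerSystem 6 12 W) (hT : IsConstantWeightTrade T) (hTW : T.1 ⊆ W) :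
    72 ≤ volume T := by
  obtain ⟨g, hg⟩ := hW.exists_image_eq
  obtain ⟨w, hw⟩ := (isConstantWeightTrade_iff.1 hT).2.2.2.1
  obtain ⟨h, hh, hhw⟩ := exists_permute_wittBlock (w := permute g w)
    (by rw [← hg]; exact Set.mem_image_of_mem _ (hTW hw))
  have key := le_ncard_of_wittBlock_mem (hT.image (h * g)) ?_ ?_
  · rwa [Set.ncard_image_of_injective _ (permute_injective _)] at key
  · change permute (h * g) '' T.1 ⊆ _
    rw [image_permute_mul, ← hh, ← hg]
    exact Set.image_mono (Set.image_mono hTW)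
  · rw [← hhw]
    exact ⟨w, hw, permute_mul h g w⟩

end WittTrades

/-! ### The theorem. -/

theorem mainTheorem5 :
    -- the 25 trades are primary constant-weight trades, of the volumes given by their names
    (∀ i : WittTrades.TradeName,
      WittTrades.IsPrimaryConstantWeightTrade (WittTrades.trade i) ∧
        WittTrades.volume (WittTrades.trade i) = i.nominalVolume) ∧
    -- they are pairwise nonequivalent
    (∀ i j : WittTrades.TradeName,
      WittTrades.Equivalent (WittTrades.trade i) (WittTrades.trade j) → i = j) ∧
    -- exactly the seven named ones are equivalent to the difference pair of two S(5,6,12)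
    (∀ i : WittTrades.TradeName,
      (∃ T : Set (WittTrades.Word 12) × Set (WittTrades.Word 12), WittTrades.IsWittDifference T ∧
        WittTrades.Equivalent T (WittTrades.trade i)) ↔ i ∈ WittTrades.wittNames) ∧
    -- these seven are themselves difference pairs
    (∀ i ∈ WittTrades.wittNames, WittTrades.IsWittDifference (WittTrades.trade i)) ∧
    -- every difference pair of two S(5,6,12) is equivalent to one of the seven
    (∀ T : Set (WittTrades.Word 12) × Set (WittTrades.Word 12), WittTrades.IsWittDifference T →
      ∃ i ∈ WittTrades.wittNames, WittTrades.Equivalent T (WittTrades.trade i)) ∧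
    -- the smallest trade contained in an S(5,6,12) has volume 72
    IsLeast {v : ℕ | ∃ (W : Set (WittTrades.Word 12))
        (T : Set (WittTrades.Word 12) × Set (WittTrades.Word 12)),
      WittTrades.IsSteinerSystem 6 12 W ∧ WittTrades.IsConstantWeightTrade T ∧ T.1 ⊆ W ∧
        WittTrades.volume T = v} 72 := by
  refine ⟨fun i => ⟨WittTrades.isPrimaryConstantWeightTrade_trade i,
      (WittTrades.isConstantWeightTrade_trade i).2⟩, fun i j => WittTrades.eq_of_equivalent,
    WittTrades.exists_isWittDifference_iff, fun i hi => ?_, fun T hT => hT.exists_equivalent,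
    ?_, ?_⟩
  · obtain ⟨n, hn, rfl⟩ := WittTrades.exists_wittName_eq hi
    exact WittTrades.isWittDifference_wittName hn
  -- The bound is attained by 72b, which is `wittName 0`; its first component lies in the system
  -- with mask `wittFst 0`.
  · refine ⟨_, _, WittTrades.isSteinerSystem_wittFst 0,
      (WittTrades.isConstantWeightTrade_trade .t72b).1, ?_,
      (WittTrades.isConstantWeightTrade_trade .t72b).2⟩
    have h := WittTrades.trade_wittName (n := 0) (by norm_num)
    change WittTrades.trade .t72b = _ at h
    rw [h]
    exact Set.sdiff_subset
  · rintro _ ⟨W, T, hW, hT, hTW, rfl⟩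
    exact WittTrades.le_volume hW hT hTW
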